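/- **Setting.** Let $r,T\ge1$ and let $\mu_j,s_j,d_j\ge1$ ($1\le j\le r$) be integers. Put $\chi(x)=\prod_{j}(1-x^{\mu_js_j})^{d_j}=\sum_k e(k)x^k$, $n=\sum_j\mu_js_jd_j$, $\beta(i\lambda)=\prod_j\prod_{|k|\le[s_j/2]}(i\lambda-2\pi ik/s_j)^{d_j}$, $w(\lambda)=|\chi(e^{-i\lambda})|^2/|\beta(i\lambda)|^2$, $\sum_k d(k)x^k=\chi(x)^{-1}$. A *spectral density* is an integrable $f:(-\pi,\pi]\to\mathbb C^{T\times T}$ with $f(\lambda)\ge0$ a.e. A $\mathbb C^T$-valued sequence $\vec\xi(m)$, $m\in\mathbb Z$, has stationary generalized multiple (GM) increments with spectral density $f$ if all its increments $\chi(B)\vec\xi$ ($B$ the backward shift), for arbitrary positive steps $\mu$, $\mu'$, are centred and square integrable and $\mathsf E\,\chi_{\mu}(B)\xi_p(m)\overline{\chi_{\mu'}(B)\xi_q(k)}=\frac1{2\pi}\int_{-\pi}^{\pi}e^{i\lambda(m-k)}\chi_\mu(e^{-i\lambda})\overline{\chi_{\mu'}(e^{-i\lambda})}|\beta(i\lambda)|^{-2}f_{pq}(\lambda)\,d\lambda$.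 Let $\vec a(k)\in\mathbb C^T$, $k\ge0$, be such that $\vec b(k)=(D\mathbf a)_k=\sum_{m\ge k}d(m-k)\vec a(m)$ converges for every $k$ and $\sum\|\vec a(k)\|$, $\sum(k+1)\|\vec a(k)\|^2$, $\sum\|\vec b(k)\|$, $\sum(k+1)\|\vec b(k)\|^2$ are finite; put $\vec B(e^{i\lambda})=\sum_{k\ge0}\vec b(k)e^{ik\lambda}$. The functional $A\vec\xi=\sum_{k\ge0}\vec a(k)^\top\vec\xi(k)$ is understood as $A\vec\xi=\sum_{k\ge0}\vec b(k)^\top\chi(B)\vec\xi(k)-V\vec\xi$, where the series converges in mean square and $V\vec\xi=\sum_{k=-n}^{-1}\bigl(\sum_{l=0}^{k+n}e(l-k)\vec b(l)\bigr)^\top\vec\xi(k)$ is observed. It is estimated from $\vec\xi(m)$, $m\le-1$, by $\eta-V\vec\xi$ with $\eta$ in the closed span of the increments $\chi(B)\xi_p(m)$, $m\le-1$. In $L_2(f)$, $\|h\|_f^2=\frac1{2\pi}\int h^\top f\bar h\,d\lambda$, let $L_2^{0-}(f)$ be the closed span of $e^{i\lambda k}\chi(e^{-i\lambda})\beta(i\lambda)^{-1}\boldsymbol\delta_p$,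 $k\le-1$, $1\le p\le T$. Put $\Delta(h;f)=\|\vec B\chi/\beta-h\|_f^2$ and $\Delta(f)=\min_{h\in L_2^{0-}(f)}\Delta(h;f)$; the minimizer is the spectral characteristic of the optimal estimate. For a class $\mathcal D$ of densities, $f_0\in\mathcal D$ is *least favourable* if $\Delta(f_0)=\max_{f\in\mathcal D}\Delta(f)$, and $h^0\in H_{\mathcal D}=\bigcap_{f\in\mathcal D}L_2^{0-}(f)$ is *minimax-robust* if $\sup_{f\in\mathcal D}\Delta(h^0;f)=\min_{h\in H_{\mathcal D}}\sup_{f\in\mathcal D}\Delta(h;f)$. The *minimality condition* on $f$: $f$ is invertible a.e. and $\int\operatorname{Tr}[w(\lambda)^{-1}f(\lambda)^{-1}]d\lambda<\infty$. With $G=wf$, let $\mathbf F$ be the operator with matrix entries $F(j,k)=\frac1{2\pi}\int e^{i\lambda(k-j)}(G(\lambda)^{-1})^\top d\lambda$, $j,k\ge0$. The equation $\mathbf F\mathbf c=D\mathbf a$ is understood in the domain of the closed quadratic form of $\mathbf F$: $C(\lambda)=\sum_{k\ge0}\vec c(k)e^{ik\lambda}$ is the Fourier series of an integrable function with $\int C^\top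 G^{-1}\bar C\,d\lambda<\infty$, and the $j$-th Fourier coefficient of $(G^{-1})^\top C$ is $\vec b(j)$ for every $j\ge0$. The classes of spectral densities are: $\mathcal D_0^1$: $\frac1{2\pi}\int wf\,d\lambda=P$; $\mathcal D_0^2$: $\frac1{2\pi}\int w\operatorname{Tr}f\,d\lambda=p$; $\mathcal D_0^3$: $\frac1{2\pi}\int wf_{kk}\,d\lambda=p_k$, $1\le k\le T$; $\mathcal D_0^4$: $\frac1{2\pi}\int w\operatorname{Tr}(B_1f)\,d\lambda=p$. Here $p,p_k$ are given real numbers and $P,B_1$ given positive definite Hermitian matrices. The corresponding multiplier matrices $\Lambda$ are: $\vec\alpha\vec\alpha^*$ with $\vec\alpha\in\mathbb C^T$; $\alpha^2I$; $\operatorname{diag}(\alpha_1^2,\dots,\alpha_T^2)$; $\alpha^2B_1^\top$ (with $\alpha,\alpha_k\in\mathbb R$). **Theorem.** For every sequence $\vec\xi$ with stationary GM increments and spectral density $f$, the mean square error of the optimal linear estimate of $A\vec\xi$ is $\Delta(f)$. For every spectral density that satisfies the minimality condition, $\mathbf F\mathbf c=D\mathbf a$ has exactly one solution $\mathbf c=\mathbf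 F^{-1}D\mathbf a$. Let $\mathcal D$ be any of $\mathcal D_0^1,\dots,\mathcal D_0^4$, let $f_0\in\mathcal D$ satisfy the minimality condition, $G_0=wf_0$, with $\mathbf F^0$ its operator and $C_0(\lambda)=\sum_{k\ge0}((\mathbf F^0)^{-1}D\mathbf a)_ke^{ik\lambda}$. The following are equivalent: 1. $f_0$ is least favourable in $\mathcal D$ for the optimal linear estimation of $A\vec\xi$; 2. for some multiplier matrix $\Lambda$ of the class, $C_0(\lambda)C_0(\lambda)^*=G_0(\lambda)^\top\Lambda\,G_0(\lambda)^\top$ for a.e. $\lambda$; 3. $f_0$ solves the constrained optimization problem $\max\langle D\mathbf a,\mathbf F^{-1}D\mathbf a\rangle=\langle D\mathbf a,(\mathbf F^0)^{-1}D\mathbf a\rangle$ over the $f\in\mathcal D$ that satisfy the minimality condition. If moreover $G_0=\Phi\Phi^*$ a.e. is a canonical factorization, that is, $\Phi(e^{-i\lambda})=\sum_{k\ge0}\varphi(k)e^{-ik\lambda}$ with $\varphi(k)\in\mathbb C^{T\times q}$ square summable and the rows of $I_q$ in the mean square closure of the functions $(\sum_{n<N}x(n)e^{-in\lambda})^\top\Phi(e^{-i\lambda})$,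 $x(n)\in\mathbb C^T$, then 1–3 are also equivalent to 4. for some multiplier matrix $\Lambda$ of the class, $R(\lambda)R(\lambda)^*=\Phi(e^{-i\lambda})^\top\Lambda\,\overline{\Phi(e^{-i\lambda})}$ for a.e. $\lambda$, where $R(\lambda)=\sum_{k\ge0}\bigl(\sum_{m\ge0}\varphi(m)^\top\vec b(m+k)\bigr)e^{ik\lambda}$. If $f_0$ is least favourable in $\mathcal D$, then $$h(\lambda)^\top=\vec B(e^{i\lambda})^\top\frac{\chi(e^{-i\lambda})}{\beta(i\lambda)}-\frac{\overline{\beta(i\lambda)}}{\chi(e^{i\lambda})}C_0(\lambda)^\top f_0(\lambda)^{-1}$$ is the spectral characteristic of the optimal estimate under $f_0$, and it is, up to equality a.e., the unique minimax-robust spectral characteristic for $\mathcal D$. -/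

import Mathlib

open MeasureTheory Filter Topology Matrix
open scoped ENNReal ComplexOrder

noncomputable section

namespace GMForecast

/-! ## The increment operator -/

/-- The data `(μ, s, d)` of a generalized multiple (GM) increment: steps, seasonal periods and
orders of the factors `(1 - B ^ (μ i * s i)) ^ d i`, where `B` is the backward shift. -/
structure GMType where
  r : ℕ
  r_pos : 0 < r
  mu : Fin r → ℕ
  s : Fin r → ℕ
  d : Fin r → ℕ
  mu_pos : ∀ i, 0 < mu i
  s_pos : ∀ i, 0 < s i
  d_pos : ∀ i, 0 < d i

/-- The same seasonal periods and orders, with other positive steps. -/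
def GMType.withSteps (γ : GMType) (nu : Fin γ.r → ℕ) (h : ∀ i, 0 < nu i) : GMType :=
  { γ with mu := nu, mu_pos := h }

/-- The increment polynomial `χ(x) = ∏ (1 - x ^ (μ i * s i)) ^ d i`; its coefficients are the
numbers `e_γ(k)`. -/
def incrPoly (γ : GMType) : Polynomial ℂ :=
  ∏ i, (1 - Polynomial.X ^ (γ.mu i * γ.s i)) ^ γ.d i

/-- `n(γ) = ∑ μ i * s i * d i`, the degree of the increment polynomial. -/
def order (γ : GMType) : ℕ := ∑ i, γ.mu i * γ.s i * γ.d i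

/-- The GM increment `χ(B) ξ` of a vector-valued stochastic sequence. -/
def incr {Ω : Type*} {T : ℕ} (γ : GMType) (ξ : ℤ → Ω → Fin T → ℂ) (m : ℤ) (ω : Ω) : Fin T → ℂ :=
  ∑ k ∈ Finset.range (order γ + 1), (incrPoly γ).coeff k • ξ (m - k) ω

/-- `χ(e^{-iλ})`. -/
def chi (γ : GMType) (l : ℝ) : ℂ := (incrPoly γ).eval (Complex.exp (-Complex.I * l))

/-- `β(iλ) = ∏_j ∏_{|k| ≤ [s_j / 2]} (iλ - 2πik / s_j) ^ d_j`. -/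
def beta (γ : GMType) (l : ℝ) : ℂ :=
  ∏ j, ∏ k ∈ Finset.Icc (-((γ.s j : ℤ) / 2)) ((γ.s j : ℤ) / 2),
    (Complex.I * l - 2 * Real.pi * Complex.I * (k : ℂ) / (γ.s j : ℂ)) ^ γ.d j

/-- The weight `|χ(e^{-iλ})|² / |β(iλ)|²`. -/
def weight (γ : GMType) (l : ℝ) : ℝ := ‖chi γ l‖ ^ 2 / ‖beta γ l‖ ^ 2

/-- Coefficients of `∏_i (∑_j x ^ (μ i * s i * j)) ^ d i`, the power series inverse to the
increment polynomial. -/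
def dCoeff (γ : GMType) (k : ℕ) : ℂ :=
  PowerSeries.coeff k
    (∏ i, (PowerSeries.mk fun n => if γ.mu i * γ.s i ∣ n then (1 : ℂ) else 0) ^ γ.d i)

/-- The terms of the series `(D a)_k = ∑_{m ≥ k} d(m - k) a(m)`. -/
def dTerm {T : ℕ} (γ : GMType) (a : ℕ → Fin T → ℂ) (k m : ℕ) : Fin T → ℂ :=
  dCoeff γ m • a (k + m)

/-- `b(k) = (D a)_k = ∑_{m ≥ k} d(m - k) a(m)`, the limit of the partial sums. -/
def dTransform {T : ℕ} (γ : GMType) (a : ℕ → Fin T → ℂ) (k : ℕ) : Fin T → ℂ :=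
  ∑'[SummationFilter.conditional ℕ] m, dTerm γ a k m

/-- The standing conditions on the coefficients of the functional `∑ a(k)ᵀ ξ(k)`: the series that
define `D a` converge, and `a` and `D a` satisfy the two summability conditions. -/
structure AdmissibleCoeffs {T : ℕ} (γ : GMType) (a : ℕ → Fin T → ℂ) : Prop where
  converges : ∀ k, Summable (dTerm γ a k) (SummationFilter.conditional ℕ)
  summable : Summable fun k => ‖a k‖
  summable_sq : Summable fun k : ℕ => ((k : ℝ) + 1) * ‖a k‖ ^ 2
  summable_d : Summable fun k => ‖dTransform γ a k‖
  summable_sq_d : Summable fun k : ℕ => ((k : ℝ) + 1) * ‖dTransform γ a k‖ ^ 2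

/-! ## Spectral densities and trigonometric series -/

/-- Lebesgue measure on `(-π, π]`. -/
def circ : Measure ℝ := volume.restrict (Set.Ioc (-Real.pi) Real.pi)

/-- `f` is a matrix spectral density: integrable on `(-π, π]` and positive semidefinite a.e. -/
structure IsSpectralDensity {T : ℕ} (f : ℝ → Matrix (Fin T) (Fin T) ℂ) : Prop where
  integrable : ∀ i j, Integrable (fun l => f l i j) circ
  posSemidef : ∀ᵐ l ∂circ, (f l).PosSemidef

/-- `(|χ(e^{-iλ})|² / |β(iλ)|²) f(λ)`. -/
def weighted {T : ℕ} (γ : GMType) (f : ℝ → Matrix (Fin T) (Fin T) ℂ) (l : ℝ) :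
    Matrix (Fin T) (Fin T) ℂ :=
  (weight γ l : ℂ) • f l

/-- The minimality condition: `f` is invertible a.e. and
`∫ Tr[(|β(iλ)|² / |χ(e^{-iλ})|²) f(λ)⁻¹] dλ < ∞`. -/
def Minimal {T : ℕ} (γ : GMType) (f : ℝ → Matrix (Fin T) (Fin T) ℂ) : Prop :=
  (∀ᵐ l ∂circ, IsUnit (f l).det) ∧
    Integrable (fun l => (((weight γ l : ℂ)⁻¹) • (f l)⁻¹).trace) circ

/-- The Fourier coefficient `(1 / 2π) ∫ u(λ) e^{-ikλ} dλ`. -/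
def fcoeff (u : ℝ → ℂ) (k : ℤ) : ℂ :=
  (1 / (2 * Real.pi) : ℂ) * ∫ l, u l * Complex.exp (-Complex.I * k * l) ∂circ

/-- `u` is the sum of the trigonometric series `∑_{k ∈ ℤ} c(k) e^{ikλ}`: the (a.e. unique)
integrable function with these Fourier coefficients. -/
def IsTrigSum (c : ℤ → ℂ) (u : ℝ → ℂ) : Prop :=
  Integrable u circ ∧ ∀ k, fcoeff u k = c k

/-- `C` is the sum of `∑_{k ≥ 0} c(k) e^{ikλ}`, for vectors `c(k)`. -/
def IsAnalyticSum {q : ℕ} (c : ℕ → Fin q → ℂ) (C : ℝ → Fin q → ℂ) : Prop :=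
  ∀ p, IsTrigSum (fun k => if 0 ≤ k then c k.toNat p else 0) fun l => C l p

/-- `B(e^{iλ}) = ∑_{k ≥ 0} b(k) e^{ikλ}`, for an absolutely summable `b`. -/
def bSeries {T : ℕ} (b : ℕ → Fin T → ℂ) (l : ℝ) : Fin T → ℂ :=
  ∑' k : ℕ, Complex.exp (Complex.I * k * l) • b k

/-! ## Estimates and their errors -/

/-- The squared norm of `L₂(f)`: `(1 / 2π) ∫ h(λ)ᵀ f(λ) conj h(λ) dλ`. -/
def sqNorm {T : ℕ} (f : ℝ → Matrix (Fin T) (Fin T) ℂ) (h : ℝ → Fin T → ℂ) : ℝ≥0∞ :=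
  ENNReal.ofReal (1 / (2 * Real.pi)) *
    ∫⁻ l, ENNReal.ofReal (h l ⬝ᵥ (f l *ᵥ star (h l))).re ∂circ

/-- Finite linear combinations of the functions `e^{iλk} χ(e^{-iλ}) β(iλ)⁻¹ δ_p`, `k ≤ -1`. -/
def pastPoly {T : ℕ} (γ : GMType) (N : ℕ) (x : ℕ → Fin T → ℂ) (l : ℝ) : Fin T → ℂ :=
  (chi γ l / beta γ l) •
    ∑ n ∈ Finset.range N, Complex.exp (-Complex.I * (n + 1) * l) • x n

/-- `h` belongs to `L₂^{0-}(f)`, the closed span in `L₂(f)` of the functions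
`e^{iλk} χ(e^{-iλ}) β(iλ)⁻¹ δ_p`, `k ≤ -1`. -/
def MemPast {T : ℕ} (γ : GMType) (f : ℝ → Matrix (Fin T) (Fin T) ℂ) (h : ℝ → Fin T → ℂ) : Prop :=
  AEStronglyMeasurable h circ ∧
    ∀ ε : ℝ≥0∞, 0 < ε → ∃ N x, sqNorm f (fun l => h l - pastPoly γ N x l) < ε

/-- `Δ(h; f)`: the mean square error, under the spectral density `f`, of the estimate with spectral
characteristic `h`; here `b = D a`. -/
def err {T : ℕ} (γ : GMType) (b : ℕ → Fin T → ℂ) (h : ℝ → Fin T → ℂ)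
    (f : ℝ → Matrix (Fin T) (Fin T) ℂ) : ℝ≥0∞ :=
  sqNorm f fun l => (chi γ l / beta γ l) • bSeries b l - h l

/-- `Δ(f) = Δ(h(f); f)`: the mean square error of the optimal estimate. -/
def optErr {T : ℕ} (γ : GMType) (b : ℕ → Fin T → ℂ) (f : ℝ → Matrix (Fin T) (Fin T) ℂ) : ℝ≥0∞ :=
  ⨅ (h : ℝ → Fin T → ℂ) (_ : MemPast γ f h), err γ b h f

/-- `h` is the spectral characteristic of the optimal estimate under the density `f`. -/
def IsOptimal {T : ℕ} (γ : GMType) (b : ℕ → Fin T → ℂ) (f : ℝ → Matrix (Fin T) (Fin T) ℂ)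
    (h : ℝ → Fin T → ℂ) : Prop :=
  MemPast γ f h ∧ err γ b h f = optErr γ b f

/-- `f₀` is least favourable in the class `D`. -/
def LeastFavourable {T : ℕ} (γ : GMType) (b : ℕ → Fin T → ℂ)
    (D : Set (ℝ → Matrix (Fin T) (Fin T) ℂ)) (f₀ : ℝ → Matrix (Fin T) (Fin T) ℂ) : Prop :=
  f₀ ∈ D ∧ ∀ f ∈ D, optErr γ b f ≤ optErr γ b f₀

/-- `h` is a minimax-robust spectral characteristic for the class `D`: it lies in
`H_D = ⋂_{f ∈ D} L₂^{0-}(f)` and minimizes over `H_D` the largest error on `D`. -/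
def IsMinimax {T : ℕ} (γ : GMType) (b : ℕ → Fin T → ℂ)
    (D : Set (ℝ → Matrix (Fin T) (Fin T) ℂ)) (h : ℝ → Fin T → ℂ) : Prop :=
  (∀ f ∈ D, MemPast γ f h) ∧
    ∀ h' : ℝ → Fin T → ℂ, (∀ f ∈ D, MemPast γ f h') →
      (⨆ f ∈ D, err γ b h f) ≤ ⨆ f ∈ D, err γ b h' f

/-! ## Stochastic sequences -/

/-- `ξ` is a vector-valued stochastic sequence with stationary GM increments and spectral density
`f`: all its GM increments (with arbitrary positive steps) are centred, square integrable and have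
the structural function given by `f`. -/
structure HasSpectralDensity {Ω : Type*} [MeasurableSpace Ω] {T : ℕ} (γ : GMType) (P : Measure Ω)
    (ξ : ℤ → Ω → Fin T → ℂ) (f : ℝ → Matrix (Fin T) (Fin T) ℂ) : Prop where
  measurable : ∀ m p, AEStronglyMeasurable (fun ω => ξ m ω p) P
  memLp : ∀ nu hnu m p, MemLp (fun ω => incr (γ.withSteps nu hnu) ξ m ω p) 2 P
  mean : ∀ nu hnu m p, ∫ ω, incr (γ.withSteps nu hnu) ξ m ω p ∂P = 0
  structural : ∀ nu hnu nu' hnu' (m k : ℤ) (p q : Fin T),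
    ∫ ω, incr (γ.withSteps nu hnu) ξ m ω p * star (incr (γ.withSteps nu' hnu') ξ k ω q) ∂P =
      (1 / (2 * Real.pi) : ℂ) * ∫ l, Complex.exp (Complex.I * l * (m - k)) *
        (chi (γ.withSteps nu hnu) l * star (chi (γ.withSteps nu' hnu') l)
          / ((‖beta γ l‖ ^ 2 : ℝ) : ℂ)) * f l p q ∂circ

/-- `V ξ = ∑_{k = -n(γ)}^{-1} v(k)ᵀ ξ(k)`, `v(k) = ∑_{l = 0}^{k + n(γ)} e_γ(l - k) b(l)`; in the
sum below `k = -(i + 1)`. -/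
def initialPart {Ω : Type*} {T : ℕ} (γ : GMType) (b : ℕ → Fin T → ℂ) (ξ : ℤ → Ω → Fin T → ℂ)
    (ω : Ω) : ℂ :=
  ∑ i ∈ Finset.range (order γ),
    (∑ l ∈ Finset.range (order γ - i), (incrPoly γ).coeff (l + (i + 1)) • b l) ⬝ᵥ
      ξ (-((i : ℤ) + 1)) ω

/-- `A` is the functional `∑_{k ≥ 0} a(k)ᵀ ξ(k)`, understood as
`∑_{k ≥ 0} b(k)ᵀ χ(ξ(k)) - V ξ` with `b = D a`, the first series converging in mean square. -/
def IsFunctional {Ω : Type*} [MeasurableSpace Ω] {T : ℕ} (γ : GMType) (P : Measure Ω)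
    (b : ℕ → Fin T → ℂ) (ξ : ℤ → Ω → Fin T → ℂ) (A : Ω → ℂ) : Prop :=
  AEStronglyMeasurable A P ∧
    Tendsto (fun n : ℕ => eLpNorm (fun ω => (∑ k ∈ Finset.range n, b k ⬝ᵥ incr γ ξ k ω)
      - initialPart γ b ξ ω - A ω) 2 P) atTop (𝓝 0)

/-- Linear estimates of the functional from the observations `ξ(m)`, `m ≤ -1`: a finite linear
combination of the observed increments minus the observed initial part `V ξ`. -/
def estimate {Ω : Type*} {T : ℕ} (γ : GMType) (b : ℕ → Fin T → ℂ) (ξ : ℤ → Ω → Fin T → ℂ)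
    (N : ℕ) (x : ℕ → Fin T → ℂ) (ω : Ω) : ℂ :=
  (∑ n ∈ Finset.range N, x n ⬝ᵥ incr γ ξ (-((n : ℤ) + 1)) ω) - initialPart γ b ξ ω

/-! ## The operator `F` and its inverse -/

/-- The matrix entries `F(j, k) = (1 / 2π) ∫ e^{iλ(k - j)} (G(λ)⁻¹)ᵀ dλ` of the operator `F`, where
`G(λ) = (|χ(e^{-iλ})|² / |β(iλ)|²) f(λ)`. -/
def fEntry {T : ℕ} (γ : GMType) (f : ℝ → Matrix (Fin T) (Fin T) ℂ) (j k : ℕ) :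
    Matrix (Fin T) (Fin T) ℂ :=
  Matrix.of fun p q => fcoeff (fun l => (weighted γ f l)⁻¹ q p) ((j : ℤ) - k)

/-- The operator `F` in symbol form: the Fourier coefficients, with indices `j ≥ 0`, of
`(G(λ)⁻¹)ᵀ C(λ)`. On finite sums `C(λ) = ∑ c(k) e^{ikλ}` it is `∑_k F(j, k) c(k)`, see
`fApply_eq_sum`. -/
def fApply {T : ℕ} (γ : GMType) (f : ℝ → Matrix (Fin T) (Fin T) ℂ) (C : ℝ → Fin T → ℂ) (j : ℕ)
    (p : Fin T) : ℂ :=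
  fcoeff (fun l => (((weighted γ f l)⁻¹)ᵀ *ᵥ C l) p) j

theorem fApply_eq_sum {T : ℕ} (γ : GMType) (f : ℝ → Matrix (Fin T) (Fin T) ℂ)
    (hf : ∀ p q, Integrable (fun l => (weighted γ f l)⁻¹ p q) circ)
    (n : ℕ) (c : ℕ → Fin T → ℂ) (j : ℕ) (p : Fin T) :
    fApply γ f (fun l => ∑ k ∈ Finset.range n, Complex.exp (Complex.I * k * l) • c k) j p =
      ∑ k ∈ Finset.range n, (fEntry γ f j k *ᵥ c k) p := by
  have key : ∀ (k : ℕ) (q : Fin T), Integrable (fun l : ℝ => (weighted γ f l)⁻¹ q p *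
      Complex.exp (-Complex.I * (((j : ℤ) - k : ℤ) : ℂ) * l)) circ := by
    intro k q
    refine (hf q p).mul_bdd (c := 1) (by fun_prop) (ae_of_all _ fun l => ?_)
    rw [Complex.norm_exp]
    simp
  have e1 : ∀ l : ℝ, (((weighted γ f l)⁻¹)ᵀ *ᵥ
      (∑ k ∈ Finset.range n, Complex.exp (Complex.I * k * l) • c k)) p *
        Complex.exp (-Complex.I * ((j : ℤ) : ℂ) * l) =
      ∑ k ∈ Finset.range n, ∑ q, c k q * ((weighted γ f l)⁻¹ q p *
        Complex.exp (-Complex.I * (((j : ℤ) - k : ℤ) : ℂ) * l)) := by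
    intro l
    simp only [mulVec, dotProduct, Finset.sum_apply, Pi.smul_apply, smul_eq_mul, transpose_apply,
      Finset.mul_sum, Finset.sum_mul]
    rw [Finset.sum_comm]
    refine Finset.sum_congr rfl fun k _ => Finset.sum_congr rfl fun q _ => ?_
    have : Complex.exp (-Complex.I * (((j : ℤ) - k : ℤ) : ℂ) * l) =
        Complex.exp (Complex.I * k * l) * Complex.exp (-Complex.I * ((j : ℤ) : ℂ) * l) := by
      rw [← Complex.exp_add]
      congr 1
      push_cast
      ring
    rw [this]
    ring
  unfold fApply fcoeff
  simp only [e1]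
  rw [integral_finsetSum _ fun k _ => integrable_finsetSum _ fun q _ => (key k q).const_mul _,
    Finset.mul_sum]
  refine Finset.sum_congr rfl fun k _ => ?_
  rw [integral_finsetSum _ fun q _ => (key k q).const_mul _, Finset.mul_sum]
  simp only [mulVec, dotProduct, fEntry, of_apply, fcoeff, integral_const_mul]
  refine Finset.sum_congr rfl fun q _ => ?_
  ring

/-- `C(λ) = ∑_{k ≥ 0} (F⁻¹ b)_k e^{ikλ}`: the coefficients of `C` solve `F c = b`, in the domain of
the closed quadratic form of `F` (`C` has finite energy `∫ C(λ)ᵀ G(λ)⁻¹ conj C(λ) dλ`). -/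
structure IsFInverse {T : ℕ} (γ : GMType) (f : ℝ → Matrix (Fin T) (Fin T) ℂ)
    (b : ℕ → Fin T → ℂ) (C : ℝ → Fin T → ℂ) : Prop where
  integrable : ∀ p, Integrable (fun l => C l p) circ
  analytic : ∀ p (k : ℤ), k < 0 → fcoeff (fun l => C l p) k = 0
  energy : sqNorm (fun l => (weighted γ f l)⁻¹) C < ∞
  solves : ∀ j p, fApply γ f C j p = b j p

/-- `⟨b, F⁻¹ b⟩ = ∑_k b(k)ᵀ conj (F⁻¹ b)_k`, with `F⁻¹ b` the Fourier coefficients of `C`. -/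
def fInvForm {T : ℕ} (b : ℕ → Fin T → ℂ) (C : ℝ → Fin T → ℂ) : ℝ :=
  (∑' k : ℕ, ∑ p, b k p * star (fcoeff (fun l => C l p) k)).re

/-- The spectral characteristic
`h(λ)ᵀ = B(e^{iλ})ᵀ χ(e^{-iλ}) / β(iλ) - (conj β(iλ) / χ(e^{iλ})) C(λ)ᵀ f(λ)⁻¹`. -/
def charact {T : ℕ} (γ : GMType) (b : ℕ → Fin T → ℂ) (f : ℝ → Matrix (Fin T) (Fin T) ℂ)
    (C : ℝ → Fin T → ℂ) (l : ℝ) : Fin T → ℂ :=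
  (chi γ l / beta γ l) • bSeries b l - (star (beta γ l) / star (chi γ l)) • (C l ᵥ* (f l)⁻¹)

/-! ## Canonical factorization -/

/-- `Φ(e^{-iλ}) = ∑_{k ≥ 0} φ(k) e^{-ikλ}` is the canonical factor of
`G(λ) = (|χ(e^{-iλ})|² / |β(iλ)|²) f(λ)`. Canonical means that in `χ(ξ(m)) = ∑ φ(k) ε(m - k)` the
innovations `ε(0)` belong to the closed span of `χ(ξ(m))`, `m ≤ 0`: the rows of the identity matrix
are mean square limits of `(∑_{n < N} x(n) e^{-inλ})ᵀ Φ(e^{-iλ})`. -/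
structure IsCanonicalFactor {T q : ℕ} (γ : GMType) (f : ℝ → Matrix (Fin T) (Fin T) ℂ)
    (φ : ℕ → Matrix (Fin T) (Fin q) ℂ) (Φ : ℝ → Matrix (Fin T) (Fin q) ℂ) : Prop where
  square_summable : ∀ i j, Summable fun k => ‖φ k i j‖ ^ 2
  series : ∀ i j, IsTrigSum (fun k => if k ≤ 0 then φ (-k).toNat i j else 0) fun l => Φ l i j
  factor : ∀ᵐ l ∂circ, weighted γ f l = Φ l * (Φ l)ᴴ
  innovation : ∀ (j : Fin q) (ε : ℝ≥0∞), 0 < ε → ∃ (N : ℕ) (x : ℕ → Fin T → ℂ),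
    ∑ i, ∫⁻ l, ‖((∑ n ∈ Finset.range N, Complex.exp (-Complex.I * n * l) • x n) ᵥ* Φ l) i
      - (1 : Matrix (Fin q) (Fin q) ℂ) j i‖ₑ ^ 2 ∂circ < ε

/-- `(D A φ)_k = ∑_m φ(m)ᵀ ∑_{l ≥ k} d(l - k) a(m + l) = ∑_m φ(m)ᵀ (D a)_{m + k}`; here
`b = D a`. -/
def rCoeff {T q : ℕ} (b : ℕ → Fin T → ℂ) (φ : ℕ → Matrix (Fin T) (Fin q) ℂ) (k : ℕ) : Fin q → ℂ :=
  ∑' m : ℕ, (φ m)ᵀ *ᵥ b (m + k)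

/-! ## The classes of spectral densities -/

/-- `MomentClass γ D S`: `D` is one of the four moment classes of spectral densities, and `S` is the
set of matrices formed by the Lagrange multipliers that belong to it. -/
inductive MomentClass {T : ℕ} (γ : GMType) :
    Set (ℝ → Matrix (Fin T) (Fin T) ℂ) → Set (Matrix (Fin T) (Fin T) ℂ) → Prop
  | total (P : Matrix (Fin T) (Fin T) ℂ) (hP : P.PosDef) :
      MomentClass γ
        {f | IsSpectralDensity f ∧
          ∀ i j, (1 / (2 * Real.pi) : ℂ) * ∫ l, (weight γ l : ℂ) * f l i j ∂circ = P i j}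
        {L | ∃ α : Fin T → ℂ, L = vecMulVec α (star α)}
  | trace (p : ℝ) :
      MomentClass γ
        {f | IsSpectralDensity f ∧
          (1 / (2 * Real.pi) : ℂ) * ∫ l, (weight γ l : ℂ) * (f l).trace ∂circ = p}
        {L | ∃ α : ℝ, L = ((α ^ 2 : ℝ) : ℂ) • (1 : Matrix (Fin T) (Fin T) ℂ)}
  | diag (p : Fin T → ℝ) :
      MomentClass γ
        {f | IsSpectralDensity f ∧
          ∀ k, (1 / (2 * Real.pi) : ℂ) * ∫ l, (weight γ l : ℂ) * f l k k ∂circ = p k}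
        {L | ∃ α : Fin T → ℝ, L = Matrix.diagonal fun k => ((α k ^ 2 : ℝ) : ℂ)}
  | inner (B₁ : Matrix (Fin T) (Fin T) ℂ) (hB₁ : B₁.PosDef) (p : ℝ) :
      MomentClass γ
        {f | IsSpectralDensity f ∧
          (1 / (2 * Real.pi) : ℂ) * ∫ l, (weight γ l : ℂ) * (B₁ * f l).trace ∂circ = p}
        {L | ∃ α : ℝ, L = ((α ^ 2 : ℝ) : ℂ) • B₁ᵀ}

end GMForecast

end

/-!
# Minimax-robust forecasting of sequences with stationary GM increments

Put `G = w f`. Dividing by the transfer function `χ / β`, which is bounded and a.e. nonzero, turns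
the problem under the density `f` into the projection, in `L₂(G)`, of the absolutely convergent
series `B = ∑ b(k) e^{ikλ}` onto the closed span of the functions `e^{ikλ} δ_p`, `k < 0` (the past);
see `memPast_iff` and `optErr_eq`. The isometry between increments and trigonometric polynomials
identifies the error of this projection with the mean square error of the optimal estimate
(`HasSpectralDensity.iInf_lintegral_estimate`).

**The equation `F c = D a`.** Let `f` satisfy the minimality condition, so that `G⁻¹` is integrable
and elements of `L₂(G)` have Fourier coefficients. Let `r` be the residual of the projection and
`C = Gᵀ r`. Orthogonality to the past says that `C` is analytic (`orthogonal_iff_fcoeff`), and the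
coefficients of `(G⁻¹)ᵀ C = r` of index `k ≥ 0` are the `b(k)`; so `C` solves the equation. If `C` is
the difference of two solutions, the energy `∫ Cᵀ G⁻¹ conj C = ∫ Cᵀ conj r` pairs the analytic
function `C` with `conj r`, which has only coefficients of index `k ≥ 1`. The integrand is integrable
although the factors need not be square integrable, and its mean vanishes by a boundary form of Smirnov's
theorem, `integral_sum_mul_eq_zero`. The latter is proved with bounded outer functions, obtained as
residuals of scalar projections (`exists_outer`). Hence the solution is unique, and the optimal error
is `⟨D a, F⁻¹ D a⟩` (`IsSolution.fInvForm_eq`).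

**Multipliers.** In terms of `r` the equation `C₀ C₀* = G₀ᵀ Λ G₀ᵀ` reads `r r* = Λ`, and so does
the equation with the canonical factor `Φ`, since `R = Φᵀ r` (`IsCanonicalFactor.ae_eq`). If it
holds then `r` is bounded, and, by Smirnov's theorem again, `B - r` belongs to the past of *every*
density (`pastLim_of_bounded`). Its error `∫ Tr(Λᵀ G)` is a combination of the moments that define the
class, hence constant on the class; so `f₀` is least favourable. Conversely, let `f₀` be least
favourable and let `ρ` be a scalar lower bound of `f₀`. The perturbations `f₀ + t ρ ψ X`, with `X`
Hermitian and `ψ` bounded, show that `∫ w ρ ψ rᵀ X conj r = 0` whenever they preserve the moments.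
Taking `ψ` of zero mean shows that `r r*` is constant, and taking `ψ = 1` and `X` invisible to the
moments shows that it is a multiplier matrix of the class (`MomentForm.exists_multiplier`).

**The optimization problem.** As an infimum of linear functions of `f`, the optimal error is concave.
Midpoints with `f₀` satisfy the minimality condition, so that maximality among such densities
implies maximality in the class (`MomentForm.isMax_iff`).

**The minimax estimate.** For a least favourable `f₀` the estimate `B - r` has the same error on the
whole class, equal to the optimal error under `f₀`. Any other minimax-robust estimate has at most
this error under `f₀`, and agrees with `B - r` by Pythagoras (`MomentForm.isMinimax_iff`).
-/

noncomputable section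

namespace GMForecast

/-! ### Positive semidefinite forms on `ℂ^T` -/

/-- The sesquilinear form `xᵀ A conj y`. -/
def herm {T : ℕ} (A : Matrix (Fin T) (Fin T) ℂ) (x y : Fin T → ℂ) : ℂ := x ⬝ᵥ (A *ᵥ star y)

/-- The real part of `xᵀ A conj x`, the integrand of `sqNorm`. -/
def quad {T : ℕ} (A : Matrix (Fin T) (Fin T) ℂ) (x : Fin T → ℂ) : ℝ := (herm A x x).re

section Pointwise

variable {T : ℕ} {A : Matrix (Fin T) (Fin T) ℂ}

/-- A positive semidefinite form is the pull-back of the standard inner product; all the pointwise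
inequalities below are read off from this. -/
theorem exists_herm_eq_inner (hA : A.PosSemidef) :
    ∃ L : (Fin T → ℂ) →ₗ[ℂ] EuclideanSpace ℂ (Fin T), ∀ x y, herm A x y = inner ℂ (L y) (L x) := by
  obtain ⟨X, rfl⟩ : ∃ X : Matrix (Fin T) (Fin T) ℂ, A = Xᴴ * X := by
    open scoped MatrixOrder in
    exact CStarAlgebra.nonneg_iff_eq_star_mul_self.mp hA.nonneg
  refine ⟨(WithLp.linearEquiv 2 ℂ (Fin T → ℂ)).symm.toLinearMap ∘ₗ Xᴴ.vecMulLinear,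
    fun x y => ?_⟩
  rw [EuclideanSpace.inner_eq_star_dotProduct]
  simp only [herm, LinearMap.comp_apply, LinearEquiv.coe_coe, vecMulLinear_apply,
    WithLp.linearEquiv_symm_apply]
  rw [← mulVec_mulVec, dotProduct_mulVec]
  congr 1
  simp [star_vecMul]

theorem herm_smul_left (c : ℂ) (x y : Fin T → ℂ) : herm A (c • x) y = c * herm A x y := by
  simp [herm]

theorem herm_smul_right (c : ℂ) (x y : Fin T → ℂ) : herm A x (c • y) = star c * herm A x y := by
  simp [herm, mulVec_smul]

theorem herm_add_right (x y z : Fin T → ℂ) : herm A x (y + z) = herm A x y + herm A x z := by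
  simp [herm, mulVec_add, dotProduct_add]

theorem herm_sub_left (x y z : Fin T → ℂ) : herm A (x - y) z = herm A x z - herm A y z := by
  simp [herm, sub_dotProduct]

theorem herm_sub_right (x y z : Fin T → ℂ) : herm A x (y - z) = herm A x y - herm A x z := by
  simp [herm, mulVec_sub, dotProduct_sub]

theorem herm_swap (hA : A.PosSemidef) (x y : Fin T → ℂ) : herm A y x = star (herm A x y) := by
  obtain ⟨L, hL⟩ := exists_herm_eq_inner hA
  rw [hL, hL]
  exact (inner_conj_symm _ _).symm

theorem herm_self (hA : A.PosSemidef) (x : Fin T → ℂ) : herm A x x = quad A x := by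
  have h := herm_swap hA x x
  exact (Complex.conj_eq_iff_re.1 h.symm).symm

theorem quad_nonneg (hA : A.PosSemidef) (x : Fin T → ℂ) : 0 ≤ quad A x := by
  obtain ⟨L, hL⟩ := exists_herm_eq_inner hA
  rw [quad, hL]
  exact inner_self_nonneg (𝕜 := ℂ)

theorem norm_herm_le (hA : A.PosSemidef) (x y : Fin T → ℂ) :
    ‖herm A x y‖ ≤ √(quad A x) * √(quad A y) := by
  obtain ⟨L, hL⟩ := exists_herm_eq_inner hA
  have h : ∀ x, √(quad A x) = ‖L x‖ := fun x => by
    rw [quad, hL]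
    exact (norm_eq_sqrt_re_inner (𝕜 := ℂ) (L x)).symm
  rw [h, h, hL, mul_comm]
  exact norm_inner_le_norm _ _

theorem norm_herm_sq_le (hA : A.PosSemidef) (x y : Fin T → ℂ) :
    ‖herm A x y‖ ^ 2 ≤ quad A x * quad A y := by
  have h := norm_herm_le hA x y
  calc _ ≤ (√(quad A x) * √(quad A y)) ^ 2 := by gcongr
    _ = _ := by rw [mul_pow, Real.sq_sqrt (quad_nonneg hA x), Real.sq_sqrt (quad_nonneg hA y)]

theorem norm_herm_le_add (hA : A.PosSemidef) (x y : Fin T → ℂ) :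
    ‖herm A x y‖ ≤ quad A x + quad A y := by
  have h := norm_herm_sq_le hA x y
  have hx := quad_nonneg hA x
  have hy := quad_nonneg hA y
  nlinarith [norm_nonneg (herm A x y)]

theorem quad_smul (c : ℂ) (x : Fin T → ℂ) : quad A (c • x) = ‖c‖ ^ 2 * quad A x := by
  rw [quad, herm_smul_left, herm_smul_right, ← mul_assoc, Complex.star_def, Complex.mul_conj,
    Complex.normSq_eq_norm_sq, Complex.re_ofReal_mul, quad]

theorem quad_neg (x : Fin T → ℂ) : quad A (-x) = quad A x := by
  have := quad_smul (A := A) (-1) x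
  simpa using this

theorem quad_sub (hA : A.PosSemidef) (x y : Fin T → ℂ) :
    quad A (x - y) = quad A x - 2 * (herm A x y).re + quad A y := by
  have h : (herm A y x).re = (herm A x y).re := by rw [herm_swap hA x y]; simp
  rw [quad, herm_sub_left, herm_sub_right, herm_sub_right]
  simp only [Complex.sub_re, quad, h]
  ring

theorem quad_add_le (hA : A.PosSemidef) (x y : Fin T → ℂ) :
    quad A (x + y) ≤ 2 * quad A x + 2 * quad A y := by
  have h1 := quad_sub hA x (-y)
  have h2 := quad_nonneg hA (x - y)
  rw [quad_sub hA] at h2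
  have h3 : herm A x (-y) = - herm A x y := by
    have := herm_smul_right (A := A) (-1) x y
    simpa using this
  rw [quad_neg, h3, sub_neg_eq_add, Complex.neg_re] at h1
  linarith

theorem quad_sub_le (hA : A.PosSemidef) (x y : Fin T → ℂ) :
    quad A (x - y) ≤ 2 * quad A x + 2 * quad A y := by
  have := quad_add_le hA x (-y)
  rwa [quad_neg, ← sub_eq_add_neg] at this

/-- The parallelogram law, in the form used for minimizing sequences. -/
theorem quad_parallelogram (hA : A.PosSemidef) (z x y : Fin T → ℂ) :
    quad A (x - y) = 2 * quad A (z - x) + 2 * quad A (z - y)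
      - 4 * quad A (z - (2⁻¹ : ℂ) • (x + y)) := by
  rw [quad_sub hA z x, quad_sub hA z y, quad_sub hA z, quad_smul, quad_sub hA x y,
    herm_smul_right, herm_add_right]
  have h1 := quad_sub hA x (-y)
  have h3 : herm A x (-y) = - herm A x y := by
    have := herm_smul_right (A := A) (-1) x y
    simpa using this
  rw [quad_neg, h3, sub_neg_eq_add, Complex.neg_re] at h1
  have h4 : (star (2⁻¹ : ℂ)) = ((2⁻¹ : ℝ) : ℂ) := by simp
  rw [h4, Complex.re_ofReal_mul, Complex.add_re, h1]
  simp
  ring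

theorem herm_single_right (x : Fin T → ℂ) (p : Fin T) :
    herm A x (Pi.single p 1) = (Aᵀ *ᵥ x) p := by
  have : star (Pi.single p (1 : ℂ) : Fin T → ℂ) = Pi.single p 1 := by
    rw [← Pi.single_star, star_one]
  rw [herm, this, mulVec_single_one, dotProduct_comm]
  simp [mulVec, dotProduct, transpose_apply]

theorem quad_single (p : Fin T) : quad A (Pi.single p 1) = (A p p).re := by
  rw [quad, herm_single_right]
  simp

theorem norm_transpose_mulVec_sq_le (hA : A.PosSemidef) (x : Fin T → ℂ) (p : Fin T) :
    ‖(Aᵀ *ᵥ x) p‖ ^ 2 ≤ quad A x * (A p p).re := by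
  rw [← herm_single_right, ← quad_single (A := A)]
  exact norm_herm_sq_le hA _ _

theorem herm_eq_dotProduct_transpose (hA : A.PosSemidef) (x y : Fin T → ℂ) :
    herm A x y = x ⬝ᵥ star (Aᵀ *ᵥ y) := by
  rw [herm, star_mulVec, hA.transpose.isHermitian.eq, vecMul_transpose]

theorem herm_eq_transpose_dotProduct (x y : Fin T → ℂ) : herm A x y = (Aᵀ *ᵥ x) ⬝ᵥ star y := by
  rw [herm, dotProduct_mulVec, mulVec_transpose]

/-- `‖x‖` is controlled by the form of an invertible matrix and the diagonal of the inverse. -/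
theorem norm_apply_sq_le (hA : A.PosSemidef) (hu : IsUnit A.det) (x : Fin T → ℂ) (p : Fin T) :
    ‖x p‖ ^ 2 ≤ quad A x * (A⁻¹ p p).re := by
  have h := norm_transpose_mulVec_sq_le hA.inv (Aᵀ *ᵥ x) p
  have e : (A⁻¹)ᵀ *ᵥ (Aᵀ *ᵥ x) = x := by
    rw [mulVec_mulVec, ← transpose_mul, mul_nonsing_inv _ hu, transpose_one, one_mulVec]
  rw [e] at h
  have e2 : quad A⁻¹ (Aᵀ *ᵥ x) = quad A x := by
    rw [quad, herm_eq_dotProduct_transpose hA.inv, e, quad, herm_eq_transpose_dotProduct]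
  rwa [e2] at h

/-- The form of `A⁻¹` at `Aᵀ x` is the form of `A` at `x`. -/
theorem herm_inv (hA : A.PosSemidef) (hu : IsUnit A.det) (x y : Fin T → ℂ) :
    herm A⁻¹ x y = herm A ((A⁻¹)ᵀ *ᵥ x) ((A⁻¹)ᵀ *ᵥ y) := by
  rw [herm_eq_transpose_dotProduct (A := A), mulVec_mulVec, ← transpose_mul,
    nonsing_inv_mul _ hu, transpose_one, one_mulVec, herm_eq_dotProduct_transpose hA.inv]

theorem sum_norm_sq_le (hA : A.PosSemidef) (hu : IsUnit A.det) (x : Fin T → ℂ) :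
    ∑ p, ‖x p‖ ^ 2 ≤ quad A x * (A⁻¹).trace.re := by
  calc _ ≤ ∑ p, quad A x * (A⁻¹ p p).re := Finset.sum_le_sum fun p _ => norm_apply_sq_le hA hu x p
    _ = _ := by simp [← Finset.mul_sum, Matrix.trace]

theorem norm_herm_le_sum (x y : Fin T → ℂ) :
    ‖herm A x y‖ ≤ (∑ i, ∑ j, ‖A i j‖) * (‖x‖ * ‖y‖) := by
  simp only [herm, dotProduct, mulVec, Finset.sum_mul, Finset.mul_sum]
  refine (norm_sum_le _ _).trans (Finset.sum_le_sum fun i _ => (norm_sum_le _ _).trans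
    (Finset.sum_le_sum fun j _ => ?_))
  rw [norm_mul, norm_mul, Pi.star_apply, norm_star]
  have h1 := norm_le_pi_norm x i
  have h2 := norm_le_pi_norm y j
  calc _ = ‖A i j‖ * (‖x i‖ * ‖y j‖) := by ring
    _ ≤ _ := by gcongr

theorem quad_le_sum (x : Fin T → ℂ) : quad A x ≤ (∑ i, ∑ j, ‖A i j‖) * ‖x‖ ^ 2 := by
  rw [sq]
  exact ((Complex.re_le_norm _).trans (norm_herm_le_sum x x))

theorem eq_zero_of_quad_eq_zero (hA : A.PosSemidef) (hu : IsUnit A.det) {x : Fin T → ℂ}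
    (hx : quad A x = 0) : x = 0 := by
  ext p
  have h := norm_apply_sq_le hA hu x p
  rw [hx, zero_mul] at h
  have : ‖x p‖ = 0 := by nlinarith [norm_nonneg (x p)]
  simpa using this

end Pointwise

/-! ### Fourier coefficients on `(-π, π]` -/

instance : IsFiniteMeasure circ := by
  unfold circ; infer_instance

theorem circ_real_univ : circ.real Set.univ = 2 * Real.pi := by
  have : 0 ≤ Real.pi + Real.pi := by positivity
  simp [circ, Measure.real, this, two_mul]

/-- The exponential `e^{ikλ}`. -/
def expo (k : ℤ) (l : ℝ) : ℂ := Complex.exp (Complex.I * k * l)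

theorem expo_zero : expo 0 = fun _ => 1 := by
  ext; simp [expo]

theorem expo_add (j k : ℤ) (l : ℝ) : expo (j + k) l = expo j l * expo k l := by
  rw [expo, expo, expo, ← Complex.exp_add]
  congr 1
  push_cast
  ring

theorem star_expo (k : ℤ) (l : ℝ) : star (expo k l) = expo (-k) l := by
  rw [expo, expo, Complex.star_def, ← Complex.exp_conj]
  congr 1
  simp

@[simp] theorem norm_expo (k : ℤ) (l : ℝ) : ‖expo k l‖ = 1 := by
  simp [expo, Complex.norm_exp]

@[fun_prop] theorem continuous_expo (k : ℤ) : Continuous (expo k) := by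
  unfold expo; fun_prop

theorem integrable_mul_expo {u : ℝ → ℂ} (hu : Integrable u circ) (k : ℤ) :
    Integrable (fun l => u l * expo k l) circ :=
  hu.mul_bdd (c := 1) (by fun_prop) (ae_of_all _ fun l => by simp)

theorem fcoeff_eq (u : ℝ → ℂ) (k : ℤ) :
    fcoeff u k = (1 / (2 * Real.pi) : ℂ) * ∫ l, u l * expo (-k) l ∂circ := by
  unfold fcoeff expo
  congr 2
  ext l
  congr 2
  push_cast
  ring

theorem neg_pi_lt_pi : -Real.pi < Real.pi := by linarith [Real.pi_pos]

theorem fourier_coe_eq_expo (n : ℤ) (l : ℝ) :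
    fourier n (l : AddCircle (Real.pi - -Real.pi)) = expo n l := by
  rw [fourier_coe_apply, expo]
  congr 1
  have : (Real.pi : ℂ) ≠ 0 := by exact_mod_cast Real.pi_ne_zero
  push_cast
  field_simp
  ring

theorem fcoeff_eq_fourierCoeffOn (u : ℝ → ℂ) (k : ℤ) :
    fcoeff u k = fourierCoeffOn neg_pi_lt_pi u k := by
  rw [fcoeff_eq, fourierCoeffOn_eq_integral, intervalIntegral.integral_of_le neg_pi_lt_pi.le,
    Complex.real_smul]
  congr 1
  · push_cast; ring
  · simp only [fourier_coe_eq_expo, circ, smul_eq_mul, mul_comm]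

theorem fcoeff_congr {u v : ℝ → ℂ} (h : u =ᵐ[circ] v) (k : ℤ) : fcoeff u k = fcoeff v k := by
  rw [fcoeff_eq, fcoeff_eq]
  congr 1
  refine integral_congr_ae ?_
  filter_upwards [h] with l hl
  rw [hl]

theorem fcoeff_add {u v : ℝ → ℂ} (hu : Integrable u circ) (hv : Integrable v circ) (k : ℤ) :
    fcoeff (fun l => u l + v l) k = fcoeff u k + fcoeff v k := by
  simp only [fcoeff_eq, add_mul]
  rw [integral_add (integrable_mul_expo hu _) (integrable_mul_expo hv _), mul_add]

theorem fcoeff_sub {u v : ℝ → ℂ} (hu : Integrable u circ) (hv : Integrable v circ) (k : ℤ) :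
    fcoeff (fun l => u l - v l) k = fcoeff u k - fcoeff v k := by
  simp only [fcoeff_eq, sub_mul]
  rw [integral_sub (integrable_mul_expo hu _) (integrable_mul_expo hv _), mul_sub]

theorem fcoeff_const_mul (c : ℂ) (u : ℝ → ℂ) (k : ℤ) :
    fcoeff (fun l => c * u l) k = c * fcoeff u k := by
  simp only [fcoeff_eq, mul_assoc]
  rw [integral_const_mul]
  ring

theorem fcoeff_sum {ι : Type*} (s : Finset ι) {u : ι → ℝ → ℂ}
    (hu : ∀ i ∈ s, Integrable (u i) circ) (k : ℤ) :
    fcoeff (fun l => ∑ i ∈ s, u i l) k = ∑ i ∈ s, fcoeff (u i) k := by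
  simp only [fcoeff_eq, Finset.sum_mul]
  rw [integral_finsetSum _ fun i hi => integrable_mul_expo (hu i hi) _, Finset.mul_sum]

theorem fcoeff_expo_mul (m : ℤ) (u : ℝ → ℂ) (k : ℤ) :
    fcoeff (fun l => expo m l * u l) k = fcoeff u (k - m) := by
  simp only [fcoeff_eq]
  congr 2
  ext l
  rw [show -(k - m) = m + -k by ring, expo_add]
  ring

theorem fcoeff_star (u : ℝ → ℂ) (k : ℤ) : fcoeff (fun l => star (u l)) k = star (fcoeff u (-k)) := by
  simp only [fcoeff_eq, star_mul']
  congr 1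
  · simp
  · rw [Complex.star_def, ← integral_conj]
    congr 1
    ext l
    rw [map_mul]
    congr 1
    rw [← Complex.star_def, star_expo, neg_neg]

theorem fcoeff_one (k : ℤ) : fcoeff (fun _ => 1) k = if k = 0 then 1 else 0 := by
  have hp : (Real.pi : ℂ) ≠ 0 := by exact_mod_cast Real.pi_ne_zero
  rw [fcoeff_eq]
  split_ifs with h
  · subst h
    simp [expo_zero, circ_real_univ]
    field_simp
  · have hk : (Complex.I * (-k : ℤ)) ≠ 0 := by simp [h]
    simp only [one_mul, circ]
    rw [← intervalIntegral.integral_of_le neg_pi_lt_pi.le]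
    unfold expo
    rw [integral_exp_mul_complex hk]
    have : Complex.exp (Complex.I * (-k : ℤ) * (Real.pi : ℝ)) =
        Complex.exp (Complex.I * (-k : ℤ) * (-Real.pi : ℝ)) := by
      rw [Complex.exp_eq_exp_iff_exists_int]
      exact ⟨-k, by push_cast; ring⟩
    rw [this]
    simp

theorem fcoeff_expo (m k : ℤ) : fcoeff (expo m) k = if k = m then 1 else 0 := by
  have := fcoeff_expo_mul m (fun _ => 1) k
  simp only [mul_one] at this
  rw [show expo m = fun l => expo m l from rfl, this, fcoeff_one]
  simp [sub_eq_zero]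

theorem norm_fcoeff_le (u : ℝ → ℂ) (k : ℤ) :
    ‖fcoeff u k‖ ≤ 1 / (2 * Real.pi) * ∫ l, ‖u l‖ ∂circ := by
  rw [fcoeff_eq, norm_mul]
  have : ‖(1 / (2 * Real.pi) : ℂ)‖ = 1 / (2 * Real.pi) := by
    rw [show (1 / (2 * Real.pi) : ℂ) = ((1 / (2 * Real.pi) : ℝ) : ℂ) by push_cast; rfl,
      Complex.norm_real, Real.norm_of_nonneg (by positivity)]
  rw [this]
  gcongr
  refine (norm_integral_le_integral_norm _).trans (le_of_eq ?_)
  simp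

/-- Fourier coefficients are continuous in the mean. -/
theorem fcoeff_tendsto {ι : Type*} {F : Filter ι} {u : ι → ℝ → ℂ} {v : ℝ → ℂ}
    (hu : ∀ i, Integrable (u i) circ) (hv : Integrable v circ)
    (h : Tendsto (fun i => ∫ l, ‖v l - u i l‖ ∂circ) F (𝓝 0)) (k : ℤ) :
    Tendsto (fun i => fcoeff (u i) k) F (𝓝 (fcoeff v k)) := by
  rw [tendsto_iff_norm_sub_tendsto_zero]
  have h2 := h.const_mul (1 / (2 * Real.pi))
  rw [mul_zero] at h2
  refine squeeze_zero (fun _ => norm_nonneg _) (fun i => ?_) h2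
  rw [norm_sub_rev, ← fcoeff_sub hv (hu i)]
  exact norm_fcoeff_le _ _

/-- A continuous function on the circle is integrated to `0` against a function all of whose
Fourier coefficients vanish. -/
theorem integral_continuousMap_mul_eq_zero {h : ℝ → ℂ} (hi : Integrable h circ)
    (h0 : ∀ k, fcoeff h k = 0) (φ : C(AddCircle (Real.pi - -Real.pi), ℂ)) :
    ∫ l, φ (l : AddCircle (Real.pi - -Real.pi)) * h l ∂circ = 0 := by
  have : Fact (0 < Real.pi - -Real.pi) := ⟨by linarith [Real.pi_pos]⟩
  have key : ∀ φ : C(AddCircle (Real.pi - -Real.pi), ℂ),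
      Integrable (fun l : ℝ => φ (l : AddCircle (Real.pi - -Real.pi)) * h l) circ := fun φ =>
    hi.bdd_mul (c := ‖φ‖)
      ((φ.continuous.comp (AddCircle.continuous_mk' _)).aestronglyMeasurable)
      (ae_of_all _ fun l => φ.norm_coe_le_norm _)
  let Λ : C(AddCircle (Real.pi - -Real.pi), ℂ) →ₗ[ℂ] ℂ :=
    { toFun := fun φ => ∫ l, φ (l : AddCircle (Real.pi - -Real.pi)) * h l ∂circ
      map_add' := fun φ ψ => by
        simp only [ContinuousMap.add_apply, add_mul]
        exact integral_add (key φ) (key ψ)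
      map_smul' := fun c φ => by
        simp only [ContinuousMap.smul_apply, smul_eq_mul, mul_assoc, RingHom.id_apply]
        exact integral_const_mul _ _ }
  have hb : ∀ φ, ‖Λ φ‖ ≤ (∫ l, ‖h l‖ ∂circ) * ‖φ‖ := fun φ => by
    rw [mul_comm, ← integral_const_mul]
    refine norm_integral_le_of_norm_le (hi.norm.const_mul _) (ae_of_all _ fun l => ?_)
    rw [norm_mul]
    gcongr
    exact φ.norm_coe_le_norm _
  let Λc := Λ.mkContinuous _ hb
  have hle : Submodule.span ℂ (Set.range (@fourier (Real.pi - -Real.pi))) ≤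
      LinearMap.ker (Λc : C(AddCircle (Real.pi - -Real.pi), ℂ) →ₗ[ℂ] ℂ) := by
    rw [Submodule.span_le]
    rintro _ ⟨n, rfl⟩
    have h1 := h0 (-n)
    rw [fcoeff_eq, neg_neg] at h1
    have hp : (1 / (2 * Real.pi) : ℂ) ≠ 0 := by
      have : (Real.pi : ℂ) ≠ 0 := by exact_mod_cast Real.pi_ne_zero
      simp [this]
    have h2 := (mul_eq_zero.1 h1).resolve_left hp
    change ∫ l, fourier n (l : AddCircle (Real.pi - -Real.pi)) * h l ∂circ = 0
    simp only [fourier_coe_eq_expo]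
    simpa only [mul_comm] using h2
  have hcl := Submodule.topologicalClosure_minimal _ hle Λc.isClosed_ker
  rw [span_fourier_closure_eq_top] at hcl
  exact hcl (Submodule.mem_top (x := φ))

/-- An integrable function is determined a.e. by its Fourier coefficients. -/
theorem ae_eq_zero_of_fcoeff_eq_zero {h : ℝ → ℂ} (hi : Integrable h circ)
    (h0 : ∀ k, fcoeff h k = 0) : h =ᵐ[circ] 0 := by
  have : Fact (0 < Real.pi - -Real.pi) := ⟨by linarith [Real.pi_pos]⟩
  have hloc : LocallyIntegrableOn h (Set.Ioo (-Real.pi) Real.pi) volume := by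
    have : IntegrableOn h (Set.Ioc (-Real.pi) Real.pi) volume := hi
    exact (this.mono_set Set.Ioo_subset_Ioc_self).locallyIntegrableOn
  have hmain := isOpen_Ioo.ae_eq_zero_of_integral_contDiff_smul_eq_zero hloc fun g hg _ hsupp => ?_
  · have hr : ∀ᵐ x ∂volume.restrict (Set.Ioo (-Real.pi) Real.pi), h x = 0 :=
      (ae_restrict_iff' measurableSet_Ioo).2 hmain
    rw [Measure.restrict_congr_set Ioo_ae_eq_Ioc] at hr
    exact hr
  · have hend : ∀ x ∉ Set.Ioo (-Real.pi) Real.pi, g x = 0 := fun x hx =>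
      image_eq_zero_of_notMem_tsupport fun hx' => hx (hsupp hx')
    have hper : (fun x => (g x : ℂ)) (-Real.pi) =
        (fun x => (g x : ℂ)) (-Real.pi + (Real.pi - -Real.pi)) := by
      simp [hend (-Real.pi) (by simp), hend Real.pi (by simp)]
    have hcont : Continuous (AddCircle.liftIoc (Real.pi - -Real.pi) (-Real.pi)
        (fun x => (g x : ℂ))) :=
      AddCircle.liftIoc_continuous hper
        (Complex.continuous_ofReal.comp hg.continuous).continuousOn
    have h1 := integral_continuousMap_mul_eq_zero hi h0 ⟨_, hcont⟩
    rw [← setIntegral_eq_integral_of_forall_compl_eq_zero (s := Set.Ioc (-Real.pi) Real.pi)]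
    · rw [← h1]
      refine setIntegral_congr_fun measurableSet_Ioc fun x hx => ?_
      have hx' : x ∈ Set.Ioc (-Real.pi) (-Real.pi + (Real.pi - -Real.pi)) := by simpa using hx
      simp only [ContinuousMap.coe_mk, AddCircle.liftIoc_coe_apply hx', Complex.real_smul]
    · intro x hx
      rw [hend x fun h' => hx (Set.Ioo_subset_Ioc_self h'), zero_smul]

theorem ae_eq_of_fcoeff_eq {u v : ℝ → ℂ} (hu : Integrable u circ) (hv : Integrable v circ)
    (h : ∀ k, fcoeff u k = fcoeff v k) : u =ᵐ[circ] v := by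
  have := ae_eq_zero_of_fcoeff_eq_zero (hu.sub hv) fun k => by
    have := fcoeff_sub hu hv k
    rw [h, sub_self] at this
    exact this
  filter_upwards [this] with l hl
  exact sub_eq_zero.1 hl

/-- Parseval's identity. -/
theorem hasSum_norm_fcoeff_sq {F : ℝ → ℂ} (hF : MemLp F 2 circ) :
    HasSum (fun k => ‖fcoeff F k‖ ^ 2) ((2 * Real.pi)⁻¹ * ∫ l, ‖F l‖ ^ 2 ∂circ) := by
  have h := hasSum_sq_fourierCoeffOn neg_pi_lt_pi hF
  rw [intervalIntegral.integral_of_le neg_pi_lt_pi.le] at h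
  simp only [← fcoeff_eq_fourierCoeffOn, sub_neg_eq_add, ← two_mul, smul_eq_mul] at h
  exact h

/-- Square integrable functions whose spectra do not meet are orthogonal. -/
theorem integral_mul_eq_zero_of_fcoeff {F H : ℝ → ℂ} (hF : MemLp F 2 circ) (hH : MemLp H 2 circ)
    (h : ∀ k, fcoeff F k = 0 ∨ fcoeff H (-k) = 0) : ∫ l, F l * H l ∂circ = 0 := by
  have hFi : Integrable F circ := hF.integrable (by norm_num)
  have hHi : Integrable H circ := hH.integrable (by norm_num)
  have hFH : Integrable (fun l => F l * H l) circ := hF.integrable_mul hH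
  have hH' : MemLp (fun l => star (H l)) 2 circ := hH.star
  have hHi' : Integrable (fun l => star (H l)) circ := hH'.integrable (by norm_num)
  -- The norm of `F + c conj H` is computed twice: pointwise and on the Fourier side.
  have key : ∀ c : ℂ, ‖c‖ = 1 → (star c * ∫ l, F l * H l ∂circ).re = 0 := by
    intro c hc
    have hc2 : MemLp (fun l => c * star (H l)) 2 circ := hH'.const_mul c
    have s1 := (hasSum_norm_fcoeff_sq hF).add (hasSum_norm_fcoeff_sq hc2)
    have s2 := hasSum_norm_fcoeff_sq (hF.add hc2)
    have e : (fun k => ‖fcoeff (F + fun l => c * star (H l)) k‖ ^ 2) =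
        fun k => ‖fcoeff F k‖ ^ 2 + ‖fcoeff (fun l => c * star (H l)) k‖ ^ 2 := by
      ext k
      have e1 := fcoeff_add hFi (hHi'.const_mul c) k
      have e2 : fcoeff (fun l => c * star (H l)) k = c * star (fcoeff H (-k)) := by
        rw [fcoeff_const_mul, fcoeff_star]
      rw [show (F + fun l => c * star (H l)) = fun l => F l + c * star (H l) from rfl, e1, e2]
      rcases h k with h | h <;> simp [h]
    rw [e] at s2
    have s3 := s1.unique s2
    rw [← mul_add] at s3
    have s4 := mul_left_cancel₀ (by positivity : (2 * Real.pi)⁻¹ ≠ 0) s3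
    have i1 : Integrable (fun l => ‖F l‖ ^ 2) circ := hF.integrable_norm_pow (by norm_num)
    have i2 : Integrable (fun l => ‖c * star (H l)‖ ^ 2) circ :=
      hc2.integrable_norm_pow (by norm_num)
    have i3 : Integrable (fun l => 2 * (star c * (F l * H l)).re) circ :=
      ((hFH.const_mul (star c)).re).const_mul 2
    have e3 : ∀ l, ‖(F + fun l => c * star (H l)) l‖ ^ 2 =
        (‖F l‖ ^ 2 + ‖c * star (H l)‖ ^ 2) + 2 * (star c * (F l * H l)).re := by
      intro l
      simp only [Pi.add_apply, ← Complex.normSq_eq_norm_sq, Complex.normSq_add, Complex.star_def,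
        map_mul, Complex.conj_conj]
      congr 3
      ring
    simp only [e3] at s4
    have i4 : Integrable (fun l => ‖F l‖ ^ 2 + ‖c * star (H l)‖ ^ 2) circ := i1.add i2
    rw [integral_add i4 i3, integral_add i1 i2, integral_const_mul] at s4
    have s5 : ∫ l, (star c * (F l * H l)).re ∂circ = 0 := by linarith
    have s6 := integral_re (hFH.const_mul (star c))
    rw [integral_const_mul] at s6
    exact s6.symm.trans s5
  have k1 := key 1 (by simp)
  have k2 := key Complex.I (by simp)
  apply Complex.ext
  · simpa using k1
  · simpa using k2

/-! ### The space `L₂(G)` -/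

/-- `h` is an element of `L₂(G)`. -/
structure MemL2 {T : ℕ} (G : ℝ → Matrix (Fin T) (Fin T) ℂ) (h : ℝ → Fin T → ℂ) : Prop where
  aesm : AEStronglyMeasurable h circ
  integrable : Integrable (fun l => quad (G l) (h l)) circ

/-- The squared norm `∫ hᵀ G conj h` of `L₂(G)`, without the factor `1 / 2π`. -/
def nrm {T : ℕ} (G : ℝ → Matrix (Fin T) (Fin T) ℂ) (h : ℝ → Fin T → ℂ) : ℝ :=
  ∫ l, quad (G l) (h l) ∂circ

/-- A density that is invertible a.e. and has an integrable inverse. -/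
structure IsMinDensity {T : ℕ} (G : ℝ → Matrix (Fin T) (Fin T) ℂ) : Prop
    extends IsSpectralDensity G where
  isUnit_det : ∀ᵐ l ∂circ, IsUnit (G l).det
  integrable_inv : Integrable (fun l => ((G l)⁻¹).trace) circ

/-- A pointwise bound `f² ≤ a b` passes to the integrals. -/
theorem integrable_and_sq_integral_norm_le {α E : Type*} [MeasurableSpace α]
    [NormedAddCommGroup E] {μ : Measure α}
    {f : α → E} {a b : α → ℝ} (hf : AEStronglyMeasurable f μ) (ha : Integrable a μ)
    (hb : Integrable b μ) (ha0 : 0 ≤ᵐ[μ] a) (hb0 : 0 ≤ᵐ[μ] b)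
    (h : ∀ᵐ x ∂μ, ‖f x‖ ^ 2 ≤ a x * b x) :
    Integrable f μ ∧ (∫ x, ‖f x‖ ∂μ) ^ 2 ≤ (∫ x, a x ∂μ) * ∫ x, b x ∂μ := by
  have hfi : Integrable f μ := by
    refine (ha.add hb).mono' hf ?_
    filter_upwards [ha0, hb0, h] with x h1 h2 h3
    simp only [Pi.zero_apply, Pi.add_apply] at *
    nlinarith [norm_nonneg (f x)]
  refine ⟨hfi, ?_⟩
  have hA : 0 ≤ ∫ x, a x ∂μ := integral_nonneg_of_ae ha0
  have hB : 0 ≤ ∫ x, b x ∂μ := integral_nonneg_of_ae hb0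
  have key : ∀ t : ℝ, 0 ≤ (∫ x, a x ∂μ) * (t * t) + (-2 * ∫ x, ‖f x‖ ∂μ) * t + ∫ x, b x ∂μ := by
    intro t
    have h1 : ∫ x, (2 * t) * ‖f x‖ ∂μ ≤ ∫ x, (t * t) * a x + b x ∂μ := by
      refine integral_mono_ae (hfi.norm.const_mul _) ((ha.const_mul _).add hb) ?_
      filter_upwards [ha0, hb0, h] with x h1 h2 h3
      simp only [Pi.zero_apply] at *
      rcases le_or_gt t 0 with ht | ht
      · nlinarith [norm_nonneg (f x), mul_nonneg (mul_self_nonneg t) h1,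
          mul_nonneg (neg_nonneg.2 ht) (norm_nonneg (f x))]
      · have h4 : (2 * t * ‖f x‖) ^ 2 ≤ (t * t * a x + b x) ^ 2 := by
          nlinarith [mul_le_mul_of_nonneg_left h3 (mul_self_nonneg t),
            sq_nonneg (t * t * a x - b x)]
        exact le_of_sq_le_sq h4 (by positivity)
    rw [integral_const_mul, integral_add (ha.const_mul _) hb, integral_const_mul] at h1
    linarith
  have := discrim_le_zero key
  rw [discrim] at this
  nlinarith

section L2

variable {T : ℕ} {G : ℝ → Matrix (Fin T) (Fin T) ℂ}

theorem aesm_apply {ι : Type*} [Fintype ι] {h : ℝ → ι → ℂ} (hh : AEStronglyMeasurable h circ)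
    (p : ι) : AEStronglyMeasurable (fun l => h l p) circ :=
  (continuous_apply p).comp_aestronglyMeasurable hh

theorem aesm_pi {ι : Type*} [Fintype ι] {h : ℝ → ι → ℂ}
    (hh : ∀ p, AEStronglyMeasurable (fun l => h l p) circ) : AEStronglyMeasurable h circ :=
  (aemeasurable_pi_iff.2 fun p => (hh p).aemeasurable).aestronglyMeasurable

theorem aesm_herm (hG : ∀ i j, AEStronglyMeasurable (fun l => G l i j) circ)
    {h g : ℝ → Fin T → ℂ} (hh : AEStronglyMeasurable h circ) (hg : AEStronglyMeasurable g circ) :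
    AEStronglyMeasurable (fun l => herm (G l) (h l) (g l)) circ := by
  simp only [herm, dotProduct, mulVec, Pi.star_apply]
  refine Finset.aestronglyMeasurable_fun_sum _ fun i _ => (aesm_apply hh i).mul
    (Finset.aestronglyMeasurable_fun_sum _ fun j _ => (hG i j).mul ?_)
  exact continuous_star.comp_aestronglyMeasurable (aesm_apply hg j)

theorem IsSpectralDensity.aesm (hG : IsSpectralDensity G) (i j : Fin T) :
    AEStronglyMeasurable (fun l => G l i j) circ := (hG.integrable i j).aestronglyMeasurable

theorem aesm_quad (hG : IsSpectralDensity G) {h : ℝ → Fin T → ℂ}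
    (hh : AEStronglyMeasurable h circ) :
    AEStronglyMeasurable (fun l => quad (G l) (h l)) circ :=
  Complex.continuous_re.comp_aestronglyMeasurable (aesm_herm hG.aesm hh hh)

theorem memL2_of_bounded (hG : IsSpectralDensity G) {h : ℝ → Fin T → ℂ}
    (hh : AEStronglyMeasurable h circ) {M : ℝ} (hM : ∀ᵐ l ∂circ, ‖h l‖ ≤ M) : MemL2 G h := by
  refine ⟨hh, ?_⟩
  have hi : Integrable (fun l => (∑ i, ∑ j, ‖G l i j‖) * M ^ 2) circ :=
    (integrable_finsetSum _ fun i _ => integrable_finsetSum _ fun j _ =>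
      (hG.integrable i j).norm).mul_const _
  refine hi.mono' (aesm_quad hG hh) ?_
  filter_upwards [hM, hG.posSemidef] with l hl hp
  rw [Real.norm_of_nonneg (quad_nonneg hp _)]
  refine (quad_le_sum _).trans ?_
  gcongr

theorem MemL2.sub (hG : IsSpectralDensity G) {h g : ℝ → Fin T → ℂ} (hh : MemL2 G h)
    (hg : MemL2 G g) : MemL2 G (h - g) := by
  refine ⟨hh.aesm.sub hg.aesm, ?_⟩
  refine ((hh.integrable.const_mul 2).add (hg.integrable.const_mul 2)).mono'
    (aesm_quad hG (hh.aesm.sub hg.aesm)) ?_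
  filter_upwards [hG.posSemidef] with l hp
  rw [Real.norm_of_nonneg (quad_nonneg hp _)]
  exact quad_sub_le hp _ _

theorem MemL2.const_smul {h : ℝ → Fin T → ℂ} (hh : MemL2 G h) (c : ℂ) :
    MemL2 G (c • h) := by
  refine ⟨hh.aesm.const_smul c, ?_⟩
  simp only [Pi.smul_apply, quad_smul]
  exact hh.integrable.const_mul _

theorem MemL2.add (hG : IsSpectralDensity G) {h g : ℝ → Fin T → ℂ} (hh : MemL2 G h)
    (hg : MemL2 G g) : MemL2 G (h + g) := by
  have := hh.sub hG (hg.const_smul (-1))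
  rwa [neg_one_smul, sub_neg_eq_add] at this

theorem nrm_nonneg (hG : IsSpectralDensity G) (h : ℝ → Fin T → ℂ) : 0 ≤ nrm G h := by
  refine integral_nonneg_of_ae ?_
  filter_upwards [hG.posSemidef] with l hp
  exact quad_nonneg hp _

theorem nrm_smul (c : ℂ) (h : ℝ → Fin T → ℂ) : nrm G (c • h) = ‖c‖ ^ 2 * nrm G h := by
  simp only [nrm, Pi.smul_apply, quad_smul, integral_const_mul]

theorem nrm_sub_comm (h g : ℝ → Fin T → ℂ) : nrm G (h - g) = nrm G (g - h) := by
  simp only [nrm, Pi.sub_apply]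
  congr 1
  ext l
  rw [← neg_sub, quad_neg]

theorem integrable_herm (hG : IsSpectralDensity G) {h g : ℝ → Fin T → ℂ} (hh : MemL2 G h)
    (hg : MemL2 G g) : Integrable (fun l => herm (G l) (h l) (g l)) circ := by
  refine (hh.integrable.add hg.integrable).mono' (aesm_herm hG.aesm hh.aesm hg.aesm) ?_
  filter_upwards [hG.posSemidef] with l hp
  exact norm_herm_le_add hp _ _

theorem norm_integral_herm_sq_le (hG : IsSpectralDensity G) {h g : ℝ → Fin T → ℂ}
    (hh : MemL2 G h) (hg : MemL2 G g) :
    ‖∫ l, herm (G l) (h l) (g l) ∂circ‖ ^ 2 ≤ nrm G h * nrm G g := by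
  have hq : ∀ h : ℝ → Fin T → ℂ, 0 ≤ᵐ[circ] fun l => quad (G l) (h l) := fun h => by
    filter_upwards [hG.posSemidef] with l hp using quad_nonneg hp _
  have := (integrable_and_sq_integral_norm_le (aesm_herm hG.aesm hh.aesm hg.aesm) hh.integrable
    hg.integrable (hq h) (hq g) (by
      filter_upwards [hG.posSemidef] with l hp using norm_herm_sq_le hp _ _)).2
  refine le_trans ?_ this
  gcongr
  exact norm_integral_le_integral_norm _

theorem nrm_sub (hG : IsSpectralDensity G) {h g : ℝ → Fin T → ℂ} (hh : MemL2 G h)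
    (hg : MemL2 G g) :
    nrm G (h - g) = nrm G h - 2 * (∫ l, herm (G l) (h l) (g l) ∂circ).re + nrm G g := by
  have hi := integrable_herm hG hh hg
  have hre : (∫ l, herm (G l) (h l) (g l) ∂circ).re = ∫ l, (herm (G l) (h l) (g l)).re ∂circ :=
    (integral_re hi).symm
  have h2 : Integrable (fun l => 2 * (herm (G l) (h l) (g l)).re) circ := hi.re.const_mul 2
  have h3 : Integrable (fun l => quad (G l) (h l) - 2 * (herm (G l) (h l) (g l)).re) circ :=
    hh.integrable.sub h2
  rw [nrm, nrm, nrm, hre, ← integral_const_mul, ← integral_sub hh.integrable h2,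
    ← integral_add h3 hg.integrable]
  refine integral_congr_ae ?_
  filter_upwards [hG.posSemidef] with l hp
  exact quad_sub hp _ _

theorem nrm_sub_le (hG : IsSpectralDensity G) {h g : ℝ → Fin T → ℂ} (hh : MemL2 G h)
    (hg : MemL2 G g) : nrm G (h - g) ≤ 2 * nrm G h + 2 * nrm G g := by
  rw [nrm, nrm, nrm, ← integral_const_mul, ← integral_const_mul,
    ← integral_add (hh.integrable.const_mul 2) (hg.integrable.const_mul 2)]
  refine integral_mono_ae (hh.sub hG hg).integrable
    ((hh.integrable.const_mul 2).add (hg.integrable.const_mul 2)) ?_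
  filter_upwards [hG.posSemidef] with l hp
  exact quad_sub_le hp _ _

theorem nrm_parallelogram (hG : IsSpectralDensity G) {z x y : ℝ → Fin T → ℂ} (hz : MemL2 G z)
    (hx : MemL2 G x) (hy : MemL2 G y) :
    nrm G (x - y) = 2 * nrm G (z - x) + 2 * nrm G (z - y) - 4 * nrm G (z - (2⁻¹ : ℂ) • (x + y)) := by
  have h1 := (hz.sub hG hx).integrable.const_mul 2
  have h2 := (hz.sub hG hy).integrable.const_mul 2
  have h3 := (hz.sub hG ((hx.add hG hy).const_smul 2⁻¹)).integrable.const_mul 4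
  have h4 : Integrable (fun l => 2 * quad (G l) ((z - x) l) + 2 * quad (G l) ((z - y) l)) circ :=
    h1.add h2
  rw [nrm, nrm, nrm, nrm, ← integral_const_mul, ← integral_const_mul, ← integral_const_mul,
    ← integral_add h1 h2, ← integral_sub h4 h3]
  refine integral_congr_ae ?_
  filter_upwards [hG.posSemidef] with l hp
  exact quad_parallelogram hp _ _ _

/-- Elements of `L₂(G)` are integrable when `G⁻¹` is. -/
theorem IsMinDensity.integrable_apply (hG : IsMinDensity G) {h : ℝ → Fin T → ℂ}
    (hh : MemL2 G h) (p : Fin T) :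
    Integrable (fun l => h l p) circ ∧
      (∫ l, ‖h l p‖ ∂circ) ^ 2 ≤ nrm G h * ∫ l, ((G l)⁻¹).trace.re ∂circ := by
  refine integrable_and_sq_integral_norm_le (aesm_apply hh.aesm p) hh.integrable
    hG.integrable_inv.re ?_ ?_ ?_
  · filter_upwards [hG.posSemidef] with l hp using quad_nonneg hp _
  · filter_upwards [hG.posSemidef] with l hp
    exact (Complex.nonneg_iff.1 hp.inv.trace_nonneg).1
  · filter_upwards [hG.posSemidef, hG.isUnit_det] with l hp hu
    refine le_trans ?_ (sum_norm_sq_le hp hu (h l))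
    exact Finset.single_le_sum (f := fun p => ‖h l p‖ ^ 2) (fun _ _ => sq_nonneg _)
      (Finset.mem_univ p)

/-- `Gᵀ h` is integrable for `h` in `L₂(G)`. -/
theorem IsSpectralDensity.integrable_transpose_mulVec (hG : IsSpectralDensity G)
    {h : ℝ → Fin T → ℂ} (hh : MemL2 G h) (p : Fin T) :
    Integrable (fun l => ((G l)ᵀ *ᵥ h l) p) circ := by
  refine (integrable_and_sq_integral_norm_le ?_ hh.integrable (hG.integrable p p).re ?_ ?_ ?_).1
  · have := aesm_herm hG.aesm hh.aesm (aestronglyMeasurable_const (b := Pi.single p (1 : ℂ)))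
    simpa only [herm_single_right] using this
  · filter_upwards [hG.posSemidef] with l hp using quad_nonneg hp _
  · filter_upwards [hG.posSemidef] with l hp
    exact (Complex.nonneg_iff.1 hp.diag_nonneg).1
  · filter_upwards [hG.posSemidef] with l hp using norm_transpose_mulVec_sq_le hp _ _

end L2

/-! ### The past -/

/-- The function `∑_{n < N} e^{-i(n+1)λ} x(n)`. -/
def pastFun {T : ℕ} (N : ℕ) (x : ℕ → Fin T → ℂ) (l : ℝ) : Fin T → ℂ :=
  ∑ n ∈ Finset.range N, Complex.exp (-Complex.I * (n + 1) * l) • x n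

theorem exp_eq_expo (n : ℕ) (l : ℝ) :
    Complex.exp (-Complex.I * (n + 1) * l) = expo (-((n : ℤ) + 1)) l := by
  rw [expo]
  congr 1
  push_cast
  ring

theorem pastFun_eq {T : ℕ} (N : ℕ) (x : ℕ → Fin T → ℂ) (l : ℝ) :
    pastFun N x l = ∑ n ∈ Finset.range N, expo (-((n : ℤ) + 1)) l • x n := by
  simp only [pastFun, exp_eq_expo]

theorem pastFun_extend {T : ℕ} {N M : ℕ} (h : N ≤ M) (x : ℕ → Fin T → ℂ) :
    pastFun N x = pastFun M fun n => if n < N then x n else 0 := by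
  ext1 l
  rw [pastFun, pastFun]
  symm
  rw [← Finset.sum_subset (Finset.range_subset_range.2 h)]
  · exact Finset.sum_congr rfl fun n hn => by simp [Finset.mem_range.1 hn]
  · intro n _ hn
    simp [Finset.mem_range.not.1 hn]

/-- The vector space of the functions `∑_{n < N} e^{-i(n+1)λ} x(n)`. -/
def pastSpan (T : ℕ) : Submodule ℂ (ℝ → Fin T → ℂ) where
  carrier := {Q | ∃ N x, Q = pastFun N x}
  add_mem' := by
    rintro _ _ ⟨N, x, rfl⟩ ⟨M, y, rfl⟩
    rw [pastFun_extend (le_max_left N M) x, pastFun_extend (le_max_right N M) y]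
    refine ⟨max N M, fun n => (if n < N then x n else 0) + if n < M then y n else 0, ?_⟩
    ext1 l
    simp only [pastFun, Pi.add_apply, ← Finset.sum_add_distrib, ← smul_add]
  zero_mem' := ⟨0, 0, by ext; simp [pastFun]⟩
  smul_mem' := by
    rintro c _ ⟨N, x, rfl⟩
    refine ⟨N, fun n => c • x n, ?_⟩
    ext1 l
    simp only [pastFun, Pi.smul_apply, Finset.smul_sum, smul_comm c]

theorem pastFun_mem {T : ℕ} (N : ℕ) (x : ℕ → Fin T → ℂ) : pastFun N x ∈ pastSpan T := ⟨N, x, rfl⟩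

theorem expo_smul_mem {T : ℕ} {k : ℤ} (hk : k < 0) (x : Fin T → ℂ) :
    (fun l => expo k l • x) ∈ pastSpan T := by
  refine ⟨(-k - 1).toNat + 1, fun n => if n = (-k - 1).toNat then x else 0, ?_⟩
  ext1 l
  rw [pastFun_eq, Finset.sum_eq_single (-k - 1).toNat]
  · have : (((-k - 1).toNat : ℕ) : ℤ) = -k - 1 := Int.toNat_of_nonneg (by lia)
    rw [this, if_pos rfl]
    congr 2
    ring
  · intro n _ hn
    rw [if_neg hn, smul_zero]
  · simp

theorem continuous_of_mem {T : ℕ} {Q : ℝ → Fin T → ℂ} (hQ : Q ∈ pastSpan T) : Continuous Q := by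
  obtain ⟨N, x, rfl⟩ := hQ
  unfold pastFun
  fun_prop

theorem bounded_of_mem {T : ℕ} {Q : ℝ → Fin T → ℂ} (hQ : Q ∈ pastSpan T) :
    ∃ M, ∀ l, ‖Q l‖ ≤ M := by
  obtain ⟨N, x, rfl⟩ := hQ
  refine ⟨∑ n ∈ Finset.range N, ‖x n‖, fun l => ?_⟩
  rw [pastFun_eq]
  refine (norm_sum_le _ _).trans (Finset.sum_le_sum fun n _ => ?_)
  rw [norm_smul, norm_expo, one_mul]

theorem fcoeff_of_mem {T : ℕ} {Q : ℝ → Fin T → ℂ} (hQ : Q ∈ pastSpan T) (p : Fin T) {k : ℤ}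
    (hk : 0 ≤ k) : fcoeff (fun l => Q l p) k = 0 := by
  obtain ⟨N, x, rfl⟩ := hQ
  simp only [pastFun_eq, Finset.sum_apply, Pi.smul_apply, smul_eq_mul]
  rw [fcoeff_sum _ fun n _ => ?_]
  · refine Finset.sum_eq_zero fun n _ => ?_
    simp only [mul_comm (expo _ _)]
    rw [fcoeff_const_mul, fcoeff_expo, if_neg (by lia), mul_zero]
  · simpa only [mul_comm] using integrable_mul_expo (integrable_const (x n p)) _

section Past

variable {T : ℕ} {G : ℝ → Matrix (Fin T) (Fin T) ℂ}

theorem memL2_of_mem (hG : IsSpectralDensity G) {Q : ℝ → Fin T → ℂ} (hQ : Q ∈ pastSpan T) :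
    MemL2 G Q := by
  obtain ⟨M, hM⟩ := bounded_of_mem hQ
  exact memL2_of_bounded hG (continuous_of_mem hQ).aestronglyMeasurable (ae_of_all _ hM)

/-- `g` belongs to the closed span in `L₂(G)` of the functions `e^{iλk} δ_p`, `k ≤ -1`. -/
structure PastLim (G : ℝ → Matrix (Fin T) (Fin T) ℂ) (g : ℝ → Fin T → ℂ) : Prop where
  memL2 : MemL2 G g
  approx : ∀ ε : ℝ, 0 < ε → ∃ Q ∈ pastSpan T, nrm G (g - Q) < ε

theorem PastLim.of_mem (hG : IsSpectralDensity G) {Q : ℝ → Fin T → ℂ} (hQ : Q ∈ pastSpan T) :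
    PastLim G Q := ⟨memL2_of_mem hG hQ, fun ε hε => ⟨Q, hQ, by simpa [nrm, quad, herm] using hε⟩⟩

theorem PastLim.sub (hG : IsSpectralDensity G) {g h : ℝ → Fin T → ℂ} (hg : PastLim G g)
    (hh : PastLim G h) : PastLim G (g - h) := by
  refine ⟨hg.memL2.sub hG hh.memL2, fun ε hε => ?_⟩
  obtain ⟨Q, hQ, hQε⟩ := hg.approx (ε / 4) (by positivity)
  obtain ⟨R, hR, hRε⟩ := hh.approx (ε / 4) (by positivity)
  refine ⟨Q - R, sub_mem hQ hR, ?_⟩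
  rw [sub_sub_sub_comm]
  have := nrm_sub_le hG (hg.memL2.sub hG (memL2_of_mem hG hQ)) (hh.memL2.sub hG (memL2_of_mem hG hR))
  linarith

/-- Orthogonality to the past extends to its closure. -/
theorem PastLim.integral_herm_eq_zero (hG : IsSpectralDensity G) {r g : ℝ → Fin T → ℂ}
    (hr : MemL2 G r) (hg : PastLim G g)
    (h : ∀ Q ∈ pastSpan T, ∫ l, herm (G l) (r l) (Q l) ∂circ = 0) :
    ∫ l, herm (G l) (r l) (g l) ∂circ = 0 := by
  have key : ∀ ε : ℝ, 0 < ε → ‖∫ l, herm (G l) (r l) (g l) ∂circ‖ ^ 2 ≤ nrm G r * ε := by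
    intro ε hε
    obtain ⟨Q, hQ, hQε⟩ := hg.approx ε hε
    have h1 := norm_integral_herm_sq_le hG hr (hg.memL2.sub hG (memL2_of_mem hG hQ))
    have h2 : ∫ l, herm (G l) (r l) ((g - Q) l) ∂circ = ∫ l, herm (G l) (r l) (g l) ∂circ := by
      simp only [Pi.sub_apply, herm_sub_right]
      rw [integral_sub (integrable_herm hG hr hg.memL2)
        (integrable_herm hG hr (memL2_of_mem hG hQ)), h Q hQ, sub_zero]
    rw [h2] at h1
    exact h1.trans (mul_le_mul_of_nonneg_left hQε.le (nrm_nonneg hG r))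
  have h0 : ‖∫ l, herm (G l) (r l) (g l) ∂circ‖ ^ 2 ≤ 0 := by
    refine le_of_forall_pos_le_add fun ε hε => ?_
    have hn := nrm_nonneg hG r
    refine (key (ε / (nrm G r + 1)) (by positivity)).trans ?_
    rw [zero_add, ← mul_div_assoc, div_le_iff₀ (by positivity)]
    nlinarith
  have : ‖∫ l, herm (G l) (r l) (g l) ∂circ‖ = 0 := by
    nlinarith [norm_nonneg (∫ l, herm (G l) (r l) (g l) ∂circ)]
  simpa using this

/-- Elements of the closed past have no Fourier coefficients of index `k ≥ 0`. -/
theorem PastLim.fcoeff_eq_zero (hG : IsMinDensity G) {g : ℝ → Fin T → ℂ} (hg : PastLim G g)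
    (p : Fin T) {k : ℤ} (hk : 0 ≤ k) : fcoeff (fun l => g l p) k = 0 := by
  have hG' := hG.toIsSpectralDensity
  have hC : 0 ≤ ∫ l, ((G l)⁻¹).trace.re ∂circ := integral_nonneg_of_ae (by
    filter_upwards [hG.posSemidef] with l hp
    exact (Complex.nonneg_iff.1 hp.inv.trace_nonneg).1)
  choose Q hQ hQε using fun n : ℕ => hg.approx (1 / ((n : ℝ) + 1)) (by positivity)
  have hd := fun n => hG.integrable_apply (hg.memL2.sub hG' (memL2_of_mem hG' (hQ n))) p
  have hlim : Tendsto (fun n => ∫ l, ‖g l p - Q n l p‖ ∂circ) atTop (𝓝 0) := by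
    have h1 : Tendsto (fun n : ℕ => √((1 / ((n : ℝ) + 1)) * ∫ l, ((G l)⁻¹).trace.re ∂circ))
        atTop (𝓝 0) := by
      have := ((tendsto_one_div_add_atTop_nhds_zero_nat (𝕜 := ℝ)).mul_const
        (∫ l, ((G l)⁻¹).trace.re ∂circ)).sqrt
      simpa using this
    refine squeeze_zero (fun n => integral_nonneg fun _ => norm_nonneg _) (fun n => ?_) h1
    refine Real.le_sqrt_of_sq_le ((hd n).2.trans ?_)
    gcongr
    exact (hQε n).le
  have := fcoeff_tendsto (fun n => (hG.integrable_apply (memL2_of_mem hG' (hQ n)) p).1)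
    (hG.integrable_apply hg.memL2 p).1 hlim k
  refine tendsto_nhds_unique this ?_
  simp only [fcoeff_of_mem (hQ _) p hk]
  exact tendsto_const_nhds

theorem integral_herm_expo_eq (r : ℝ → Fin T → ℂ) (p : Fin T) (k : ℤ) :
    ∫ l, herm (G l) (r l) (expo k l • Pi.single p 1) ∂circ =
      2 * Real.pi * fcoeff (fun l => ((G l)ᵀ *ᵥ r l) p) k := by
  have hp : (Real.pi : ℂ) ≠ 0 := by exact_mod_cast Real.pi_ne_zero
  rw [fcoeff_eq, ← mul_assoc, mul_one_div_cancel (by simp [hp]), one_mul]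
  congr 1
  ext l
  rw [herm_smul_right, herm_single_right, star_expo, mul_comm]

/-- `r` is orthogonal to the past iff `Gᵀ r` has no Fourier coefficients of index `k < 0`. -/
theorem orthogonal_iff_fcoeff (hG : IsSpectralDensity G) {r : ℝ → Fin T → ℂ} (hr : MemL2 G r) :
    (∀ Q ∈ pastSpan T, ∫ l, herm (G l) (r l) (Q l) ∂circ = 0) ↔
      ∀ p (k : ℤ), k < 0 → fcoeff (fun l => ((G l)ᵀ *ᵥ r l) p) k = 0 := by
  have hp : (2 * Real.pi : ℂ) ≠ 0 := by
    have : (Real.pi : ℂ) ≠ 0 := by exact_mod_cast Real.pi_ne_zero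
    simp [this]
  constructor
  · intro h p k hk
    have := h _ (expo_smul_mem hk (Pi.single p 1))
    rw [integral_herm_expo_eq] at this
    exact (mul_eq_zero.1 this).resolve_left hp
  · rintro h _ ⟨N, x, rfl⟩
    have e : ∀ l, herm (G l) (r l) (pastFun N x l) = ∑ n ∈ Finset.range N, ∑ p,
        star (x n p) * herm (G l) (r l) (expo (-((n : ℤ) + 1)) l • Pi.single p 1) := by
      intro l
      have hx : ∀ n, x n = ∑ p, x n p • (Pi.single p 1 : Fin T → ℂ) := fun n => by
        ext q; simp [Finset.sum_apply, Pi.single_apply]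
      have hsum : ∀ {ι : Type} (s : Finset ι) (y : ι → Fin T → ℂ),
          herm (G l) (r l) (∑ i ∈ s, y i) = ∑ i ∈ s, herm (G l) (r l) (y i) := fun s y => by
        simp [herm, mulVec_sum, dotProduct_sum, star_sum]
      rw [pastFun_eq, hsum]
      refine Finset.sum_congr rfl fun n _ => ?_
      conv_lhs => rw [hx n, Finset.smul_sum, hsum]
      refine Finset.sum_congr rfl fun p _ => ?_
      rw [smul_comm, herm_smul_right]
    have hi : ∀ n p, Integrable (fun l => star (x n p) *
        herm (G l) (r l) (expo (-((n : ℤ) + 1)) l • Pi.single p 1)) circ := fun n p =>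
      (integrable_herm hG hr (memL2_of_mem hG (expo_smul_mem (by lia) _))).const_mul _
    simp only [e]
    rw [integral_finsetSum _ fun n _ => integrable_finsetSum _ fun p _ => hi n p]
    refine Finset.sum_eq_zero fun n _ => ?_
    rw [integral_finsetSum _ fun p _ => hi n p]
    refine Finset.sum_eq_zero fun p _ => ?_
    rw [integral_const_mul, integral_herm_expo_eq, h p _ (by lia)]
    simp

end Past

/-! ### Projection onto the past -/

section Projection

variable {T : ℕ} {G : ℝ → Matrix (Fin T) (Fin T) ℂ}

theorem IsMinDensity.integrable_norm (hG : IsMinDensity G) {h : ℝ → Fin T → ℂ} (hh : MemL2 G h) :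
    Integrable h circ ∧
      (∫ l, ‖h l‖ ∂circ) ^ 2 ≤ nrm G h * ∫ l, ((G l)⁻¹).trace.re ∂circ := by
  refine integrable_and_sq_integral_norm_le hh.aesm hh.integrable hG.integrable_inv.re ?_ ?_ ?_
  · filter_upwards [hG.posSemidef] with l hp using quad_nonneg hp _
  · filter_upwards [hG.posSemidef] with l hp
    exact (Complex.nonneg_iff.1 hp.inv.trace_nonneg).1
  · filter_upwards [hG.posSemidef, hG.isUnit_det] with l hp hu
    refine le_trans ?_ (sum_norm_sq_le hp hu (h l))
    refine Real.sq_le (Finset.sum_nonneg fun _ _ => sq_nonneg _) |>.2 ⟨?_, ?_⟩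
    · exact (neg_nonpos.2 (Real.sqrt_nonneg _)).trans (norm_nonneg _)
    · refine (pi_norm_le_iff_of_nonneg (Real.sqrt_nonneg _)).2 fun p => Real.le_sqrt_of_sq_le ?_
      exact Finset.single_le_sum (f := fun p => ‖h l p‖ ^ 2) (fun _ _ => sq_nonneg _)
        (Finset.mem_univ p)

theorem continuous_quad (A : Matrix (Fin T) (Fin T) ℂ) : Continuous (quad A) := by
  unfold quad herm
  fun_prop

theorem lintegral_quad (hG : IsSpectralDensity G) {h : ℝ → Fin T → ℂ} (hh : MemL2 G h) :
    ∫⁻ l, ENNReal.ofReal (quad (G l) (h l)) ∂circ = ENNReal.ofReal (nrm G h) := by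
  rw [nrm, ofReal_integral_eq_lintegral_ofReal hh.integrable]
  filter_upwards [hG.posSemidef] with l hp using quad_nonneg hp _

theorem memL2_of_lintegral (hG : IsSpectralDensity G) {h : ℝ → Fin T → ℂ}
    (hh : AEStronglyMeasurable h circ)
    (hfin : ∫⁻ l, ENNReal.ofReal (quad (G l) (h l)) ∂circ < ∞) : MemL2 G h := by
  refine ⟨hh, aesm_quad hG hh, ?_⟩
  rw [hasFiniteIntegral_iff_ofReal]
  · exact hfin
  · filter_upwards [hG.posSemidef] with l hp using quad_nonneg hp _

/-- A minimizing sequence in the past is Cauchy in the mean. As `G⁻¹` is integrable it converges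
a.e. along the whole sequence, and Fatou's lemma identifies the limit. -/
theorem exists_limit_of_cauchy (hG : IsMinDensity G) {Q : ℕ → ℝ → Fin T → ℂ}
    (hQ : ∀ n, Q n ∈ pastSpan T)
    (hc : ∀ N n k, N ≤ n → N ≤ k → nrm G (Q n - Q k) ≤ 4 * ((1 / 2 : ℝ) ^ N) ^ 2) :
    ∃ g, MemL2 G g ∧ ∀ n, nrm G (g - Q n) ≤ 4 * ((1 / 2 : ℝ) ^ n) ^ 2 := by
  have hG' := hG.toIsSpectralDensity
  set K := ∫ l, ((G l)⁻¹).trace.re ∂circ with hK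
  have hK0 : 0 ≤ K := integral_nonneg_of_ae (by
    filter_upwards [hG.posSemidef] with l hp
    exact (Complex.nonneg_iff.1 hp.inv.trace_nonneg).1)
  have hQm := fun n => memL2_of_mem hG' (hQ n)
  have hcau : ∀ N n m : ℕ, N ≤ n → N ≤ m → eLpNorm (Q n - Q m) 1 circ <
      ENNReal.ofReal ((2 * √K + 1) * (1 / 2) ^ N) := by
    intro N n k hn hk
    have hm := (hQm n).sub hG' (hQm k)
    have hi := hG.integrable_norm hm
    rw [eLpNorm_one_eq_lintegral_enorm, ← ofReal_integral_norm_eq_lintegral_enorm hi.1]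
    have h1 : (∫ l, ‖(Q n - Q k) l‖ ∂circ) ^ 2 ≤ (2 * √K * (1 / 2) ^ N) ^ 2 := by
      refine (hi.2.trans (mul_le_mul_of_nonneg_right (hc N n k hn hk) hK0)).trans (le_of_eq ?_)
      rw [mul_pow, mul_pow, Real.sq_sqrt hK0]
      ring
    have h2 := le_of_sq_le_sq h1 (by positivity)
    refine (ENNReal.ofReal_lt_ofReal_iff (by positivity)).2 (h2.trans_lt ?_)
    gcongr
    linarith
  have hsum : ∑' N : ℕ, ENNReal.ofReal ((2 * √K + 1) * (1 / 2) ^ N) ≠ ∞ := by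
    have hs : Summable fun N : ℕ => (2 * √K + 1) * (1 / 2 : ℝ) ^ N :=
      summable_geometric_two.mul_left _
    rw [← ENNReal.ofReal_tsum_of_nonneg (fun n => by positivity) hs]
    exact ENNReal.ofReal_ne_top
  obtain ⟨g, hgm, hg⟩ := exists_stronglyMeasurable_limit_of_tendsto_ae (fun n => (hQm n).aesm)
    (Lp.ae_tendsto_of_cauchy_eLpNorm (fun n => (hQm n).aesm) le_rfl hsum hcau)
  have hb : ∀ n, ∫⁻ l, ENNReal.ofReal (quad (G l) (g l - Q n l)) ∂circ ≤
      ENNReal.ofReal (4 * ((1 / 2 : ℝ) ^ n) ^ 2) := by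
    intro n
    calc ∫⁻ l, ENNReal.ofReal (quad (G l) (g l - Q n l)) ∂circ
        ≤ ∫⁻ l, liminf (fun k => ENNReal.ofReal (quad (G l) (Q k l - Q n l))) atTop ∂circ := by
          refine lintegral_mono_ae ?_
          filter_upwards [hg] with l hl
          refine le_of_eq (Tendsto.liminf_eq ?_).symm
          exact (ENNReal.continuous_ofReal.tendsto _).comp
            (((continuous_quad (G l)).tendsto _).comp (hl.sub_const _))
      _ ≤ liminf (fun k => ∫⁻ l, ENNReal.ofReal (quad (G l) (Q k l - Q n l)) ∂circ) atTop :=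
          lintegral_liminf_le' fun k =>
            (aesm_quad hG' ((hQm k).aesm.sub (hQm n).aesm)).aemeasurable.ennreal_ofReal
      _ ≤ ENNReal.ofReal (4 * ((1 / 2 : ℝ) ^ n) ^ 2) := by
          refine liminf_le_of_frequently_le' (Eventually.frequently ?_)
          filter_upwards [eventually_ge_atTop n] with k hk
          refine (lintegral_quad hG' ((hQm k).sub hG' (hQm n))).le.trans ?_
          exact ENNReal.ofReal_le_ofReal (hc n k n hk le_rfl)
  have hm : ∀ n, MemL2 G (g - Q n) := fun n => memL2_of_lintegral hG'
    (hgm.aestronglyMeasurable.sub (hQm n).aesm) ((hb n).trans_lt ENNReal.ofReal_lt_top)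
  refine ⟨g, ?_, fun n => ?_⟩
  · have := (hm 0).add hG' (hQm 0)
    rwa [sub_add_cancel] at this
  · have h1 := hb n
    rw [show (fun l => ENNReal.ofReal (quad (G l) (g l - Q n l))) =
      fun l => ENNReal.ofReal (quad (G l) ((g - Q n) l)) from rfl, lintegral_quad hG' (hm n)] at h1
    exact (ENNReal.ofReal_le_ofReal_iff (by positivity)).1 h1

/-- The orthogonal projection of `B` onto the closed past of `L₂(G)`. -/
theorem exists_projection (hG : IsMinDensity G) {B : ℝ → Fin T → ℂ} (hB : MemL2 G B) :
    ∃ g, PastLim G g ∧ ∀ Q ∈ pastSpan T, ∫ l, herm (G l) ((B - g) l) (Q l) ∂circ = 0 := by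
  have hG' := hG.toIsSpectralDensity
  set s : Set ℝ := (fun Q => nrm G (B - Q)) '' (pastSpan T : Set (ℝ → Fin T → ℂ)) with hs
  have hbdd : BddBelow s := ⟨0, by rintro _ ⟨Q, -, rfl⟩; exact nrm_nonneg hG' _⟩
  have hne : s.Nonempty := ⟨_, 0, zero_mem _, rfl⟩
  set m := sInf s with hm
  have hle : ∀ Q ∈ pastSpan T, m ≤ nrm G (B - Q) := fun Q hQ => csInf_le hbdd ⟨Q, hQ, rfl⟩
  have hex : ∀ n : ℕ, ∃ Q ∈ pastSpan T, nrm G (B - Q) < m + ((1 / 2 : ℝ) ^ n) ^ 2 := fun n => by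
    obtain ⟨_, ⟨Q, hQ, rfl⟩, hlt⟩ := exists_lt_of_csInf_lt hne
      (lt_add_of_pos_right m (by positivity : 0 < ((1 / 2 : ℝ) ^ n) ^ 2))
    exact ⟨Q, hQ, hlt⟩
  choose Q hQ hQlt using hex
  have hQm := fun n => memL2_of_mem hG' (hQ n)
  have hpow : ∀ N n : ℕ, N ≤ n → ((1 / 2 : ℝ) ^ n) ^ 2 ≤ ((1 / 2 : ℝ) ^ N) ^ 2 := fun N n h => by
    have : (1 / 2 : ℝ) ^ n ≤ (1 / 2 : ℝ) ^ N := pow_le_pow_of_le_one (by norm_num) (by norm_num) h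
    gcongr
  obtain ⟨g, hg, hgn⟩ := exists_limit_of_cauchy hG hQ fun N n k hn hk => by
    rw [nrm_parallelogram hG' hB (hQm n) (hQm k)]
    have h1 := hle _ ((pastSpan T).smul_mem (2⁻¹ : ℂ) (add_mem (hQ n) (hQ k)))
    have h2 := hQlt n
    have h3 := hQlt k
    have h4 := hpow N n hn
    have h5 := hpow N k hk
    linarith
  have hz : Tendsto (fun n : ℕ => (1 / 2 : ℝ) ^ n) atTop (𝓝 0) :=
    tendsto_pow_atTop_nhds_zero_of_lt_one (by norm_num) (by norm_num)
  refine ⟨g, ⟨hg, fun ε hε => ?_⟩, fun R hR => ?_⟩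
  · have h1 : Tendsto (fun n : ℕ => 4 * ((1 / 2 : ℝ) ^ n) ^ 2) atTop (𝓝 0) := by
      simpa using (hz.pow 2).const_mul 4
    obtain ⟨n, hn⟩ := (h1.eventually (gt_mem_nhds hε)).exists
    exact ⟨Q n, hQ n, (hgn n).trans_lt hn⟩
  · have hRm := memL2_of_mem hG' hR
    have hN := nrm_nonneg hG' R
    set I : ℕ → ℂ := fun n => ∫ l, herm (G l) ((B - Q n) l) (R l) ∂circ with hI
    -- Comparing `Q n` with `Q n + t I_n R` for all real `t` bounds `I_n`.
    have hIn : ∀ n, ‖I n‖ ≤ √(nrm G R) * (1 / 2) ^ n := by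
      intro n
      have key : ∀ t : ℝ, 0 ≤ (‖I n‖ ^ 2 * nrm G R) * (t * t) + (-2 * ‖I n‖ ^ 2) * t
          + ((1 / 2 : ℝ) ^ n) ^ 2 := by
        intro t
        have h1 := hle _ (add_mem (hQ n) ((pastSpan T).smul_mem ((t : ℂ) * I n) hR))
        rw [← sub_sub, nrm_sub hG' (hB.sub hG' (hQm n)) (hRm.const_smul _), nrm_smul] at h1
        simp only [Pi.smul_apply, herm_smul_right, integral_const_mul] at h1
        have h2 : (star ((t : ℂ) * I n) * ∫ l, herm (G l) ((B - Q n) l) (R l) ∂circ).re =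
            t * ‖I n‖ ^ 2 := by
          change (star ((t : ℂ) * I n) * I n).re = _
          rw [star_mul', mul_assoc, Complex.star_def, Complex.conj_ofReal,
            Complex.conj_mul', ← Complex.ofReal_pow, ← Complex.ofReal_mul, Complex.ofReal_re]
        rw [h2, norm_mul, Complex.norm_real, mul_pow, Real.norm_eq_abs, sq_abs] at h1
        have h3 := hQlt n
        nlinarith
      have h1 := discrim_le_zero key
      rw [discrim] at h1
      rcases eq_or_lt_of_le (norm_nonneg (I n)) with h0 | h0
      · rw [← h0]; positivity
      · refine le_of_sq_le_sq ?_ (by positivity)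
        rw [mul_pow, Real.sq_sqrt hN]
        have h2 : 0 < ‖I n‖ ^ 2 := by positivity
        have h3 : ‖I n‖ ^ 2 * ‖I n‖ ^ 2 ≤ ‖I n‖ ^ 2 * (nrm G R * ((1 / 2) ^ n) ^ 2) := by
          nlinarith
        exact le_of_mul_le_mul_left h3 h2
    have hdiff : ∀ n, ‖∫ l, herm (G l) ((B - g) l) (R l) ∂circ‖ ≤ 3 * √(nrm G R) * (1 / 2) ^ n := by
      intro n
      have h1 := norm_integral_herm_sq_le hG' (hg.sub hG' (hQm n)) hRm
      have e : ∫ l, herm (G l) ((B - g) l) (R l) ∂circ =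
          I n - ∫ l, herm (G l) ((g - Q n) l) (R l) ∂circ := by
        rw [hI, ← integral_sub (integrable_herm hG' (hB.sub hG' (hQm n)) hRm)
          (integrable_herm hG' (hg.sub hG' (hQm n)) hRm)]
        congr 1
        ext l
        rw [← herm_sub_left]
        simp
      have h2 : ‖∫ l, herm (G l) ((g - Q n) l) (R l) ∂circ‖ ≤ 2 * √(nrm G R) * (1 / 2) ^ n := by
        refine le_of_sq_le_sq (h1.trans ?_) (by positivity)
        rw [mul_pow, mul_pow, Real.sq_sqrt hN]
        nlinarith [mul_le_mul_of_nonneg_right (hgn n) hN]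
      rw [e]
      refine (norm_sub_le _ _).trans ?_
      linarith [hIn n]
    have h0 := hz.const_mul (3 * √(nrm G R))
    rw [mul_zero] at h0
    have := ge_of_tendsto' h0 hdiff
    simpa using le_antisymm this (norm_nonneg _)

end Projection

/-! ### Bounded analytic multipliers and the pairing of analytic functions -/

theorem expo_smul_mem_of_mem {T : ℕ} {k : ℤ} (hk : k ≤ 0) {Q : ℝ → Fin T → ℂ}
    (hQ : Q ∈ pastSpan T) : (fun l => expo k l • Q l) ∈ pastSpan T := by
  obtain ⟨N, x, rfl⟩ := hQ
  have e : (fun l => expo k l • pastFun N x l) =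
      ∑ n ∈ Finset.range N, fun l => expo (k + -((n : ℤ) + 1)) l • x n := by
    ext1 l
    rw [pastFun_eq, Finset.smul_sum, Finset.sum_apply]
    exact Finset.sum_congr rfl fun n _ => by rw [smul_smul, expo_add]
  rw [e]
  exact sum_mem fun n _ => expo_smul_mem (by lia) _

theorem PastLim.expo_smul {T : ℕ} {G : ℝ → Matrix (Fin T) (Fin T) ℂ}
    {g : ℝ → Fin T → ℂ} (hg : PastLim G g) {k : ℤ} (hk : k ≤ 0) :
    PastLim G fun l => expo k l • g l := by
  refine ⟨⟨(continuous_expo k).aestronglyMeasurable.smul hg.memL2.aesm, ?_⟩, fun ε hε => ?_⟩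
  · simp only [quad_smul, norm_expo, one_pow, one_mul]
    exact hg.memL2.integrable
  · obtain ⟨Q, hQ, hlt⟩ := hg.approx ε hε
    refine ⟨_, expo_smul_mem_of_mem hk hQ, lt_of_eq_of_lt ?_ hlt⟩
    simp only [nrm, Pi.sub_apply, ← smul_sub, quad_smul, norm_expo, one_pow, one_mul]

theorem PastLim.nrm_eq {T : ℕ} {G : ℝ → Matrix (Fin T) (Fin T) ℂ} (hG : IsSpectralDensity G)
    {B g : ℝ → Fin T → ℂ} (hB : MemL2 G B) (hg : PastLim G g)
    (h : ∀ Q ∈ pastSpan T, ∫ l, herm (G l) ((B - g) l) (Q l) ∂circ = 0) :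
    nrm G B = nrm G (B - g) + nrm G g := by
  have h1 := hg.integral_herm_eq_zero hG (hB.sub hG hg.memL2) h
  have h2 : ∫ l, herm (G l) (g l) ((B - g) l) ∂circ = 0 := by
    rw [← star_zero ℂ, ← h1, Complex.star_def, ← integral_conj]
    refine integral_congr_ae ?_
    filter_upwards [hG.posSemidef] with l hp
    exact herm_swap hp _ _
  have h3 := nrm_sub hG hg.memL2 (hB.sub hG hg.memL2)
  have h4 : nrm G (g - (B - g)) = nrm G ((B - g) - g) := nrm_sub_comm _ _
  have h5 := nrm_sub hG (hB.sub hG hg.memL2) hg.memL2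
  have h6 : B = (B - g) - (-1 : ℂ) • g := by rw [neg_one_smul]; abel
  conv_lhs => rw [h6]
  rw [nrm_sub hG (hB.sub hG hg.memL2) (hg.memL2.const_smul _), nrm_smul]
  simp only [Pi.smul_apply, herm_smul_right, integral_const_mul, h1]
  simp

/-- The scalar density `W` as a `1 × 1` matrix density. -/
def scalarDensity (W : ℝ → ℝ) (l : ℝ) : Matrix (Fin 1) (Fin 1) ℂ := (W l : ℂ) • 1

theorem herm_scalarDensity (W : ℝ → ℝ) (l : ℝ) (x y : Fin 1 → ℂ) :
    herm (scalarDensity W l) x y = W l * (x 0 * star (y 0)) := by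
  simp [herm, scalarDensity, smul_mulVec, dotProduct]
  ring

theorem quad_scalarDensity (W : ℝ → ℝ) (l : ℝ) (x : Fin 1 → ℂ) :
    quad (scalarDensity W l) x = ‖x 0‖ ^ 2 * W l := by
  rw [quad, herm_scalarDensity, Complex.star_def, Complex.mul_conj, ← Complex.ofReal_mul,
    Complex.ofReal_re, Complex.normSq_eq_norm_sq, mul_comm]

theorem isMinDensity_scalarDensity {W : ℝ → ℝ} (hW : Integrable W circ) (h1 : ∀ l, 1 ≤ W l) :
    IsMinDensity (scalarDensity W) := by
  refine ⟨⟨fun i j => ?_, ae_of_all _ fun l => ?_⟩, ae_of_all _ fun l => ?_, ?_⟩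
  · simp only [scalarDensity, Matrix.smul_apply, smul_eq_mul]
    exact hW.ofReal.mul_const _
  · exact PosSemidef.one.smul (by exact_mod_cast zero_le_one.trans (h1 l))
  · have : (W l : ℂ) ≠ 0 := by exact_mod_cast (zero_lt_one.trans_le (h1 l)).ne'
    simp [scalarDensity, this]
  · have e : ∀ l, ((scalarDensity W l)⁻¹).trace = ((W l)⁻¹ : ℝ) := fun l => by
      have : (W l : ℂ) ≠ 0 := by exact_mod_cast (zero_lt_one.trans_le (h1 l)).ne'
      rw [inv_eq_right_inv (B := ((W l : ℂ)⁻¹) • (1 : Matrix (Fin 1) (Fin 1) ℂ))]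
      · simp
      · rw [scalarDensity, smul_mul_smul_comm, mul_inv_cancel₀ this, one_smul, one_mul]
    simp only [e]
    refine Integrable.ofReal ?_
    refine (integrable_const (1 : ℝ)).mono' hW.aestronglyMeasurable.aemeasurable.inv.aestronglyMeasurable
      (ae_of_all _ fun l => ?_)
    change ‖(W l)⁻¹‖ ≤ 1
    rw [Real.norm_of_nonneg (inv_nonneg.2 (zero_le_one.trans (h1 l)))]
    exact inv_le_one_of_one_le₀ (h1 l)

/-- The residual `r = 1 - g` of the projection of `1` onto the past of the weight `W ≥ 1` satisfies
`|r|² W = const`: its translates `e^{-ikλ} r`, `k ≥ 1`, lie in the past, so that `|r|² W` has no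
Fourier coefficients except the mean. -/
theorem exists_outer {W : ℝ → ℝ} (hW : Integrable W circ) (h1 : ∀ l, 1 ≤ W l) :
    ∃ (r : ℝ → ℂ) (c : ℝ), AEStronglyMeasurable r circ ∧ 2 * Real.pi * c ≤ ∫ l, W l ∂circ ∧
      (∀ᵐ l ∂circ, ‖r l‖ ^ 2 * W l = c) ∧ ∫ l, ‖r l - 1‖ ^ 2 ∂circ ≤ 2 * Real.pi * (c - 1) ∧
      ∀ δ : ℝ, 0 < δ → ∃ Q ∈ pastSpan 1,
        Integrable (fun l => ‖r l - (1 - Q l 0)‖ ^ 2 * W l) circ ∧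
        ∫ l, ‖r l - (1 - Q l 0)‖ ^ 2 * W l ∂circ < δ := by
  have hG := isMinDensity_scalarDensity hW h1
  have hG' := hG.toIsSpectralDensity
  set B : ℝ → Fin 1 → ℂ := fun _ _ => 1 with hBdef
  have hB : MemL2 (scalarDensity W) B :=
    memL2_of_bounded hG' aestronglyMeasurable_const (M := 1) (ae_of_all _ fun l => by simp [hBdef])
  obtain ⟨g, hg, horth⟩ := exists_projection hG hB
  set r : ℝ → ℂ := fun l => (B - g) l 0 with hr
  have hrm : MemL2 (scalarDensity W) (B - g) := hB.sub hG' hg.memL2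
  have hrsq : Integrable (fun l => ‖r l‖ ^ 2 * W l) circ := by
    simpa only [quad_scalarDensity] using hrm.integrable
  have hri : Integrable r circ := (hG.integrable_apply hrm 0).1
  have hcoef : ∀ k : ℤ, k < 0 → fcoeff (fun l => ((‖r l‖ ^ 2 * W l : ℝ) : ℂ)) k = 0 := by
    intro k hk
    have hlim : PastLim (scalarDensity W) fun l => expo k l • (B - g) l := by
      have h2 := (PastLim.of_mem hG' (expo_smul_mem hk (fun _ => 1))).sub hG'
        (hg.expo_smul hk.le)
      convert h2 using 1
      ext1 l
      simp [hBdef, smul_sub]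
    have h3 := hlim.integral_herm_eq_zero hG' hrm horth
    simp only [herm_scalarDensity, Pi.smul_apply, smul_eq_mul, star_mul', star_expo] at h3
    rw [fcoeff_eq]
    convert mul_zero _ using 2
    rw [← h3]
    congr 1
    ext l
    have h4 : r l * star (r l) = ((‖r l‖ ^ 2 : ℝ) : ℂ) := by
      rw [Complex.star_def, Complex.mul_conj, Complex.normSq_eq_norm_sq]
    rw [Complex.ofReal_mul, ← h4]
    ring
  have hcoef' : ∀ k : ℤ, k ≠ 0 → fcoeff (fun l => ((‖r l‖ ^ 2 * W l : ℝ) : ℂ)) k = 0 := by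
    intro k hk
    rcases lt_or_gt_of_ne hk with h | h
    · exact hcoef k h
    · have h2 := fcoeff_star (fun l => ((‖r l‖ ^ 2 * W l : ℝ) : ℂ)) k
      rw [hcoef (-k) (by lia), star_zero] at h2
      rw [← h2]
      congr 1
      ext l
      rw [Complex.star_def, Complex.conj_ofReal]
  have hpi : (Real.pi : ℂ) ≠ 0 := by exact_mod_cast Real.pi_ne_zero
  set c : ℝ := (2 * Real.pi)⁻¹ * ∫ l, ‖r l‖ ^ 2 * W l ∂circ with hc
  have hc0 : fcoeff (fun l => ((‖r l‖ ^ 2 * W l : ℝ) : ℂ)) 0 = (c : ℂ) := by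
    rw [fcoeff_eq, hc]
    simp only [neg_zero, expo_zero, mul_one]
    rw [integral_complex_ofReal]
    push_cast
    ring
  have hconst : ∀ᵐ l ∂circ, ‖r l‖ ^ 2 * W l = c := by
    have := ae_eq_of_fcoeff_eq hrsq.ofReal (integrable_const (c : ℂ)) fun k => by
      have h2 : fcoeff (fun _ => (c : ℂ)) k = c * fcoeff (fun _ => 1) k := by
        rw [← fcoeff_const_mul, mul_one]
      rw [h2, fcoeff_one]
      by_cases hk : k = 0
      · subst hk; simpa using hc0
      · simpa [hk] using hcoef' k hk
    filter_upwards [this] with l hl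
    exact Complex.ofReal_injective hl
  have hle : ∀ᵐ l ∂circ, ‖r l‖ ^ 2 ≤ c := by
    filter_upwards [hconst] with l hl
    nlinarith [h1 l, sq_nonneg ‖r l‖]
  have hrsq' : Integrable (fun l => ‖r l‖ ^ 2) circ :=
    (integrable_const c).mono' (hri.aestronglyMeasurable.norm.pow 2) (by
      filter_upwards [hle] with l hl
      rwa [Real.norm_of_nonneg (sq_nonneg _)])
  have hmean : ∫ l, r l ∂circ = 2 * Real.pi := by
    have h2 := hg.fcoeff_eq_zero hG 0 le_rfl
    have h3 : fcoeff r 0 = 1 := by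
      have := fcoeff_sub (integrable_const (1 : ℂ)) (hG.integrable_apply hg.memL2 0).1 0
      rw [h2, fcoeff_one, if_pos rfl, sub_zero] at this
      exact this
    rw [fcoeff_eq] at h3
    simp only [neg_zero, expo_zero, mul_one] at h3
    field_simp at h3
    exact h3
  refine ⟨r, c, hri.aestronglyMeasurable, ?_, hconst, ?_, fun δ hδ => ?_⟩
  · have h2 := hg.nrm_eq hG' hB horth
    have h3 := nrm_nonneg hG' g
    simp only [nrm, quad_scalarDensity] at h2 h3
    rw [hc, ← mul_assoc, mul_inv_cancel₀ (by positivity), one_mul]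
    simp only [hBdef, norm_one, one_pow, one_mul] at h2
    change _ = (∫ l, ‖r l‖ ^ 2 * W l ∂circ) + _ at h2
    linarith
  · have e : ∀ l, ‖r l - 1‖ ^ 2 = (‖r l‖ ^ 2 - 2 * (r l).re) + 1 := fun l => by
      rw [← Complex.normSq_eq_norm_sq, ← Complex.normSq_eq_norm_sq, Complex.normSq_sub]
      simp
      ring
    have i1 : Integrable (fun l => 2 * (r l).re) circ := hri.re.const_mul 2
    have i2 : Integrable (fun l => ‖r l‖ ^ 2 - 2 * (r l).re) circ := hrsq'.sub i1
    simp only [e]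
    rw [integral_add i2 (integrable_const 1), integral_sub hrsq' i1, integral_const_mul]
    have h2 : ∫ l, (r l).re ∂circ = 2 * Real.pi := by
      have := integral_re hri
      rw [hmean] at this
      refine this.trans ?_
      simp
    have h3 : ∫ l, ‖r l‖ ^ 2 ∂circ ≤ 2 * Real.pi * c := by
      have := integral_mono_ae hrsq' (integrable_const c) hle
      rwa [integral_const, circ_real_univ, smul_eq_mul] at this
    rw [h2, integral_const, circ_real_univ, smul_eq_mul]
    linarith
  · obtain ⟨Q, hQ, hlt⟩ := hg.approx δ hδ
    have e : ∀ l, ‖r l - (1 - Q l 0)‖ ^ 2 * W l = quad (scalarDensity W l) ((g - Q) l) := by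
      intro l
      rw [quad_scalarDensity, ← norm_neg]
      simp only [hr, hBdef, Pi.sub_apply]
      congr 3
      ring
    refine ⟨Q, hQ, ?_⟩
    simp only [e]
    exact ⟨(hg.memL2.sub hG' (memL2_of_mem hG' hQ)).integrable, hlt⟩

/-- Multiplication by the conjugate of an outer function of `exists_outer` preserves analyticity. -/
theorem fcoeff_star_mul_eq_zero {W : ℝ → ℝ} {r u : ℝ → ℂ} (hW : ∀ l, 0 ≤ W l)
    (happ : ∀ δ : ℝ, 0 < δ → ∃ Q ∈ pastSpan 1,
        Integrable (fun l => ‖r l - (1 - Q l 0)‖ ^ 2 * W l) circ ∧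
        ∫ l, ‖r l - (1 - Q l 0)‖ ^ 2 * W l ∂circ < δ)
    (hu : Integrable u circ) (hru : Integrable (fun l => star (r l) * u l) circ)
    {M : ℝ} (hM : 0 ≤ M) (huW : ∀ l, ‖u l‖ ≤ M * W l) {k₀ : ℤ}
    (hu0 : ∀ k < k₀, fcoeff u k = 0) {k : ℤ} (hk : k < k₀) :
    fcoeff (fun l => star (r l) * u l) k = 0 := by
  choose Q hQ hQi hQlt using fun n : ℕ => happ (1 / ((n : ℝ) + 1)) (by positivity)
  have hPi : ∀ n, Integrable (fun l => star (1 - Q n l 0) * u l) circ := fun n => by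
    obtain ⟨C, hC⟩ := bounded_of_mem (hQ n)
    refine hu.bdd_mul (c := 1 + C) ?_ (ae_of_all _ fun l => ?_)
    · have : Continuous fun l => star (1 - Q n l 0) := by
        have := continuous_of_mem (hQ n)
        fun_prop
      exact this.aestronglyMeasurable
    · rw [norm_star]
      refine (norm_sub_le _ _).trans ?_
      rw [norm_one]
      gcongr
      exact (norm_le_pi_norm _ 0).trans (hC l)
  have hP0 : ∀ n, fcoeff (fun l => star (1 - Q n l 0) * u l) k = 0 := by
    intro n
    obtain ⟨N, x, hx⟩ := hQ n
    have e : ∀ l, star (1 - Q n l 0) * u l =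
        u l - ∑ m ∈ Finset.range N, star (x m 0) * (expo ((m : ℤ) + 1) l * u l) := by
      intro l
      rw [hx, pastFun_eq, star_sub, sub_mul, star_one, one_mul, Finset.sum_apply, star_sum,
        Finset.sum_mul]
      congr 1
      refine Finset.sum_congr rfl fun m _ => ?_
      rw [Pi.smul_apply, smul_eq_mul, star_mul', star_expo, neg_neg]
      ring
    have hi : ∀ m ∈ Finset.range N, Integrable
        (fun l => star (x m 0) * (expo ((m : ℤ) + 1) l * u l)) circ := fun m _ => by
      refine Integrable.const_mul ?_ _
      simpa only [mul_comm] using integrable_mul_expo hu ((m : ℤ) + 1)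
    simp only [e]
    rw [fcoeff_sub hu (integrable_finsetSum _ hi), fcoeff_sum _ hi, hu0 k hk, zero_sub,
      neg_eq_zero]
    refine Finset.sum_eq_zero fun m _ => ?_
    rw [fcoeff_const_mul, fcoeff_expo_mul, hu0 _ (by lia), mul_zero]
  have hlim : Tendsto (fun n => ∫ l, ‖star (r l) * u l - star (1 - Q n l 0) * u l‖ ∂circ) atTop
      (𝓝 0) := by
    have h1 : Tendsto (fun n : ℕ => √((1 / ((n : ℝ) + 1)) * ∫ l, M * ‖u l‖ ∂circ))
        atTop (𝓝 0) := by
      have := ((tendsto_one_div_add_atTop_nhds_zero_nat (𝕜 := ℝ)).mul_const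
        (∫ l, M * ‖u l‖ ∂circ)).sqrt
      simpa using this
    refine squeeze_zero (fun n => integral_nonneg fun _ => norm_nonneg _) (fun n => ?_) h1
    refine Real.le_sqrt_of_sq_le ?_
    have := (integrable_and_sq_integral_norm_le (hru.sub (hPi n)).aestronglyMeasurable (hQi n)
      (hu.norm.const_mul M) (ae_of_all _ fun l => mul_nonneg (sq_nonneg _) (hW l))
      (ae_of_all _ fun l => mul_nonneg hM (norm_nonneg _)) (ae_of_all _ fun l => ?_)).2
    · refine this.trans (mul_le_mul_of_nonneg_right (hQlt n).le ?_)
      exact integral_nonneg fun l => mul_nonneg hM (norm_nonneg _)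
    · rw [Pi.sub_apply, ← sub_mul, ← star_sub, norm_mul, norm_star, mul_pow, mul_assoc]
      refine mul_le_mul_of_nonneg_left ?_ (sq_nonneg _)
      nlinarith [huW l, norm_nonneg (u l)]
  have := fcoeff_tendsto hPi hru hlim k
  simp only [hP0] at this
  exact tendsto_nhds_unique this tendsto_const_nhds

/-- The boundary form of Smirnov's theorem: if `c` and `s` are integrable, `c` has only
coefficients of index `k ≥ 0` and `s` only of index `k ≥ 1`, then `∑ c_p s_p` has mean zero as soon
as it is integrable. The bounded analytic functions of `exists_outer` make both factors square
integrable, where Parseval's identity applies, and tend to `1`. -/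
theorem integral_sum_mul_eq_zero {T : ℕ} {c s : ℝ → Fin T → ℂ}
    (hc : ∀ p, Integrable (fun l => c l p) circ) (hs : ∀ p, Integrable (fun l => s l p) circ)
    (hc0 : ∀ p, ∀ k < 0, fcoeff (fun l => c l p) k = 0)
    (hs0 : ∀ p, ∀ k < 1, fcoeff (fun l => s l p) k = 0)
    (hcs : Integrable (fun l => ∑ p, c l p * s l p) circ) :
    ∫ l, ∑ p, c l p * s l p ∂circ = 0 := by
  set ψ : ℝ → ℝ := fun l => ∑ p, (‖c l p‖ + ‖s l p‖) with hψ
  have hψi : Integrable ψ circ := integrable_finsetSum _ fun p _ => (hc p).norm.add (hs p).norm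
  have hψ0 : ∀ l, 0 ≤ ψ l := fun l => Finset.sum_nonneg fun p _ => by positivity
  have hcψ : ∀ l p, ‖c l p‖ ≤ ψ l := fun l p => by
    refine le_trans ?_ (Finset.single_le_sum (f := fun p => ‖c l p‖ + ‖s l p‖)
      (fun _ _ => by positivity) (Finset.mem_univ p))
    simp
  have hsψ : ∀ l p, ‖s l p‖ ≤ ψ l := fun l p => by
    refine le_trans ?_ (Finset.single_le_sum (f := fun p => ‖c l p‖ + ‖s l p‖)
      (fun _ _ => by positivity) (Finset.mem_univ p))
    simp
  set ε : ℕ → ℝ := fun n => 1 / ((n : ℝ) + 1) with hε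
  have hεpos : ∀ n, 0 < ε n := fun n => by positivity
  have hε1 : ∀ n, ε n ≤ 1 := fun n => by
    rw [hε, div_le_one (by positivity)]
    simp
  set W : ℕ → ℝ → ℝ := fun n l => 1 + ε n * ψ l with hW
  have hWi : ∀ n, Integrable (W n) circ := fun n =>
    (integrable_const (1 : ℝ)).add (hψi.const_mul _)
  have hW1 : ∀ n l, 1 ≤ W n l := fun n l => by
    have := mul_nonneg (hεpos n).le (hψ0 l)
    simp only [hW]; linarith
  have hW0 : ∀ n l, 0 ≤ W n l := fun n l => zero_le_one.trans (hW1 n l)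
  have hψW : ∀ n l, ψ l ≤ (ε n)⁻¹ * W n l := fun n l => by
    rw [inv_mul_eq_div, le_div_iff₀ (hεpos n)]
    simp only [hW]
    linarith [mul_comm (ψ l) (ε n)]
  choose r κ hrm hκ hrW hr1 happ using fun n => exists_outer (hWi n) (hW1 n)
  have hI0 : 0 ≤ ∫ l, ψ l ∂circ := integral_nonneg hψ0
  have hκle : ∀ n, 2 * Real.pi * (κ n - 1) ≤ ε n * ∫ l, ψ l ∂circ := by
    intro n
    have h1 := hκ n
    have h2 : ∫ l, W n l ∂circ = 2 * Real.pi + ε n * ∫ l, ψ l ∂circ := by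
      simp only [hW]
      rw [integral_add (integrable_const _) (hψi.const_mul _), integral_const_mul, integral_const,
        circ_real_univ, smul_eq_mul, mul_one]
    linarith
  have hκC : ∀ n, κ n ≤ 1 + ∫ l, ψ l ∂circ := by
    intro n
    have h1 := hκle n
    have h2 : ε n * ∫ l, ψ l ∂circ ≤ 1 * ∫ l, ψ l ∂circ := by gcongr; exact hε1 n
    have h3 := Real.pi_gt_three
    by_contra h4
    push Not at h4
    have h5 : 0 < κ n - 1 := by linarith
    nlinarith
  have hrle : ∀ n, ∀ᵐ l ∂circ, ‖r n l‖ ^ 2 ≤ κ n := fun n => by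
    filter_upwards [hrW n] with l hl
    nlinarith [hW1 n l, sq_nonneg ‖r n l‖]
  have hrψ : ∀ n, ∀ᵐ l ∂circ, ‖r n l‖ ^ 2 * ψ l ≤ (ε n)⁻¹ * κ n := fun n => by
    filter_upwards [hrW n] with l hl
    rw [← hl]
    nlinarith [hψW n l, sq_nonneg ‖r n l‖]
  -- Both factors become square integrable after multiplication by the outer function.
  have hL2 : ∀ n (v : ℝ → ℂ), Integrable v circ → (∀ l, ‖v l‖ ≤ ψ l) →
      MemLp (fun l => star (r n l) * v l) 2 circ := by
    intro n v hv hvψ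
    have hm : AEStronglyMeasurable (fun l => star (r n l) * v l) circ :=
      (continuous_star.comp_aestronglyMeasurable (hrm n)).mul hv.aestronglyMeasurable
    refine (memLp_two_iff_integrable_sq_norm hm).2 ?_
    refine (hv.norm.const_mul ((ε n)⁻¹ * κ n)).mono' (hm.norm.pow 2) ?_
    filter_upwards [hrψ n] with l hl
    rw [Real.norm_of_nonneg (sq_nonneg _), norm_mul, norm_star, mul_pow]
    have h1 : ‖r n l‖ ^ 2 * ‖v l‖ ≤ (ε n)⁻¹ * κ n :=
      le_trans (mul_le_mul_of_nonneg_left (hvψ l) (sq_nonneg _)) hl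
    calc ‖r n l‖ ^ 2 * ‖v l‖ ^ 2 = (‖r n l‖ ^ 2 * ‖v l‖) * ‖v l‖ := by ring
      _ ≤ _ := mul_le_mul_of_nonneg_right h1 (norm_nonneg _)
  have hz : ∀ n, ∫ l, star (r n l) ^ 2 * ∑ p, c l p * s l p ∂circ = 0 := by
    intro n
    have hp : ∀ p, ∫ l, (star (r n l) * c l p) * (star (r n l) * s l p) ∂circ = 0 := by
      intro p
      have h1 := hL2 n _ (hc p) (fun l => hcψ l p)
      have h2 := hL2 n _ (hs p) (fun l => hsψ l p)
      refine integral_mul_eq_zero_of_fcoeff h1 h2 fun k => ?_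
      rcases lt_or_ge k 0 with hk | hk
      · exact Or.inl (fcoeff_star_mul_eq_zero (hW0 n) (happ n) (hc p)
          (h1.integrable (by norm_num)) (inv_nonneg.2 (hεpos n).le)
          (fun l => (hcψ l p).trans (hψW n l)) (hc0 p) hk)
      · exact Or.inr (fcoeff_star_mul_eq_zero (hW0 n) (happ n) (hs p)
          (h2.integrable (by norm_num)) (inv_nonneg.2 (hεpos n).le)
          (fun l => (hsψ l p).trans (hψW n l)) (hs0 p) (by lia))
    have e : ∀ l, star (r n l) ^ 2 * ∑ p, c l p * s l p =
        ∑ p, (star (r n l) * c l p) * (star (r n l) * s l p) := fun l => by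
      rw [Finset.mul_sum]
      exact Finset.sum_congr rfl fun p _ => by ring
    have hi : ∀ p, Integrable (fun l => (star (r n l) * c l p) * (star (r n l) * s l p)) circ :=
      fun p =>
        (hL2 n _ (hc p) (fun l => hcψ l p)).integrable_mul (hL2 n _ (hs p) (fun l => hsψ l p))
    simp only [e]
    rw [integral_finsetSum _ fun p _ => hi p]
    exact Finset.sum_eq_zero fun p _ => hp p
  have hmeas : TendstoInMeasure circ r atTop fun _ => (1 : ℂ) := by
    refine tendstoInMeasure_of_tendsto_eLpNorm (p := 1) one_ne_zero hrm
      aestronglyMeasurable_const ?_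
    have hr2 : ∀ n, Integrable (fun l => ‖r n l - 1‖ ^ 2) circ := fun n => by
      refine (integrable_const (2 * κ n + 2)).mono'
        (((hrm n).sub aestronglyMeasurable_const).norm.pow 2) ?_
      filter_upwards [hrle n] with l hl
      rw [Real.norm_of_nonneg (sq_nonneg _)]
      have h1 := norm_sub_le (r n l) 1
      rw [norm_one] at h1
      nlinarith [norm_nonneg (r n l - 1), sq_nonneg (‖r n l‖ - 1)]
    have hr3 := fun n => integrable_and_sq_integral_norm_le
      ((hrm n).sub (aestronglyMeasurable_const (b := (1 : ℂ)))) (hr2 n) (integrable_const (1 : ℝ))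
      (ae_of_all _ fun l => sq_nonneg _) (ae_of_all _ fun l => zero_le_one)
      (ae_of_all _ fun l => by simp)
    have hb : Tendsto (fun n => ENNReal.ofReal
        √((ε n * ∫ l, ψ l ∂circ) * ∫ _, (1 : ℝ) ∂circ)) atTop (𝓝 0) := by
      have h1 := (((tendsto_one_div_add_atTop_nhds_zero_nat (𝕜 := ℝ)).mul_const
        (∫ l, ψ l ∂circ)).mul_const (∫ _, (1 : ℝ) ∂circ)).sqrt
      have h2 := ENNReal.tendsto_ofReal h1
      rwa [zero_mul, zero_mul, Real.sqrt_zero, ENNReal.ofReal_zero] at h2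
    refine tendsto_of_tendsto_of_tendsto_of_le_of_le tendsto_const_nhds hb
      (fun _ => zero_le) fun n => ?_
    rw [eLpNorm_one_eq_lintegral_enorm]
    have h4 := ofReal_integral_norm_eq_lintegral_enorm (hr3 n).1
    refine (le_of_eq h4.symm).trans (ENNReal.ofReal_le_ofReal (Real.le_sqrt_of_sq_le ?_))
    refine (hr3 n).2.trans (mul_le_mul_of_nonneg_right ((hr1 n).trans (hκle n)) ?_)
    exact integral_nonneg fun _ => zero_le_one
  obtain ⟨ns, -, hns⟩ := hmeas.exists_seq_tendsto_ae
  have hdct := tendsto_integral_of_dominated_convergence (μ := circ)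
    (F := fun n l => star (r (ns n) l) ^ 2 * ∑ p, c l p * s l p)
    (f := fun l => ∑ p, c l p * s l p)
    (fun l => (1 + ∫ l, ψ l ∂circ) * ‖∑ p, c l p * s l p‖)
    (fun n => ((continuous_star.comp_aestronglyMeasurable (hrm _)).pow 2).mul
      hcs.aestronglyMeasurable) (hcs.norm.const_mul _)
    (fun n => by
      filter_upwards [hrle (ns n)] with l hl
      rw [norm_mul, norm_pow, norm_star]
      exact mul_le_mul_of_nonneg_right (hl.trans (hκC _)) (norm_nonneg _))
    (by
      filter_upwards [hns] with l hl
      have h1 := (((continuous_star.tendsto (1 : ℂ)).comp hl).pow 2).mul_const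
        (∑ p, c l p * s l p)
      simpa using h1)
  simp only [hz] at hdct
  exact (tendsto_nhds_unique hdct tendsto_const_nhds)

/-! ### Inverse densities -/

section Inverse

variable {T : ℕ} {G : ℝ → Matrix (Fin T) (Fin T) ℂ}

theorem aesm_det (hG : ∀ i j, AEStronglyMeasurable (fun l => G l i j) circ) :
    AEStronglyMeasurable (fun l => (G l).det) circ := by
  simp only [det_apply]
  exact Finset.aestronglyMeasurable_fun_sum _ fun σ _ =>
    (Finset.aestronglyMeasurable_fun_prod _ fun i _ => hG _ _).const_smul _

theorem aesm_inv (hG : ∀ i j, AEStronglyMeasurable (fun l => G l i j) circ) (i j : Fin T) :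
    AEStronglyMeasurable (fun l => (G l)⁻¹ i j) circ := by
  simp only [inv_def, Matrix.smul_apply, Ring.inverse_eq_inv', smul_eq_mul, adjugate_apply]
  refine (aesm_det hG).aemeasurable.inv.aestronglyMeasurable.mul (aesm_det fun p q => ?_)
  simp only [updateRow_apply]
  split_ifs
  · exact aestronglyMeasurable_const
  · exact hG _ _

theorem aesm_transpose_mulVec (hG : ∀ i j, AEStronglyMeasurable (fun l => G l i j) circ)
    {h : ℝ → Fin T → ℂ} (hh : AEStronglyMeasurable h circ) :
    AEStronglyMeasurable (fun l => (G l)ᵀ *ᵥ h l) circ := by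
  refine aesm_pi fun p => ?_
  simp only [mulVec, dotProduct, transpose_apply]
  exact Finset.aestronglyMeasurable_fun_sum _ fun j _ => (hG _ _).mul (aesm_apply hh j)

theorem norm_entry_le_trace {A : Matrix (Fin T) (Fin T) ℂ} (hA : A.PosSemidef) (i j : Fin T) :
    ‖A i j‖ ≤ 2 * A.trace.re := by
  have h := norm_herm_le_add hA (Pi.single i 1) (Pi.single j 1)
  rw [herm_single_right, quad_single, quad_single] at h
  have hd : ∀ k, (A k k).re ≤ A.trace.re := fun k => by
    rw [Matrix.trace, Complex.re_sum]
    exact Finset.single_le_sum (f := fun k => (A k k).re)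
      (fun k _ => (Complex.nonneg_iff.1 hA.diag_nonneg).1) (Finset.mem_univ k)
  have e : (Aᵀ *ᵥ Pi.single i 1) j = A i j := by simp
  rw [e] at h
  linarith [hd i, hd j]

theorem trace_re_nonneg {A : Matrix (Fin T) (Fin T) ℂ} (hA : A.PosSemidef) : 0 ≤ A.trace.re :=
  (Complex.nonneg_iff.1 hA.trace_nonneg).1

theorem IsMinDensity.inv (hG : IsMinDensity G) : IsMinDensity fun l => (G l)⁻¹ := by
  refine ⟨⟨fun i j => ?_, ?_⟩, ?_, ?_⟩
  · refine (hG.integrable_inv.re.const_mul 2).mono' (aesm_inv hG.aesm i j) ?_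
    filter_upwards [hG.posSemidef] with l hp
    exact norm_entry_le_trace hp.inv i j
  · filter_upwards [hG.posSemidef] with l hp using hp.inv
  · filter_upwards [hG.isUnit_det] with l hu using isUnit_nonsing_inv_det _ hu
  · have h : Integrable (fun l => (G l).trace) circ := integrable_finsetSum _ fun i _ =>
      hG.integrable i i
    refine h.congr ?_
    filter_upwards [hG.isUnit_det] with l hu
    rw [nonsing_inv_nonsing_inv _ hu]

theorem inv_transpose_mulVec_cancel {A : Matrix (Fin T) (Fin T) ℂ} (hu : IsUnit A.det)
    (x : Fin T → ℂ) : (A⁻¹)ᵀ *ᵥ (Aᵀ *ᵥ x) = x := by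
  rw [mulVec_mulVec, ← transpose_mul, mul_nonsing_inv _ hu, transpose_one, one_mulVec]

theorem transpose_mulVec_inv_cancel {A : Matrix (Fin T) (Fin T) ℂ} (hu : IsUnit A.det)
    (x : Fin T → ℂ) : Aᵀ *ᵥ ((A⁻¹)ᵀ *ᵥ x) = x := by
  rw [mulVec_mulVec, ← transpose_mul, nonsing_inv_mul _ hu, transpose_one, one_mulVec]

theorem PosSemidef.isUnit_det_add_one {A : Matrix (Fin T) (Fin T) ℂ} (hA : A.PosSemidef) :
    IsUnit (A + 1).det := by
  have : (A + 1).PosDef := PosDef.posSemidef_add hA PosDef.one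
  exact (isUnit_iff_isUnit_det _).1 this.isUnit

theorem quad_add_one (A : Matrix (Fin T) (Fin T) ℂ) (x : Fin T → ℂ) :
    quad (A + 1) x = quad A x + ∑ p, ‖x p‖ ^ 2 := by
  simp only [quad, herm, add_mulVec, dotProduct_add, one_mulVec, Complex.add_re]
  congr 1
  simp only [dotProduct, Complex.re_sum]
  refine Finset.sum_congr rfl fun p _ => ?_
  rw [Pi.star_apply, Complex.star_def, Complex.mul_conj, Complex.ofReal_re,
    Complex.normSq_eq_norm_sq]

/-- The diagonal of `(A + 1)⁻¹` is at most `1`. -/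
theorem norm_inv_add_one_diag_le {A : Matrix (Fin T) (Fin T) ℂ} (hA : A.PosSemidef) (p : Fin T) :
    ‖(A + 1)⁻¹ p p‖ ≤ 1 := by
  have hu := PosSemidef.isUnit_det_add_one hA
  have hA1 : (A + 1).PosSemidef := hA.add PosSemidef.one
  set y : Fin T → ℂ := ((A + 1)⁻¹)ᵀ *ᵥ Pi.single p 1 with hy
  have hyp : y p = (A + 1)⁻¹ p p := by simp [hy]
  have h1 : ((A + 1)⁻¹ p p).re = quad (A + 1) y := by
    rw [← quad_single, quad, herm_inv hA1 hu, quad]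
  have h2 : ‖y p‖ ^ 2 ≤ ∑ q, ‖y q‖ ^ 2 := Finset.single_le_sum (f := fun q => ‖y q‖ ^ 2)
    (fun _ _ => sq_nonneg _) (Finset.mem_univ p)
  rw [quad_add_one] at h1
  have h3 := quad_nonneg hA y
  rw [← hyp] at h1 ⊢
  have h4 := Complex.re_le_norm (y p)
  nlinarith [norm_nonneg (y p)]

theorem IsSpectralDensity.add_one (hG : IsSpectralDensity G) : IsMinDensity fun l => G l + 1 := by
  have h : IsSpectralDensity fun l => G l + 1 := by
    refine ⟨fun i j => (hG.integrable i j).add (integrable_const ((1 : Matrix (Fin T) (Fin T) ℂ) i j)), ?_⟩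
    filter_upwards [hG.posSemidef] with l hp using hp.add PosSemidef.one
  refine ⟨h, ?_, ?_⟩
  · filter_upwards [hG.posSemidef] with l hp using PosSemidef.isUnit_det_add_one hp
  · refine integrable_finsetSum _ fun p _ => ?_
    refine (integrable_const (1 : ℝ)).mono' (aesm_inv h.aesm p p) ?_
    filter_upwards [hG.posSemidef] with l hp using norm_inv_add_one_diag_le hp p

end Inverse

/-! ### Absolutely convergent trigonometric series -/

theorem integrable_star {u : ℝ → ℂ} (hu : Integrable u circ) :
    Integrable (fun l => star (u l)) circ :=
  memLp_one_iff_integrable.1 (memLp_one_iff_integrable.2 hu).star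

/-- The Fourier coefficients of the product of an absolutely convergent series with an integrable
function. -/
theorem hasSum_fcoeff_mul {β : ℕ → ℂ} (hβ : Summable fun k => ‖β k‖) {u : ℝ → ℂ}
    (hu : Integrable u circ) (m : ℤ) :
    HasSum (fun k : ℕ => β k * fcoeff u (m - k))
      (fcoeff (fun l => (∑' k : ℕ, expo k l * β k) * u l) m) := by
  have hi : ∀ k : ℕ, Integrable (fun l => expo k l * β k * u l * expo (-m) l) circ := fun k => by
    refine integrable_mul_expo ?_ _
    have := (integrable_mul_expo hu k).const_mul (β k)
    refine this.congr (ae_of_all _ fun l => ?_)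
    ring
  have hn : ∀ k : ℕ, ∫ l, ‖expo k l * β k * u l * expo (-m) l‖ ∂circ = ‖β k‖ * ∫ l, ‖u l‖ ∂circ := by
    intro k
    rw [← integral_const_mul]
    congr 1
    ext l
    simp
  have h := hasSum_integral_of_summable_integral_norm hi (by
    simp only [hn]
    exact hβ.mul_right _)
  have h2 := h.mul_left (1 / (2 * Real.pi) : ℂ)
  rw [fcoeff_eq]
  have e1 : (fun k : ℕ => β k * fcoeff u (m - k)) =
      fun k : ℕ => (1 / (2 * Real.pi) : ℂ) * ∫ l, expo k l * β k * u l * expo (-m) l ∂circ := by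
    ext k
    rw [fcoeff_eq, ← mul_assoc, mul_comm (β k), mul_assoc, ← integral_const_mul]
    congr 2
    ext l
    rw [show -(m - (k : ℤ)) = k + -m by ring, expo_add]
    ring
  have e2 : ∀ l, (∑' k : ℕ, expo k l * β k) * u l * expo (-m) l =
      ∑' k : ℕ, expo k l * β k * u l * expo (-m) l := fun l => by
    rw [← tsum_mul_right, ← tsum_mul_right]
  simp only [e1, e2]
  exact h2

theorem expo_natCast (k : ℕ) (l : ℝ) : Complex.exp (Complex.I * k * l) = expo k l := by
  simp [expo]

section Series

variable {T : ℕ} {b : ℕ → Fin T → ℂ}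

theorem summable_expo_smul (hb : Summable fun k => ‖b k‖) (l : ℝ) :
    Summable fun k : ℕ => expo k l • b k := by
  refine Summable.of_norm ?_
  simpa [norm_smul] using hb

theorem summable_apply (hb : Summable fun k => ‖b k‖) (p : Fin T) : Summable fun k => ‖b k p‖ :=
  hb.of_nonneg_of_le (fun _ => norm_nonneg _) fun k => norm_le_pi_norm (b k) p

theorem bSeries_eq (l : ℝ) : bSeries b l = ∑' k : ℕ, expo k l • b k := by
  simp only [bSeries, expo_natCast]

theorem bSeries_apply (hb : Summable fun k => ‖b k‖) (l : ℝ) (p : Fin T) :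
    bSeries b l p = ∑' k : ℕ, expo k l * b k p := by
  rw [bSeries_eq, tsum_apply (summable_expo_smul hb l)]
  rfl

theorem norm_bSeries_le (hb : Summable fun k => ‖b k‖) (l : ℝ) : ‖bSeries b l‖ ≤ ∑' k, ‖b k‖ := by
  rw [bSeries_eq]
  exact tsum_of_norm_bounded hb.hasSum fun k => by simp [norm_smul]

theorem continuous_bSeries (hb : Summable fun k => ‖b k‖) : Continuous (bSeries b) := by
  rw [show bSeries b = fun l => ∑' k : ℕ, expo k l • b k from funext bSeries_eq]
  exact continuous_tsum (fun k => by fun_prop) hb fun k l => by simp [norm_smul]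

theorem fcoeff_bSeries (hb : Summable fun k => ‖b k‖) (p : Fin T) (j : ℤ) :
    fcoeff (fun l => bSeries b l p) j = if 0 ≤ j then b j.toNat p else 0 := by
  have h := hasSum_fcoeff_mul (summable_apply hb p) (integrable_const (1 : ℂ)) j
  simp only [mul_one, ← bSeries_apply hb, fcoeff_one] at h
  refine h.unique ?_
  split_ifs with hj
  · convert hasSum_ite_eq j.toNat (b j.toNat p) using 1
    ext k
    by_cases hk : k = j.toNat
    · subst hk; simp [hj]
    · rw [if_neg hk, if_neg (by lia), mul_zero]
  · convert hasSum_zero using 1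
    ext k
    rw [if_neg (by lia), mul_zero]

theorem memL2_bSeries {G : ℝ → Matrix (Fin T) (Fin T) ℂ} (hG : IsSpectralDensity G)
    (hb : Summable fun k => ‖b k‖) : MemL2 G (bSeries b) :=
  memL2_of_bounded hG (continuous_bSeries hb).aestronglyMeasurable
    (ae_of_all _ (norm_bSeries_le hb))

end Series

/-! ### The normal equations -/

section Normal

variable {T : ℕ} {G : ℝ → Matrix (Fin T) (Fin T) ℂ}

theorem MemL2.congr {h g : ℝ → Fin T → ℂ} (hh : MemL2 G h) (e : h =ᵐ[circ] g) : MemL2 G g := by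
  refine ⟨hh.aesm.congr e, hh.integrable.congr ?_⟩
  filter_upwards [e] with l hl
  rw [hl]

theorem nrm_congr {h g : ℝ → Fin T → ℂ} (e : h =ᵐ[circ] g) : nrm G h = nrm G g := by
  refine integral_congr_ae ?_
  filter_upwards [e] with l hl
  rw [hl]

theorem PastLim.congr {h g : ℝ → Fin T → ℂ} (hh : PastLim G h) (e : h =ᵐ[circ] g) :
    PastLim G g := by
  refine ⟨hh.memL2.congr e, fun ε hε => ?_⟩
  obtain ⟨Q, hQ, hlt⟩ := hh.approx ε hε
  refine ⟨Q, hQ, lt_of_eq_of_lt (nrm_congr ?_) hlt⟩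
  filter_upwards [e] with l hl
  simp [hl]

/-- The equation `F c = b` for the density `G`; `C` is the function with Fourier coefficients
`c`. -/
structure IsSolution (G : ℝ → Matrix (Fin T) (Fin T) ℂ) (b : ℕ → Fin T → ℂ)
    (C : ℝ → Fin T → ℂ) : Prop where
  integrable : ∀ p, Integrable (fun l => C l p) circ
  analytic : ∀ p (k : ℤ), k < 0 → fcoeff (fun l => C l p) k = 0
  energy : MemL2 (fun l => (G l)⁻¹) C
  solves : ∀ (j : ℕ) p, fcoeff (fun l => (((G l)⁻¹)ᵀ *ᵥ C l) p) j = b j p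

/-- The error `r` of the optimal estimate, `rᵀ = Cᵀ G⁻¹`. -/
def residual (G : ℝ → Matrix (Fin T) (Fin T) ℂ) (C : ℝ → Fin T → ℂ) (l : ℝ) : Fin T → ℂ :=
  ((G l)⁻¹)ᵀ *ᵥ C l

theorem memL2_residual (hG : IsMinDensity G) {C : ℝ → Fin T → ℂ}
    (hC : MemL2 (fun l => (G l)⁻¹) C) : MemL2 G (residual G C) := by
  refine ⟨aesm_transpose_mulVec hG.inv.aesm hC.aesm, hC.integrable.congr ?_⟩
  filter_upwards [hG.posSemidef, hG.isUnit_det] with l hp hu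
  rw [quad, herm_inv hp hu]
  rfl

theorem transpose_mulVec_residual (hG : IsMinDensity G) (C : ℝ → Fin T → ℂ) :
    ∀ᵐ l ∂circ, (G l)ᵀ *ᵥ residual G C l = C l := by
  filter_upwards [hG.isUnit_det] with l hu
  exact transpose_mulVec_inv_cancel hu _

theorem exists_isSolution (hG : IsMinDensity G) {b : ℕ → Fin T → ℂ}
    (hb : Summable fun k => ‖b k‖) :
    ∃ C, IsSolution G b C ∧ PastLim G (bSeries b - residual G C) := by
  have hG' := hG.toIsSpectralDensity
  have hB := memL2_bSeries hG' hb
  obtain ⟨g, hg, horth⟩ := exists_projection hG hB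
  have hr := hB.sub hG' hg.memL2
  set C : ℝ → Fin T → ℂ := fun l => (G l)ᵀ *ᵥ (bSeries b - g) l with hC
  have hres : residual G C =ᵐ[circ] bSeries b - g := by
    filter_upwards [hG.isUnit_det] with l hu
    exact inv_transpose_mulVec_cancel hu _
  refine ⟨C, ⟨hG'.integrable_transpose_mulVec hr, (orthogonal_iff_fcoeff hG' hr).1 horth, ?_, ?_⟩,
    hg.congr ?_⟩
  · refine ⟨aesm_transpose_mulVec hG'.aesm hr.aesm, hr.integrable.congr ?_⟩
    filter_upwards [hG.posSemidef, hG.isUnit_det] with l hp hu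
    rw [quad, quad, herm_inv hp hu, inv_transpose_mulVec_cancel hu]
  · intro j p
    have h1 : (fun l => (((G l)⁻¹)ᵀ *ᵥ C l) p) =ᵐ[circ] fun l => bSeries b l p - g l p := by
      filter_upwards [hres] with l hl
      exact congrFun hl p
    rw [fcoeff_congr h1, fcoeff_sub (hG.integrable_apply hB p).1
      (hG.integrable_apply hg.memL2 p).1, fcoeff_bSeries hb,
      hg.fcoeff_eq_zero hG p (by lia : (0 : ℤ) ≤ j)]
    simp
  · filter_upwards [hres] with l hl
    simp [hl]

/-- `F` is injective on the domain of its closed form: the energy `∫ Cᵀ G⁻¹ conj C` of an element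
`C` of the kernel pairs the analytic `C` with the conjugate of `(G⁻¹)ᵀ C`, whose coefficients have
index `k ≥ 1`. -/
theorem IsSolution.unique (hG : IsMinDensity G) {b : ℕ → Fin T → ℂ} {C C' : ℝ → Fin T → ℂ}
    (hC : IsSolution G b C) (hC' : IsSolution G b C') : C =ᵐ[circ] C' := by
  have hI := hG.inv
  have hI' := hI.toIsSpectralDensity
  have hD := hC.energy.sub hI' hC'.energy
  have hs : ∀ (C : ℝ → Fin T → ℂ), MemL2 (fun l => (G l)⁻¹) C → ∀ p,
      Integrable (fun l => (((G l)⁻¹)ᵀ *ᵥ C l) p) circ := fun C h p =>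
    hI'.integrable_transpose_mulVec h p
  have hprod : (fun l => herm (G l)⁻¹ ((C - C') l) ((C - C') l)) =ᵐ[circ]
      fun l => ∑ p, (C - C') l p * star (((G l)⁻¹)ᵀ *ᵥ (C - C') l) p := by
    filter_upwards [hG.posSemidef] with l hp
    exact herm_eq_dotProduct_transpose hp.inv _ _
  have hint := integrable_herm hI' hD hD
  have h0 := integral_sum_mul_eq_zero (c := C - C')
    (s := fun l => star (((G l)⁻¹)ᵀ *ᵥ (C - C') l))
    (fun p => (hC.integrable p).sub (hC'.integrable p))
    (fun p => integrable_star (hs _ hD p))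
    (fun p k hk => by
      have := fcoeff_sub (hC.integrable p) (hC'.integrable p) k
      rw [hC.analytic p k hk, hC'.analytic p k hk, sub_zero] at this
      exact this)
    (fun p k hk => by
      have h1 := fcoeff_star (fun l => (((G l)⁻¹)ᵀ *ᵥ (C - C') l) p) k
      have h2 := fcoeff_sub (hs C hC.energy p) (hs C' hC'.energy p) (-k)
      have h3 := hC.solves (-k).toNat p
      have h4 := hC'.solves (-k).toNat p
      rw [show (((-k).toNat : ℕ) : ℤ) = -k from Int.toNat_of_nonneg (by lia)] at h3 h4
      rw [h3, h4, sub_self] at h2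
      simp only [Pi.sub_apply, mulVec_sub] at h1 ⊢
      rw [h2, star_zero] at h1
      exact h1)
    (hint.congr hprod)
  have h1 : nrm (fun l => (G l)⁻¹) (C - C') = 0 := by
    have h2 : ((nrm (fun l => (G l)⁻¹) (C - C') : ℝ) : ℂ) = 0 := by
      rw [nrm, ← integral_complex_ofReal]
      refine (integral_congr_ae ?_).trans h0
      filter_upwards [hprod, hG.posSemidef] with l hl hp
      exact (herm_self hp.inv _).symm.trans hl
    exact_mod_cast h2
  have h2 := (integral_eq_zero_iff_of_nonneg_ae (by
    filter_upwards [hG.posSemidef] with l hp using quad_nonneg hp.inv _) hD.integrable).1 h1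
  filter_upwards [h2, hI.posSemidef, hI.isUnit_det] with l hl hp hu
  exact sub_eq_zero.1 (eq_zero_of_quad_eq_zero hp hu hl)

/-- The solution of the normal equations gives the projection onto the past. -/
theorem IsSolution.pastLim (hG : IsMinDensity G) {b : ℕ → Fin T → ℂ}
    (hb : Summable fun k => ‖b k‖) {C : ℝ → Fin T → ℂ} (hC : IsSolution G b C) :
    PastLim G (bSeries b - residual G C) := by
  obtain ⟨C₀, hC₀, h⟩ := exists_isSolution hG hb
  refine h.congr ?_
  filter_upwards [hC.unique hG hC₀] with l hl
  simp [residual, hl]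

theorem IsSolution.orthogonal (hG : IsMinDensity G) {b : ℕ → Fin T → ℂ} {C : ℝ → Fin T → ℂ}
    (hC : IsSolution G b C) :
    ∀ Q ∈ pastSpan T, ∫ l, herm (G l) (residual G C l) (Q l) ∂circ = 0 := by
  refine (orthogonal_iff_fcoeff hG.toIsSpectralDensity (memL2_residual hG hC.energy)).2
    fun p k hk => ?_
  rw [← hC.analytic p k hk]
  refine fcoeff_congr ?_ k
  filter_upwards [transpose_mulVec_residual hG C] with l hl
  rw [hl]

/-- The optimal error `inf ‖B - Q‖²` over the past, without the factor `1 / 2π`. -/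
def optVal (G : ℝ → Matrix (Fin T) (Fin T) ℂ) (B : ℝ → Fin T → ℂ) : ℝ :=
  ⨅ Q : pastSpan T, nrm G (B - Q.1)

theorem bddBelow_nrm (hG : IsSpectralDensity G) (B : ℝ → Fin T → ℂ) :
    BddBelow (Set.range fun Q : pastSpan T => nrm G (B - Q.1)) :=
  ⟨0, by rintro _ ⟨Q, rfl⟩; exact nrm_nonneg hG _⟩

theorem optVal_le (hG : IsSpectralDensity G) (B : ℝ → Fin T → ℂ) {Q : ℝ → Fin T → ℂ}
    (hQ : Q ∈ pastSpan T) : optVal G B ≤ nrm G (B - Q) := ciInf_le (bddBelow_nrm hG B) ⟨Q, hQ⟩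

theorem optVal_nonneg (hG : IsSpectralDensity G) (B : ℝ → Fin T → ℂ) : 0 ≤ optVal G B :=
  le_ciInf fun _ => nrm_nonneg hG _

/-- Pythagoras: `‖r + h‖² = ‖r‖² + ‖h‖²` for `h` in the closed past and `r` orthogonal to it. -/
theorem nrm_sub_of_orthogonal (hG : IsSpectralDensity G) {r h : ℝ → Fin T → ℂ} (hr : MemL2 G r)
    (horth : ∀ Q ∈ pastSpan T, ∫ l, herm (G l) (r l) (Q l) ∂circ = 0) (hh : PastLim G h) :
    nrm G (r - h) = nrm G r + nrm G h := by
  rw [nrm_sub hG hr hh.memL2, hh.integral_herm_eq_zero hG hr horth]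
  simp

theorem sqrt_nrm_sub_le (hG : IsSpectralDensity G) {h g : ℝ → Fin T → ℂ} (hh : MemL2 G h)
    (hg : MemL2 G g) : √(nrm G (h - g)) ≤ √(nrm G h) + √(nrm G g) := by
  refine Real.sqrt_le_iff.2 ⟨by positivity, ?_⟩
  rw [nrm_sub hG hh hg]
  have h1 := norm_integral_herm_sq_le hG hh hg
  have h2 : ‖∫ l, herm (G l) (h l) (g l) ∂circ‖ ≤ √(nrm G h) * √(nrm G g) := by
    refine le_of_sq_le_sq (h1.trans ?_) (by positivity)
    rw [mul_pow, Real.sq_sqrt (nrm_nonneg hG _), Real.sq_sqrt (nrm_nonneg hG _)]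
  have h3 := (abs_le.1 (Complex.abs_re_le_norm (∫ l, herm (G l) (h l) (g l) ∂circ))).1
  rw [add_sq, Real.sq_sqrt (nrm_nonneg hG _), Real.sq_sqrt (nrm_nonneg hG _)]
  linarith

/-- Elements of the closed past do not estimate better than those of the past itself. -/
theorem optVal_le_of_pastLim (hG : IsSpectralDensity G) {B h : ℝ → Fin T → ℂ} (hB : MemL2 G B)
    (hh : PastLim G h) : optVal G B ≤ nrm G (B - h) := by
  have key : ∀ δ : ℝ, 0 < δ → √(optVal G B) ≤ √(nrm G (B - h)) + δ := by
    intro δ hδ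
    obtain ⟨Q, hQ, hlt⟩ := hh.approx (δ ^ 2) (by positivity)
    have hQm := memL2_of_mem hG hQ
    have h1 := sqrt_nrm_sub_le hG (hB.sub hG hh.memL2) (hQm.sub hG hh.memL2)
    rw [sub_sub_sub_cancel_right] at h1
    refine (Real.sqrt_le_sqrt (optVal_le hG B hQ)).trans (h1.trans ?_)
    gcongr
    rw [nrm_sub_comm]
    exact (Real.sqrt_le_left hδ.le).2 hlt.le
  have := le_of_forall_pos_le_add key
  exact (Real.sqrt_le_sqrt_iff (nrm_nonneg hG _)).1 this

/-- The optimal error is the squared norm of the residual. -/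
theorem IsSolution.optVal_eq (hG : IsMinDensity G) {b : ℕ → Fin T → ℂ}
    (hb : Summable fun k => ‖b k‖) {C : ℝ → Fin T → ℂ} (hC : IsSolution G b C) :
    optVal G (bSeries b) = nrm G (residual G C) := by
  have hG' := hG.toIsSpectralDensity
  have hB := memL2_bSeries hG' hb
  have hr := memL2_residual hG hC.energy
  have hg := hC.pastLim hG hb
  refine le_antisymm ?_ (le_ciInf fun Q => ?_)
  · have := optVal_le_of_pastLim hG' hB hg
    rwa [sub_sub_cancel] at this
  · have h1 := nrm_sub_of_orthogonal hG' hr (hC.orthogonal hG)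
      ((PastLim.of_mem hG' Q.2).sub hG' hg)
    have h2 : residual G C - (Q.1 - (bSeries b - residual G C)) = bSeries b - Q.1 := by abel
    rw [h2] at h1
    rw [h1]
    linarith [nrm_nonneg hG' (Q.1 - (bSeries b - residual G C))]

/-- `⟨b, F⁻¹ b⟩` is the optimal error. -/
theorem IsSolution.fInvForm_eq (hG : IsMinDensity G) {b : ℕ → Fin T → ℂ}
    (hb : Summable fun k => ‖b k‖) {C : ℝ → Fin T → ℂ} (hC : IsSolution G b C) :
    fInvForm b C = 1 / (2 * Real.pi) * optVal G (bSeries b) := by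
  have hG' := hG.toIsSpectralDensity
  have hB := memL2_bSeries hG' hb
  have hr := memL2_residual hG hC.energy
  have hg := hC.pastLim hG hb
  have h1 : ∀ p, HasSum (fun k : ℕ => b k p * star (fcoeff (fun l => C l p) k))
      (fcoeff (fun l => bSeries b l p * star (C l p)) 0) := by
    intro p
    have := hasSum_fcoeff_mul (summable_apply hb p) (integrable_star (hC.integrable p)) 0
    simp only [← bSeries_apply hb] at this
    convert this using 1
    ext k
    rw [zero_sub]
    have h2 := fcoeff_star (fun l => C l p) (-(k : ℤ))
    rw [neg_neg] at h2
    rw [← h2]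
  have hi : ∀ p, Integrable (fun l => bSeries b l p * star (C l p)) circ := fun p =>
    (integrable_star (hC.integrable p)).bdd_mul (c := ∑' k, ‖b k‖)
      ((continuous_apply p).comp (continuous_bSeries hb)).aestronglyMeasurable
      (ae_of_all _ fun l => (norm_le_pi_norm _ p).trans (norm_bSeries_le hb l))
  have h2 := hasSum_sum (s := Finset.univ) fun p _ => h1 p
  rw [fInvForm, h2.tsum_eq, ← fcoeff_sum _ fun p _ => hi p]
  have h3 : (fun l => ∑ p, bSeries b l p * star (C l p)) =ᵐ[circ]
      fun l => herm (G l) (residual G C l) (residual G C l) -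
        star (herm (G l) (residual G C l) (residual G C l - bSeries b l)) := by
    filter_upwards [hG.posSemidef, transpose_mulVec_residual hG C] with l hp hl
    have h4 : herm (G l) (bSeries b l) (residual G C l) =
        ∑ p, bSeries b l p * star (C l p) := by
      rw [herm_eq_dotProduct_transpose hp, hl]
      rfl
    rw [← h4, ← herm_swap hp, herm_sub_left]
    ring
  have h5 := hg.integral_herm_eq_zero hG' hr (hC.orthogonal hG)
  have h6 : ∫ l, herm (G l) (residual G C l) (residual G C l - bSeries b l) ∂circ = 0 := by
    rw [← neg_eq_zero, ← integral_neg, ← h5]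
    congr 1
    ext l
    simp only [Pi.sub_apply, herm_sub_right]
    ring
  have h7 : ∫ l, star (herm (G l) (residual G C l) (residual G C l - bSeries b l)) ∂circ = 0 := by
    simp only [Complex.star_def]
    rw [integral_conj, h6, map_zero]
  have h8 : ∫ l, herm (G l) (residual G C l) (residual G C l) ∂circ = (nrm G (residual G C) : ℂ) := by
    rw [nrm, ← integral_complex_ofReal]
    refine integral_congr_ae ?_
    filter_upwards [hG.posSemidef] with l hp
    exact herm_self hp _
  have i1 := integrable_herm hG' hr hr
  have i2 : Integrable (fun l => star (herm (G l) (residual G C l)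
      (residual G C l - bSeries b l))) circ :=
    integrable_star (integrable_herm hG' hr (hr.sub hG' hB))
  rw [fcoeff_congr h3, fcoeff_eq]
  simp only [neg_zero, expo_zero, mul_one]
  rw [integral_sub i1 i2, h7, h8, sub_zero, hC.optVal_eq hG hb,
    show (1 / (2 * Real.pi) : ℂ) = ((1 / (2 * Real.pi) : ℝ) : ℂ) by push_cast; rfl,
    ← Complex.ofReal_mul, Complex.ofReal_re]

/-- A bounded function without Fourier coefficients of index `k ≥ 0` lies in the closed past of
every density: replacing `G` by `G + 1`, its residual is orthogonal to it by
`integral_sum_mul_eq_zero`. -/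
theorem pastLim_of_bounded (hG : IsSpectralDensity G) {g : ℝ → Fin T → ℂ}
    (hgm : AEStronglyMeasurable g circ) {M : ℝ} (hM : ∀ᵐ l ∂circ, ‖g l‖ ≤ M)
    (h0 : ∀ p, ∀ k : ℤ, 0 ≤ k → fcoeff (fun l => g l p) k = 0) : PastLim G g := by
  set G₁ : ℝ → Matrix (Fin T) (Fin T) ℂ := fun l => G l + 1 with hG₁
  have hm : IsMinDensity G₁ := hG.add_one
  have hm' := hm.toIsSpectralDensity
  have hg1 : MemL2 G₁ g := memL2_of_bounded hm' hgm hM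
  obtain ⟨g', hg', horth⟩ := exists_projection hm hg1
  have hr := hg1.sub hm' hg'.memL2
  have e : (fun l => herm (G₁ l) ((g - g') l) (g l)) =
      fun l => ∑ p, ((G₁ l)ᵀ *ᵥ (g - g') l) p * (star (g l)) p := by
    ext l
    exact herm_eq_transpose_dotProduct _ _
  have hi := integrable_herm hm' hr hg1
  have h1 := integral_sum_mul_eq_zero (c := fun l => (G₁ l)ᵀ *ᵥ (g - g') l)
    (s := fun l => star (g l)) (hm'.integrable_transpose_mulVec hr)
    (fun p => integrable_star (hm.integrable_apply hg1 p).1)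
    ((orthogonal_iff_fcoeff hm' hr).1 horth)
    (fun p k hk => by
      have := fcoeff_star (fun l => g l p) k
      rw [h0 p (-k) (by lia), star_zero] at this
      exact this)
    (by rwa [e] at hi)
  rw [← e] at h1
  have h2 := hg'.integral_herm_eq_zero hm' hr horth
  have h3 : nrm G₁ (g - g') = 0 := by
    have h4 : ∫ l, herm (G₁ l) ((g - g') l) ((g - g') l) ∂circ = 0 := by
      have e2 : ∀ l, herm (G₁ l) ((g - g') l) ((g - g') l) =
          herm (G₁ l) ((g - g') l) (g l) - herm (G₁ l) ((g - g') l) (g' l) := fun l =>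
        herm_sub_right _ _ _
      simp only [e2]
      rw [integral_sub hi (integrable_herm hm' hr hg'.memL2), h1, h2, sub_zero]
    have h5 : ((nrm G₁ (g - g') : ℝ) : ℂ) = 0 := by
      rw [nrm, ← integral_complex_ofReal, ← h4]
      refine integral_congr_ae ?_
      filter_upwards [hm.posSemidef] with l hp
      exact (herm_self hp _).symm
    exact_mod_cast h5
  have hmono : ∀ h : ℝ → Fin T → ℂ, MemL2 G₁ h → MemL2 G h → nrm G h ≤ nrm G₁ h := by
    intro h hh1 hh
    refine integral_mono hh.integrable hh1.integrable fun l => ?_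
    simp only [hG₁, quad_add_one]
    linarith [Finset.sum_nonneg fun p (_ : p ∈ Finset.univ) => sq_nonneg ‖h l p‖]
  have hg0 : MemL2 G g := memL2_of_bounded hG hgm hM
  refine ⟨hg0, fun ε hε => ?_⟩
  obtain ⟨Q, hQ, hlt⟩ := hg'.approx (ε / 4) (by positivity)
  have hQ1 := memL2_of_mem hm' hQ
  refine ⟨Q, hQ, (hmono _ (hg1.sub hm' hQ1) (hg0.sub hG (memL2_of_mem hG hQ))).trans_lt ?_⟩
  have h6 := nrm_sub_le hm' hr (hQ1.sub hm' hg'.memL2)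
  rw [sub_sub_sub_cancel_right, h3, nrm_sub_comm Q] at h6
  linarith

end Normal

/-! ### The transfer function `χ(e^{-iλ}) / β(iλ)` -/

section Transfer

variable (γ : GMType)

theorem chi_eq_prod (l : ℝ) :
    chi γ l = ∏ j, (1 - Complex.exp (-Complex.I * l) ^ (γ.mu j * γ.s j)) ^ γ.d j := by
  simp [chi, incrPoly, Polynomial.eval_prod]

theorem continuous_chi : Continuous (chi γ) := by
  unfold chi
  fun_prop

theorem continuous_beta : Continuous (beta γ) := by
  unfold beta
  fun_prop

/-- The zeros of `1 - e^{-iλμs}` at the points `2πk/s` cancel those of the denominator: the nearest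
point to `λ` compensates the numerator, and the others are at distance at least `π/s`. -/
theorem norm_one_sub_exp_le {μ s : ℕ} (hs : 0 < s) {l : ℝ}
    (hl : l ∈ Set.Ioo (-Real.pi) Real.pi) :
    ‖1 - Complex.exp (-Complex.I * l) ^ (μ * s)‖ ≤
      (μ * s / (Real.pi / s) ^ ((Finset.Icc (-((s : ℤ) / 2)) ((s : ℤ) / 2)).card - 1)) *
        ∏ k ∈ Finset.Icc (-((s : ℤ) / 2)) ((s : ℤ) / 2),
          ‖Complex.I * l - 2 * Real.pi * Complex.I * (k : ℂ) / (s : ℂ)‖ := by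
  have hpi := Real.pi_pos
  have hs' : (0 : ℝ) < s := by exact_mod_cast hs
  have hnorm : ∀ k : ℤ, ‖Complex.I * l - 2 * Real.pi * Complex.I * (k : ℂ) / (s : ℂ)‖ =
      |l - 2 * Real.pi * k / s| := fun k => by
    rw [show Complex.I * l - 2 * Real.pi * Complex.I * (k : ℂ) / (s : ℂ) =
      Complex.I * ((l - 2 * Real.pi * k / s : ℝ) : ℂ) by push_cast; ring, norm_mul,
      Complex.norm_I, one_mul, Complex.norm_real, Real.norm_eq_abs]
  set x : ℝ := l * s / (2 * Real.pi) with hx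
  set k₀ : ℤ := round x with hk₀
  have hxs : |x| < s / 2 := by
    rw [hx, abs_div, abs_mul, abs_of_pos hs', abs_of_pos (by positivity : 0 < 2 * Real.pi),
      div_lt_iff₀ (by positivity)]
    have := abs_lt.2 ⟨hl.1, hl.2⟩
    nlinarith
  have hround := abs_sub_round x
  have hmem : k₀ ∈ Finset.Icc (-((s : ℤ) / 2)) ((s : ℤ) / 2) := by
    have h1 : |(k₀ : ℝ)| < s / 2 + 1 / 2 := by
      have := abs_sub_abs_le_abs_sub (k₀ : ℝ) x
      rw [abs_sub_comm (k₀ : ℝ) x] at this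
      linarith
    have h2 := abs_lt.1 h1
    have h3 : 2 * k₀ < s + 1 := by
      have : (2 * k₀ : ℝ) < s + 1 := by linarith [h2.2]
      exact_mod_cast this
    have h4 : -(s + 1 : ℤ) < 2 * k₀ := by
      have : (-(s + 1) : ℝ) < 2 * k₀ := by linarith [h2.1]
      exact_mod_cast this
    rw [Finset.mem_Icc]
    constructor <;> lia
  have hdist : ∀ k : ℤ, |l - 2 * Real.pi * k / s| = 2 * Real.pi / s * |x - k| := fun k => by
    rw [← abs_of_pos (by positivity : 0 < 2 * Real.pi / s), ← abs_mul, hx]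
    congr 1
    field_simp
  have hother : ∀ k ∈ (Finset.Icc (-((s : ℤ) / 2)) ((s : ℤ) / 2)).erase k₀,
      Real.pi / s ≤ |l - 2 * Real.pi * k / s| := fun k hk => by
    rw [hdist]
    have h1 : (1 : ℝ) ≤ |(k : ℝ) - k₀| := by
      have : (1 : ℤ) ≤ |k - k₀| := Int.one_le_abs (sub_ne_zero.2 (Finset.ne_of_mem_erase hk))
      exact_mod_cast this
    have h2 : (1 / 2 : ℝ) ≤ |x - k| := by
      have := abs_sub_le (k : ℝ) x k₀
      rw [abs_sub_comm (k : ℝ) x] at this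
      linarith
    calc Real.pi / s = 2 * Real.pi / s * (1 / 2) := by ring
      _ ≤ _ := by gcongr
  have hnum : ‖1 - Complex.exp (-Complex.I * l) ^ (μ * s)‖ ≤
      μ * s * |l - 2 * Real.pi * k₀ / s| := by
    have e : Complex.exp (-Complex.I * l) ^ (μ * s) =
        Complex.exp (Complex.I * ((-(μ * s * (l - 2 * Real.pi * k₀ / s)) : ℝ) : ℂ)) := by
      rw [← Complex.exp_nat_mul, Complex.exp_eq_exp_iff_exists_int]
      refine ⟨-(μ * k₀), ?_⟩
      have : (s : ℂ) ≠ 0 := by exact_mod_cast hs.ne'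
      push_cast
      field_simp
      ring
    rw [e, norm_sub_rev]
    refine Real.norm_exp_I_mul_ofReal_sub_one_le.trans (le_of_eq ?_)
    rw [norm_neg, Real.norm_eq_abs, abs_mul, abs_of_nonneg (by positivity)]
  rw [← Finset.mul_prod_erase _ _ hmem]
  simp only [hnorm]
  have hprod : (Real.pi / s) ^ ((Finset.Icc (-((s : ℤ) / 2)) ((s : ℤ) / 2)).card - 1) ≤
      ∏ k ∈ (Finset.Icc (-((s : ℤ) / 2)) ((s : ℤ) / 2)).erase k₀, |l - 2 * Real.pi * k / s| := by
    rw [← Finset.card_erase_of_mem hmem, ← Finset.prod_const]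
    exact Finset.prod_le_prod (fun _ _ => by positivity) hother
  refine hnum.trans ?_
  rw [div_mul_eq_mul_div, le_div_iff₀ (by positivity)]
  calc _ = μ * s * (|l - 2 * Real.pi * k₀ / s| * _) := by rw [mul_assoc]
    _ ≤ _ := by gcongr

theorem ae_mem_Ioo : ∀ᵐ l ∂circ, l ∈ Set.Ioo (-Real.pi) Real.pi := by
  rw [circ, ← Measure.restrict_congr_set Ioo_ae_eq_Ioc]
  exact ae_restrict_mem measurableSet_Ioo

theorem exists_norm_chi_le :
    ∃ M : ℝ, 0 ≤ M ∧ ∀ l ∈ Set.Ioo (-Real.pi) Real.pi, ‖chi γ l‖ ≤ M * ‖beta γ l‖ := by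
  refine ⟨∏ j, (γ.mu j * γ.s j / (Real.pi / γ.s j) ^
    ((Finset.Icc (-((γ.s j : ℤ) / 2)) ((γ.s j : ℤ) / 2)).card - 1)) ^ γ.d j,
    Finset.prod_nonneg fun j _ => by positivity, fun l hl => ?_⟩
  rw [chi_eq_prod, beta, norm_prod, norm_prod, ← Finset.prod_mul_distrib]
  refine Finset.prod_le_prod (fun _ _ => norm_nonneg _) fun j _ => ?_
  rw [norm_pow, Finset.prod_pow, norm_pow, ← mul_pow, norm_prod]
  gcongr
  exact norm_one_sub_exp_le (γ.s_pos j) hl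

theorem ae_chi_ne_zero : ∀ᵐ l ∂circ, chi γ l ≠ 0 := by
  have hc : {l : ℝ | chi γ l = 0}.Countable := by
    refine Set.Countable.mono ?_ (Set.countable_iUnion fun j : Fin γ.r =>
      Set.countable_range fun k : ℤ => -(2 * Real.pi * k / (γ.mu j * γ.s j)))
    intro l hl
    rw [Set.mem_ofPred_eq, chi_eq_prod, Finset.prod_eq_zero_iff] at hl
    obtain ⟨j, -, hj⟩ := hl
    have h1 := sub_eq_zero.1 (pow_eq_zero_iff (γ.d_pos j).ne' |>.1 hj)
    rw [← Complex.exp_nat_mul, eq_comm, Complex.exp_eq_one_iff] at h1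
    obtain ⟨k, hk⟩ := h1
    refine Set.mem_iUnion.2 ⟨j, k, ?_⟩
    have hm : (γ.mu j : ℂ) ≠ 0 := by exact_mod_cast (γ.mu_pos j).ne'
    have hs : (γ.s j : ℂ) ≠ 0 := by exact_mod_cast (γ.s_pos j).ne'
    have h2 : (l : ℂ) = -(2 * Real.pi * k / (γ.mu j * γ.s j)) := by
      have h3 : Complex.I * ((γ.mu j * γ.s j) * l) = Complex.I * (-(2 * Real.pi * k)) := by
        push_cast at hk
        linear_combination -hk
      have h4 := mul_left_cancel₀ Complex.I_ne_zero h3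
      field_simp
      linear_combination h4
    have h5 : (l : ℂ) = ((-(2 * Real.pi * k / (γ.mu j * γ.s j)) : ℝ) : ℂ) := by
      rw [h2]; push_cast; ring
    exact (Complex.ofReal_injective h5).symm
  exact ae_restrict_of_ae (hc.ae_notMem volume)

theorem ae_beta_ne_zero : ∀ᵐ l ∂circ, beta γ l ≠ 0 := by
  obtain ⟨M, -, hM⟩ := exists_norm_chi_le γ
  filter_upwards [ae_chi_ne_zero γ, ae_mem_Ioo] with l h1 h2 h3
  have := hM l h2
  rw [h3, norm_zero, mul_zero, norm_le_zero_iff] at this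
  exact h1 this

theorem weight_eq (l : ℝ) : weight γ l = ‖chi γ l / beta γ l‖ ^ 2 := by
  rw [weight, norm_div, div_pow]

theorem weight_nonneg (l : ℝ) : 0 ≤ weight γ l := by rw [weight_eq]; positivity

theorem exists_norm_transfer_le : ∃ M : ℝ, ∀ᵐ l ∂circ, ‖chi γ l / beta γ l‖ ≤ M := by
  obtain ⟨M, -, hM⟩ := exists_norm_chi_le γ
  refine ⟨M, ?_⟩
  filter_upwards [ae_beta_ne_zero γ, ae_mem_Ioo] with l h1 h2
  rw [norm_div, div_le_iff₀ (norm_pos_iff.2 h1)]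
  exact hM l h2

theorem exists_weight_le : ∃ M : ℝ, ∀ᵐ l ∂circ, weight γ l ≤ M := by
  obtain ⟨M, hM⟩ := exists_norm_transfer_le γ
  refine ⟨M ^ 2, ?_⟩
  filter_upwards [hM] with l h1
  rw [weight_eq]
  gcongr

theorem aesm_transfer : AEStronglyMeasurable (fun l => chi γ l / beta γ l) circ :=
  ((continuous_chi γ).measurable.div (continuous_beta γ).measurable).aestronglyMeasurable

theorem aesm_weight : AEStronglyMeasurable (weight γ) circ := by
  rw [show weight γ = fun l => ‖chi γ l / beta γ l‖ ^ 2 from funext (weight_eq γ)]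
  exact (aesm_transfer γ).norm.pow 2

theorem ae_transfer_ne_zero : ∀ᵐ l ∂circ, chi γ l / beta γ l ≠ 0 := by
  filter_upwards [ae_chi_ne_zero γ, ae_beta_ne_zero γ] with l h1 h2 using div_ne_zero h1 h2

theorem ae_weight_pos : ∀ᵐ l ∂circ, 0 < weight γ l := by
  filter_upwards [ae_transfer_ne_zero γ] with l h1
  rw [weight_eq]
  positivity

theorem integrable_weight_mul {u : ℝ → ℂ} (hu : Integrable u circ) :
    Integrable (fun l => (weight γ l : ℂ) * u l) circ := by
  obtain ⟨M, hM⟩ := exists_weight_le γ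
  refine hu.bdd_mul (c := M) (Complex.continuous_ofReal.comp_aestronglyMeasurable (aesm_weight γ)) ?_
  filter_upwards [hM] with l hl
  rwa [Complex.norm_real, Real.norm_of_nonneg (weight_nonneg γ l)]

variable {γ} {T : ℕ} {f : ℝ → Matrix (Fin T) (Fin T) ℂ}

theorem IsSpectralDensity.weighted (hf : IsSpectralDensity f) :
    IsSpectralDensity (weighted γ f) := by
  refine ⟨fun i j => ?_, ?_⟩
  · exact integrable_weight_mul γ (hf.integrable i j)
  · filter_upwards [hf.posSemidef] with l hp
    exact hp.smul (by exact_mod_cast weight_nonneg γ l)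

theorem weighted_inv {l : ℝ} (h : 0 < weight γ l) (f : ℝ → Matrix (Fin T) (Fin T) ℂ) :
    (weighted γ f l)⁻¹ = ((weight γ l : ℂ)⁻¹) • (f l)⁻¹ := by
  have hw : (weight γ l : ℂ) ≠ 0 := by exact_mod_cast h.ne'
  by_cases hu : IsUnit (f l).det
  · refine inv_eq_right_inv ?_
    rw [weighted, smul_mul_smul_comm, mul_inv_cancel₀ hw, mul_nonsing_inv _ hu, one_smul]
  · have h2 : ¬ IsUnit (weighted γ f l).det := by
      rw [weighted, det_smul, isUnit_iff_ne_zero]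
      rw [isUnit_iff_ne_zero, not_not] at hu
      simp [hu]
    rw [nonsing_inv_apply_not_isUnit _ h2, nonsing_inv_apply_not_isUnit _ hu, smul_zero]

theorem Minimal.isMinDensity (hf : IsSpectralDensity f) (hm : Minimal γ f) :
    IsMinDensity (weighted γ f) := by
  refine ⟨hf.weighted, ?_, hm.2.congr ?_⟩
  · filter_upwards [hm.1, ae_weight_pos γ] with l hu hw
    rw [weighted, det_smul]
    refine IsUnit.mul (IsUnit.pow _ ?_) hu
    exact isUnit_iff_ne_zero.2 (by exact_mod_cast hw.ne')
  · filter_upwards [ae_weight_pos γ] with l hw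
    rw [weighted_inv hw]

theorem quad_smul_transfer (l : ℝ) (v : Fin T → ℂ) :
    quad (f l) ((chi γ l / beta γ l) • v) = quad (weighted γ f l) v := by
  rw [quad_smul, ← weight_eq, quad, quad, weighted, herm, herm, smul_mulVec, dotProduct_smul,
    smul_eq_mul, Complex.re_ofReal_mul]

theorem sqNorm_eq_ofReal {G : ℝ → Matrix (Fin T) (Fin T) ℂ} (hG : IsSpectralDensity G)
    {h : ℝ → Fin T → ℂ} (hh : MemL2 G h) :
    sqNorm G h = ENNReal.ofReal (1 / (2 * Real.pi) * nrm G h) := by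
  rw [ENNReal.ofReal_mul (by positivity), ← lintegral_quad hG hh]
  rfl

theorem sqNorm_smul_transfer (v : ℝ → Fin T → ℂ) :
    sqNorm f (fun l => (chi γ l / beta γ l) • v l) = sqNorm (weighted γ f) v := by
  unfold sqNorm
  congr 2
  ext l
  congr 1
  exact quad_smul_transfer l (v l)

theorem sqNorm_congr {G : ℝ → Matrix (Fin T) (Fin T) ℂ} {h g : ℝ → Fin T → ℂ}
    (e : h =ᵐ[circ] g) : sqNorm G h = sqNorm G g := by
  unfold sqNorm
  congr 1
  refine lintegral_congr_ae ?_
  filter_upwards [e] with l hl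
  rw [hl]

theorem memL2_iff_sqNorm_lt_top {G : ℝ → Matrix (Fin T) (Fin T) ℂ} (hG : IsSpectralDensity G)
    {h : ℝ → Fin T → ℂ} (hh : AEStronglyMeasurable h circ) (hfin : sqNorm G h < ∞) :
    MemL2 G h := by
  refine memL2_of_lintegral hG hh ?_
  refine lt_top_iff_ne_top.2 fun htop => ?_
  have h2 : sqNorm G h = ∞ := by
    change ENNReal.ofReal (1 / (2 * Real.pi)) *
      ∫⁻ l, ENNReal.ofReal (quad (G l) (h l)) ∂circ = ∞
    rw [htop, ENNReal.mul_top]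
    exact (ENNReal.ofReal_pos.2 (by positivity)).ne'
  exact hfin.ne h2

theorem pastPoly_eq (N : ℕ) (x : ℕ → Fin T → ℂ) (l : ℝ) :
    pastPoly γ N x l = (chi γ l / beta γ l) • pastFun N x l := rfl

/-- Dividing by the transfer function carries the past of `L₂(f)` to the past of `L₂(w f)`. -/
theorem memPast_iff (hf : IsSpectralDensity f) (h : ℝ → Fin T → ℂ) :
    MemPast γ f h ↔
      PastLim (weighted γ f) fun l => (chi γ l / beta γ l)⁻¹ • h l := by
  have hG := hf.weighted (γ := γ)
  set v : ℝ → Fin T → ℂ := fun l => (chi γ l / beta γ l)⁻¹ • h l with hv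
  have hhv : h =ᵐ[circ] fun l => (chi γ l / beta γ l) • v l := by
    filter_upwards [ae_transfer_ne_zero γ] with l hl
    rw [hv, smul_smul, mul_inv_cancel₀ hl, one_smul]
  have key : ∀ N (x : ℕ → Fin T → ℂ), sqNorm f (fun l => h l - pastPoly γ N x l) =
      sqNorm (weighted γ f) (v - pastFun N x) := by
    intro N x
    rw [← sqNorm_smul_transfer]
    refine sqNorm_congr ?_
    filter_upwards [hhv] with l hl
    rw [Pi.sub_apply, smul_sub, ← pastPoly_eq, ← hl]
  constructor
  · rintro ⟨hm, happ⟩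
    have hvm : AEStronglyMeasurable v circ :=
      (aesm_transfer γ).aemeasurable.inv.aestronglyMeasurable.smul hm
    have hmem : ∀ N (x : ℕ → Fin T → ℂ), sqNorm (weighted γ f) (v - pastFun N x) < ∞ →
        MemL2 (weighted γ f) (v - pastFun N x) := fun N x hlt =>
      memL2_iff_sqNorm_lt_top hG
        (hvm.sub (continuous_of_mem (pastFun_mem N x)).aestronglyMeasurable) hlt
    refine ⟨?_, fun ε hε => ?_⟩
    · obtain ⟨N, x, hlt⟩ := happ 1 one_pos
      rw [key] at hlt
      have := (hmem N x (hlt.trans ENNReal.one_lt_top)).add hG (memL2_of_mem hG (pastFun_mem N x))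
      rwa [sub_add_cancel] at this
    · obtain ⟨N, x, hlt⟩ := happ (ENNReal.ofReal (1 / (2 * Real.pi) * ε))
        (ENNReal.ofReal_pos.2 (by positivity))
      rw [key] at hlt
      refine ⟨_, pastFun_mem N x, ?_⟩
      rw [sqNorm_eq_ofReal hG (hmem N x (hlt.trans ENNReal.ofReal_lt_top)),
        ENNReal.ofReal_lt_ofReal_iff (by positivity)] at hlt
      exact lt_of_mul_lt_mul_left hlt (by positivity)
  · intro hv'
    refine ⟨((aesm_transfer γ).smul hv'.memL2.aesm).congr hhv.symm, fun ε hε => ?_⟩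
    obtain ⟨δ, hδ, hδε⟩ : ∃ δ : ℝ, 0 < δ ∧ ENNReal.ofReal (1 / (2 * Real.pi) * δ) < ε := by
      rcases eq_or_ne ε ∞ with rfl | htop
      · exact ⟨1, one_pos, ENNReal.ofReal_lt_top⟩
      · refine ⟨ε.toReal, ENNReal.toReal_pos hε.ne' htop, ?_⟩
        rw [ENNReal.ofReal_lt_iff_lt_toReal (by positivity) htop]
        have h1 := ENNReal.toReal_pos hε.ne' htop
        have h2 : 1 / (2 * Real.pi) < 1 := by
          rw [div_lt_one (by positivity)]
          linarith [Real.pi_gt_three]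
        nlinarith
    obtain ⟨Q, ⟨N, x, rfl⟩, hlt⟩ := hv'.approx δ hδ
    refine ⟨N, x, ?_⟩
    rw [key, sqNorm_eq_ofReal hG (hv'.memL2.sub hG (memL2_of_mem hG (pastFun_mem N x)))]
    refine lt_of_le_of_lt (ENNReal.ofReal_le_ofReal ?_) hδε
    gcongr

theorem err_smul_transfer (b : ℕ → Fin T → ℂ) (v : ℝ → Fin T → ℂ) :
    err γ b (fun l => (chi γ l / beta γ l) • v l) f = sqNorm (weighted γ f) (bSeries b - v) := by
  rw [err, ← sqNorm_smul_transfer]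
  congr 1
  ext1 l
  rw [Pi.sub_apply, smul_sub]

theorem err_congr {b : ℕ → Fin T → ℂ} {h g : ℝ → Fin T → ℂ} (e : h =ᵐ[circ] g) :
    err γ b h f = err γ b g f := by
  refine sqNorm_congr ?_
  filter_upwards [e] with l hl
  rw [hl]

theorem ae_eq_smul_transfer (h : ℝ → Fin T → ℂ) :
    h =ᵐ[circ] fun l => (chi γ l / beta γ l) • ((chi γ l / beta γ l)⁻¹ • h l) := by
  filter_upwards [ae_transfer_ne_zero γ] with l hl
  rw [smul_smul, mul_inv_cancel₀ hl, one_smul]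

theorem memPast_smul_iff (hf : IsSpectralDensity f) (v : ℝ → Fin T → ℂ) :
    MemPast γ f (fun l => (chi γ l / beta γ l) • v l) ↔ PastLim (weighted γ f) v := by
  rw [memPast_iff hf]
  have e : (fun l => (chi γ l / beta γ l)⁻¹ • ((chi γ l / beta γ l) • v l)) =ᵐ[circ] v := by
    filter_upwards [ae_transfer_ne_zero γ] with l hl
    rw [smul_smul, inv_mul_cancel₀ hl, one_smul]
  exact ⟨fun h => h.congr e, fun h => h.congr e.symm⟩

theorem ofReal_optVal {G : ℝ → Matrix (Fin T) (Fin T) ℂ} (hG : IsSpectralDensity G)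
    {B : ℝ → Fin T → ℂ} (hB : MemL2 G B) :
    ENNReal.ofReal (1 / (2 * Real.pi) * optVal G B) = ⨅ Q : pastSpan T, sqNorm G (B - Q.1) := by
  rw [optVal, Real.mul_iInf_of_nonneg (by positivity), ENNReal.ofReal_iInf]
  exact iInf_congr fun Q => (sqNorm_eq_ofReal hG (hB.sub hG (memL2_of_mem hG Q.2))).symm

theorem optErr_eq (hf : IsSpectralDensity f) {b : ℕ → Fin T → ℂ}
    (hb : Summable fun k => ‖b k‖) :
    optErr γ b f =
      ENNReal.ofReal (1 / (2 * Real.pi) * optVal (weighted γ f) (bSeries b)) := by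
  have hG := hf.weighted (γ := γ)
  have hB := memL2_bSeries hG hb
  refine le_antisymm ?_ (le_iInf₂ fun h hh => ?_)
  · rw [ofReal_optVal hG hB]
    refine le_iInf fun Q => ?_
    rw [← err_smul_transfer]
    exact iInf₂_le _ ((memPast_smul_iff hf Q.1).2 (PastLim.of_mem hG Q.2))
  · have hv := (memPast_iff hf h).1 hh
    rw [err_congr (ae_eq_smul_transfer h), err_smul_transfer,
      sqNorm_eq_ofReal hG (hB.sub hG hv.memL2)]
    refine ENNReal.ofReal_le_ofReal ?_
    have := optVal_le_of_pastLim hG hB hv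
    gcongr

theorem IsFInverse.isSolution (hf : IsSpectralDensity f) (hm : Minimal γ f)
    {b : ℕ → Fin T → ℂ} {C : ℝ → Fin T → ℂ} (hC : IsFInverse γ f b C) :
    IsSolution (weighted γ f) b C :=
  ⟨hC.integrable, hC.analytic, memL2_iff_sqNorm_lt_top (hm.isMinDensity hf).inv.toIsSpectralDensity
    (aesm_pi fun p => (hC.integrable p).aestronglyMeasurable) hC.energy, hC.solves⟩

theorem IsSolution.isFInverse (hf : IsSpectralDensity f) (hm : Minimal γ f)
    {b : ℕ → Fin T → ℂ} {C : ℝ → Fin T → ℂ} (hC : IsSolution (weighted γ f) b C) :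
    IsFInverse γ f b C :=
  ⟨hC.integrable, hC.analytic, by
    have := sqNorm_eq_ofReal (hm.isMinDensity hf).inv.toIsSpectralDensity hC.energy
    rw [this]
    exact ENNReal.ofReal_lt_top, hC.solves⟩

end Transfer

/-! ### Perturbation of the density -/

section Perturbation

variable {T : ℕ} {G : ℝ → Matrix (Fin T) (Fin T) ℂ}

theorem herm_add_matrix (A A' : Matrix (Fin T) (Fin T) ℂ) (x y : Fin T → ℂ) :
    herm (A + A') x y = herm A x y + herm A' x y := by
  simp [herm, add_mulVec, dotProduct_add]

theorem herm_smul_matrix (c : ℂ) (A : Matrix (Fin T) (Fin T) ℂ) (x y : Fin T → ℂ) :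
    herm (c • A) x y = c * herm A x y := by
  simp [herm, smul_mulVec]

theorem quad_add_matrix (A A' : Matrix (Fin T) (Fin T) ℂ) (x : Fin T → ℂ) :
    quad (A + A') x = quad A x + quad A' x := by
  rw [quad, herm_add_matrix, Complex.add_re, quad, quad]

theorem quad_smul_matrix (t : ℝ) (A : Matrix (Fin T) (Fin T) ℂ) (x : Fin T → ℂ) :
    quad ((t : ℂ) • A) x = t * quad A x := by
  rw [quad, herm_smul_matrix, Complex.re_ofReal_mul, quad]

theorem herm_eq_trace (X : Matrix (Fin T) (Fin T) ℂ) (v : Fin T → ℂ) :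
    herm X v v = (X * (vecMulVec v (star v))ᵀ).trace := by
  rw [transpose_vecMulVec, mul_vecMulVec, trace_vecMulVec, herm, dotProduct_comm]

theorem quad_conj_swap {A : Matrix (Fin T) (Fin T) ℂ} (hA : A.IsHermitian) (x : Fin T → ℂ) :
    herm A x x = quad A x := by
  have h : star (herm A x x) = herm A x x := by
    rw [herm, ← star_dotProduct_star, star_mulVec, star_star, hA.eq, ← dotProduct_mulVec]
  exact (Complex.conj_eq_iff_re.1 h).symm

theorem posSemidef_of_quad_nonneg {A : Matrix (Fin T) (Fin T) ℂ} (hA : A.IsHermitian)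
    (h : ∀ x, 0 ≤ quad A x) : A.PosSemidef := by
  refine PosSemidef.of_dotProduct_mulVec_nonneg hA fun x => ?_
  have h1 := quad_conj_swap hA (star x)
  rw [herm, star_star] at h1
  rw [h1]
  exact_mod_cast h _

/-- A lower bound for a positive semidefinite form at a sum. -/
theorem le_quad_add {A : Matrix (Fin T) (Fin T) ℂ} (hA : A.PosSemidef) {δ : ℝ} (hδ : 0 < δ)
    (x y : Fin T → ℂ) : (1 - δ) * quad A x - δ⁻¹ * quad A y ≤ quad A (x + y) := by
  have h1 := quad_sub hA x (-y)
  have h2 : herm A x (-y) = - herm A x y := by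
    have := herm_smul_right (A := A) (-1) x y
    simpa using this
  rw [quad_neg, h2, sub_neg_eq_add, Complex.neg_re] at h1
  have h3 := norm_herm_sq_le hA x y
  have h4 := (abs_le.1 (Complex.abs_re_le_norm (herm A x y))).1
  have hx := quad_nonneg hA x
  have hy := quad_nonneg hA y
  have h5 : 2 * ‖herm A x y‖ ≤ δ * quad A x + δ⁻¹ * quad A y := by
    refine le_of_sq_le_sq ?_ (by positivity)
    have h6 : (δ * quad A x + δ⁻¹ * quad A y) ^ 2 =
        (δ * quad A x - δ⁻¹ * quad A y) ^ 2 + 4 * (quad A x * quad A y) := by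
      field_simp
      ring
    rw [h6]
    nlinarith [sq_nonneg (δ * quad A x - δ⁻¹ * quad A y)]
  linarith

/-- First variation: if the optimal error does not increase under the perturbations `G + t H`,
`t > 0`, by a relatively bounded `H`, then `∫ rᵀ H conj r ≤ 0` for the residual `r`. -/
theorem IsSolution.integral_quad_nonpos (hG : IsMinDensity G) {b : ℕ → Fin T → ℂ}
    (hb : Summable fun k => ‖b k‖) {C : ℝ → Fin T → ℂ} (hC : IsSolution G b C)
    {H : ℝ → Matrix (Fin T) (Fin T) ℂ} (hHi : ∀ i j, Integrable (fun l => H l i j) circ)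
    (hHh : ∀ᵐ l ∂circ, (H l).IsHermitian) {κ : ℝ} (hκ : 0 < κ)
    (hHκ : ∀ᵐ l ∂circ, ∀ x, |quad (H l) x| ≤ κ * quad (G l) x)
    (hle : ∀ t : ℝ, 0 < t → t * κ ≤ 1 →
      optVal (fun l => G l + (t : ℂ) • H l) (bSeries b) ≤ optVal G (bSeries b)) :
    ∫ l, quad (H l) (residual G C l) ∂circ ≤ 0 := by
  have hG' := hG.toIsSpectralDensity
  have hB := memL2_bSeries hG' hb
  have hr := memL2_residual hG hC.energy
  have hg := hC.pastLim hG hb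
  set r := residual G C with hrdef
  set m := nrm G r with hm
  have hm0 : 0 ≤ m := nrm_nonneg hG' r
  have hopt : optVal G (bSeries b) = m := hC.optVal_eq hG hb
  have hiH : ∀ h : ℝ → Fin T → ℂ, MemL2 G h → Integrable (fun l => quad (H l) (h l)) circ := by
    intro h hh
    refine (hh.integrable.const_mul κ).mono' (Complex.continuous_re.comp_aestronglyMeasurable
      (aesm_herm (fun i j => (hHi i j).aestronglyMeasurable) hh.aesm hh.aesm)) ?_
    filter_upwards [hHκ] with l hl using hl _
  set Φ : (ℝ → Fin T → ℂ) → ℝ := fun h => ∫ l, quad (H l) (h l) ∂circ with hΦ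
  have hdens : ∀ t : ℝ, 0 < t → t * κ ≤ 1 →
      IsSpectralDensity fun l => G l + (t : ℂ) • H l := by
    intro t ht htκ
    refine ⟨fun i j => (hG'.integrable i j).add ((hHi i j).const_mul _), ?_⟩
    filter_upwards [hG'.posSemidef, hHh, hHκ] with l hp hh hb
    refine posSemidef_of_quad_nonneg (hp.isHermitian.add ?_) fun x => ?_
    · rw [IsHermitian, conjTranspose_smul, hh.eq]
      simp
    · rw [quad_add_matrix, quad_smul_matrix]
      have h1 := (abs_le.1 (hb x)).1
      have h2 := quad_nonneg hp x
      nlinarith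
  have hlow : ∀ δ : ℝ, 0 < δ → ∀ e : ℝ → Fin T → ℂ, MemL2 G e →
      (1 - δ) * (Φ r + κ * m) - δ⁻¹ * (2 * κ * nrm G e) ≤ Φ (r + e) + κ * nrm G (r + e) := by
    intro δ hδ e he
    have hre := hr.add hG' he
    have h1 : ∀ h : ℝ → Fin T → ℂ, MemL2 G h → ∫ l, (quad (H l) (h l) + κ * quad (G l) (h l)) ∂circ
        = Φ h + κ * nrm G h := fun h hh => by
      rw [integral_add (hiH h hh) (hh.integrable.const_mul κ), integral_const_mul]
      rfl
    have hI : ∀ h : ℝ → Fin T → ℂ, MemL2 G h →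
        Integrable (fun l => quad (H l) (h l) + κ * quad (G l) (h l)) circ := fun h hh =>
      (hiH h hh).add (hh.integrable.const_mul κ)
    rw [← h1 _ hre, hm, ← h1 _ hr, nrm, ← integral_const_mul, ← integral_const_mul,
      ← integral_const_mul, ← integral_sub ((hI r hr).const_mul _)
        ((he.integrable.const_mul _).const_mul _)]
    refine integral_mono_ae (((hI r hr).const_mul _).sub ((he.integrable.const_mul _).const_mul _))
      (hI _ hre) ?_
    filter_upwards [hG'.posSemidef, hHh, hHκ] with l hp hh hb
    have hP : ∀ x, quad (H l + (κ : ℂ) • G l) x = quad (H l) x + κ * quad (G l) x := fun x => by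
      rw [quad_add_matrix, quad_smul_matrix]
    have hPp : (H l + (κ : ℂ) • G l).PosSemidef := by
      refine posSemidef_of_quad_nonneg (hh.add ?_) fun x => ?_
      · rw [IsHermitian, conjTranspose_smul, hp.isHermitian.eq]
        simp
      · rw [hP]
        linarith [(abs_le.1 (hb x)).1]
    have h2 := le_quad_add hPp hδ (r l) (e l)
    rw [hP, hP, hP] at h2
    refine le_trans ?_ h2
    have h3 := (abs_le.1 (hb (e l))).2
    have h4 : δ⁻¹ * (quad (H l) (e l) + κ * quad (G l) (e l)) ≤
        δ⁻¹ * (2 * κ * quad (G l) (e l)) := by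
      gcongr
      linarith
    linarith
  have hkey : ∀ δ : ℝ, 0 < δ → ∀ t : ℝ, 0 < t → t * κ ≤ 1 → t * (δ⁻¹ * (2 * κ) + κ) ≤ 1 →
      (1 - δ) * (Φ r + κ * m) - κ * m ≤ t := by
    intro δ hδ t ht htκ htδ
    have hd := hdens t ht htκ
    have hlt : optVal (fun l => G l + (t : ℂ) • H l) (bSeries b) < m + t ^ 2 := by
      have := hle t ht htκ
      rw [hopt] at this
      nlinarith
    obtain ⟨⟨Q, hQ⟩, hQlt⟩ := exists_lt_of_ciInf_lt hlt
    have hQm := memL2_of_mem hG' hQ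
    have hh := hB.sub hG' hQm
    have he : PastLim G (Q - (bSeries b - r)) := (PastLim.of_mem hG' hQ).sub hG' hg
    have h1 := nrm_sub_of_orthogonal hG' hr (hC.orthogonal hG) he
    have h2 : r - (Q - (bSeries b - r)) = bSeries b - Q := by abel
    rw [h2] at h1
    have h3 : nrm (fun l => G l + (t : ℂ) • H l) (bSeries b - Q) =
        nrm G (bSeries b - Q) + t * Φ (bSeries b - Q) := by
      rw [nrm, nrm, hΦ, ← integral_const_mul, ← integral_add hh.integrable ((hiH _ hh).const_mul t)]
      simp only [quad_add_matrix, quad_smul_matrix]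
    have h4 := hlow δ hδ _ (he.memL2.const_smul (-1))
    have h5 : r + (-1 : ℂ) • (Q - (bSeries b - r)) = bSeries b - Q := by
      rw [neg_one_smul, ← sub_eq_add_neg, h2]
    rw [h5, nrm_smul, norm_neg, norm_one, one_pow, one_mul, h1] at h4
    simp only at hQlt
    rw [h3, h1] at hQlt
    have hN := nrm_nonneg hG' (Q - (bSeries b - r))
    have h6 : t * ((1 - δ) * (Φ r + κ * m) - κ * m) ≤ t * t := by
      have h7 := mul_le_mul_of_nonneg_left h4 ht.le
      have h8 := mul_le_mul_of_nonneg_right htδ hN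
      nlinarith
    exact le_of_mul_le_mul_left h6 ht
  have hkey2 : ∀ δ : ℝ, 0 < δ → (1 - δ) * (Φ r + κ * m) - κ * m ≤ 0 := by
    intro δ hδ
    refine le_of_forall_pos_le_add fun ε hε => ?_
    rw [zero_add]
    set K := δ⁻¹ * (2 * κ) + κ with hK
    have hKpos : 0 < K := by positivity
    have hKκ : κ ≤ K := by
      have : 0 < δ⁻¹ * (2 * κ) := by positivity
      linarith
    have ht : 0 < min ε K⁻¹ := lt_min hε (inv_pos.2 hKpos)
    have h1 : min ε K⁻¹ * K ≤ 1 := by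
      calc _ ≤ K⁻¹ * K := by gcongr; exact min_le_right _ _
        _ = 1 := inv_mul_cancel₀ hKpos.ne'
    refine (hkey δ hδ _ ht ?_ h1).trans (min_le_left _ _)
    exact (mul_le_mul_of_nonneg_left hKκ ht.le).trans h1
  refine le_of_forall_pos_le_add fun ε hε => ?_
  have hA : 0 < |Φ r + κ * m| + 1 := by positivity
  have h1 := hkey2 (ε / (|Φ r + κ * m| + 1)) (by positivity)
  have h2 : ε / (|Φ r + κ * m| + 1) * (Φ r + κ * m) ≤ ε := by
    rw [div_mul_eq_mul_div, div_le_iff₀ hA]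
    nlinarith [le_abs_self (Φ r + κ * m)]
  change Φ r ≤ 0 + ε
  linarith

/-- A function that integrates to zero against all bounded functions of zero mean, for a positive
weight, is constant. -/
theorem ae_const_of_forall_integral_eq_zero {ω k : ℝ → ℝ} (hω : Integrable ω circ)
    (hpos : ∀ᵐ l ∂circ, 0 < ω l) (hk : Integrable (fun l => ω l * k l) circ)
    (h : ∀ ψ : ℝ → ℝ, Measurable ψ → (∀ l, |ψ l| ≤ 1) → ∫ l, ω l * ψ l ∂circ = 0 →
      ∫ l, ω l * ψ l * k l ∂circ = 0) :
    ∃ c, ∀ᵐ l ∂circ, k l = c := by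
  set W := ∫ l, ω l ∂circ with hW
  have hWpos : 0 < W := by
    refine (integral_pos_iff_support_of_nonneg_ae (hpos.mono fun l hl => hl.le) hω).2 ?_
    have h1 : circ (Function.support ω) = circ Set.univ := by
      refine measure_congr ?_
      filter_upwards [hpos] with l hl
      exact eq_true (Function.mem_support.2 hl.ne')
    rw [h1]
    refine pos_iff_ne_zero.2 fun h0 => ?_
    have := circ_real_univ
    rw [Measure.real, h0, ENNReal.toReal_zero] at this
    linarith [Real.pi_pos]
  set c := (∫ l, ω l * k l ∂circ) / W with hc
  refine ⟨c, ?_⟩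
  have hz : Integrable (fun l => ω l * k l - c * ω l) circ := hk.sub (hω.const_mul c)
  have h0 := Integrable.ae_eq_zero_of_forall_setIntegral_eq_zero hz fun A hA _ => by
    set a := (∫ l in A, ω l ∂circ) / W with ha
    have hnn : 0 ≤ ∫ l in A, ω l ∂circ :=
      setIntegral_nonneg_of_ae (hpos.mono fun l hl => hl.le)
    have ha0 : 0 ≤ a := div_nonneg hnn hWpos.le
    have ha1 : a ≤ 1 := by
      rw [ha, div_le_one hWpos]
      exact setIntegral_le_integral hω (hpos.mono fun l hl => hl.le)
    have hind : ∀ u : ℝ → ℝ, Integrable u circ →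
        ∫ l, u l * (A.indicator 1 l - a) ∂circ = (∫ l in A, u l ∂circ) - a * ∫ l, u l ∂circ := by
      intro u hu
      have e : ∀ l, u l * (A.indicator 1 l - a) = A.indicator u l - a * u l := fun l => by
        by_cases hl : l ∈ A <;> simp [hl] <;> ring
      simp only [e]
      rw [integral_sub (hu.indicator hA) (hu.const_mul a), integral_indicator hA,
        integral_const_mul]
    have h1 := h (fun l => A.indicator 1 l - a)
      ((measurable_const.indicator hA).sub measurable_const)
      (fun l => by
        by_cases hl : l ∈ A
        · simp only [Set.indicator_of_mem hl, Pi.one_apply]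
          rw [abs_le]; constructor <;> linarith
        · simp only [Set.indicator_of_notMem hl]
          rw [abs_le]; constructor <;> linarith)
      (by
        rw [hind ω hω, ha, ← hW, div_mul_cancel₀ _ hWpos.ne', sub_self])
    have h2 : ∀ l, ω l * (A.indicator 1 l - a) * k l = (ω l * k l) * (A.indicator 1 l - a) :=
      fun l => by ring
    simp only [h2] at h1
    rw [hind _ hk] at h1
    rw [integral_sub hk.integrableOn (hω.const_mul c).integrableOn, integral_const_mul]
    have h3 : c * ∫ l in A, ω l ∂circ = a * ∫ l, ω l * k l ∂circ := by
      rw [hc, ha]; ring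
    rw [h3]
    exact h1
  filter_upwards [h0, hpos] with l hl hp
  have h4 : ω l * (k l - c) = 0 := by
    simp only [Pi.zero_apply] at hl
    linarith
  have h5 := (mul_eq_zero.1 h4).resolve_left hp.ne'
  linarith

end Perturbation

/-! ### The moment classes -/

section Moments

variable {T : ℕ}

/-- The common shape of the four classes: `D` is given by linear moment conditions
`∫ Tr(A_i w f) = p_i`. The multiplier matrices are, up to transposition, combinations of the `A_i`,
and a rank one matrix `v v*` that annihilates the directions `X` invisible to the moments is a
multiplier matrix. -/
structure MomentForm {ι : Type} (γ : GMType) (D : Set (ℝ → Matrix (Fin T) (Fin T) ℂ))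
    (S : Set (Matrix (Fin T) (Fin T) ℂ)) (A : ι → Matrix (Fin T) (Fin T) ℂ) (p : ι → ℂ) :
    Prop where
  mem_iff : ∀ f, f ∈ D ↔
    IsSpectralDensity f ∧ ∀ i, ∫ l, (A i * weighted γ f l).trace ∂circ = p i
  span : ∀ L ∈ S, Lᵀ ∈ Submodule.span ℂ (Set.range A)
  mem_of_annihilates : ∀ v : Fin T → ℂ,
    (∀ X : Matrix (Fin T) (Fin T) ℂ, X.IsHermitian → (∀ i, (A i * X).trace = 0) →
      herm X v v = 0) → vecMulVec v (star v) ∈ S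

theorem isHermitian_vecMulVec_transpose (v : Fin T → ℂ) :
    (vecMulVec v (star v))ᵀ.IsHermitian :=
  (posSemidef_vecMulVec_self_star v).transpose.isHermitian

/-- A Hermitian matrix `X` orthogonal to `R` and to `R - X` vanishes. -/
theorem eq_zero_of_trace_mul {X R : Matrix (Fin T) (Fin T) ℂ} (hX : X.IsHermitian)
    (h1 : (X * R).trace = 0) (h2 : ((R - X) * X).trace = 0) : X = 0 := by
  rw [← trace_conjTranspose_mul_self_eq_zero_iff, hX.eq]
  rw [sub_mul, trace_sub, trace_mul_comm R X, h1, zero_sub, neg_eq_zero] at h2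
  exact h2

/-- If `v v*` annihilates the Hermitian matrices trace-orthogonal to `B₁`, its transpose `R` is a
nonnegative multiple of `B₁`: the difference `R - c B₁` of `R` and its trace-projection onto `B₁` is
annihilated. -/
theorem vecMulVec_eq_smul_of_annihilates (hT : 0 < T) {B₁ : Matrix (Fin T) (Fin T) ℂ}
    (hB₁ : B₁.PosDef) {v : Fin T → ℂ}
    (h : ∀ X : Matrix (Fin T) (Fin T) ℂ, X.IsHermitian → (B₁ * X).trace = 0 → herm X v v = 0) :
    ∃ α : ℝ, vecMulVec v (star v) = ((α ^ 2 : ℝ) : ℂ) • B₁ᵀ := by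
  have : Nonempty (Fin T) := ⟨⟨0, hT⟩⟩
  set R := (vecMulVec v (star v))ᵀ with hR
  have hRh : R.IsHermitian := isHermitian_vecMulVec_transpose v
  have hβ : (B₁ * R).trace = (quad B₁ v : ℂ) := by
    rw [← herm_eq_trace, quad_conj_swap hB₁.isHermitian]
  have hβ0 : 0 ≤ quad B₁ v := quad_nonneg hB₁.posSemidef v
  have hq := Complex.nonneg_iff.1 (posSemidef_conjTranspose_mul_self B₁).trace_nonneg
  rw [hB₁.isHermitian.eq] at hq
  have hq' : (B₁ * B₁).trace = ((B₁ * B₁).trace.re : ℂ) :=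
    Complex.ext (by simp) (by simpa using hq.2.symm)
  have hq0 : (B₁ * B₁).trace.re ≠ 0 := fun h0 => by
    rw [h0] at hq'
    have h1 := trace_conjTranspose_mul_self_eq_zero_iff (A := B₁)
    rw [hB₁.isHermitian.eq] at h1
    have h2 := hB₁.trace_pos
    rw [h1.1 (by simpa using hq')] at h2
    simp at h2
  set c : ℝ := quad B₁ v / (B₁ * B₁).trace.re with hc
  have hc0 : 0 ≤ c := div_nonneg hβ0 hq.1
  have hXh : (R - (c : ℂ) • B₁).IsHermitian := by
    refine hRh.sub ?_
    rw [IsHermitian, conjTranspose_smul, hB₁.isHermitian.eq]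
    simp
  have hBX : (B₁ * (R - (c : ℂ) • B₁)).trace = 0 := by
    rw [mul_sub, trace_sub, hβ, mul_smul_comm, trace_smul, hq', smul_eq_mul, ← Complex.ofReal_mul,
      hc, div_mul_cancel₀ _ hq0, sub_self]
  have hX := eq_zero_of_trace_mul (R := R) hXh (by rw [← herm_eq_trace]; exact h _ hXh hBX)
    (by rw [sub_sub_cancel, smul_mul_assoc, trace_smul, hBX, smul_zero])
  refine ⟨√c, ?_⟩
  rw [Real.sq_sqrt hc0]
  have h3 := congrArg transpose (sub_eq_zero.1 hX)
  rwa [hR, transpose_transpose, transpose_smul] at h3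

theorem two_pi_ne_zero : (2 * Real.pi : ℂ) ≠ 0 := by
  have : (Real.pi : ℂ) ≠ 0 := by exact_mod_cast Real.pi_ne_zero
  simp [this]

theorem one_div_two_pi_mul_eq_iff (x y : ℂ) :
    (1 / (2 * Real.pi) : ℂ) * x = y ↔ x = 2 * Real.pi * y := by
  have := two_pi_ne_zero
  rw [one_div, inv_mul_eq_iff_eq_mul₀ this]

theorem momentForm_inner (hT : 0 < T) (γ : GMType) {B₁ : Matrix (Fin T) (Fin T) ℂ}
    (hB₁ : B₁.PosDef) (p : ℝ) :
    MomentForm γ {f | IsSpectralDensity f ∧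
          (1 / (2 * Real.pi) : ℂ) * ∫ l, (weight γ l : ℂ) * (B₁ * f l).trace ∂circ = p}
        {L | ∃ α : ℝ, L = ((α ^ 2 : ℝ) : ℂ) • B₁ᵀ} (fun _ : Unit => B₁)
        (fun _ => 2 * Real.pi * p) := by
  refine ⟨fun f => ?_, ?_, fun v h => ?_⟩
  · rw [Set.mem_ofPred_eq, one_div_two_pi_mul_eq_iff]
    simp [weighted]
  · rintro _ ⟨α, rfl⟩
    rw [transpose_smul, transpose_transpose]
    exact Submodule.smul_mem _ _ (Submodule.subset_span ⟨(), rfl⟩)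
  · exact vecMulVec_eq_smul_of_annihilates hT hB₁ fun X hX hBX => h X hX fun _ => hBX

/-- For the diagonal conditions the invisible directions are the Hermitian matrices with zero
diagonal, among them the off-diagonal part of `v v*`. -/
theorem momentForm_diag (γ : GMType) (p : Fin T → ℝ) :
    MomentForm γ {f | IsSpectralDensity f ∧
          ∀ k, (1 / (2 * Real.pi) : ℂ) * ∫ l, (weight γ l : ℂ) * f l k k ∂circ = p k}
        {L | ∃ α : Fin T → ℝ, L = Matrix.diagonal fun k => ((α k ^ 2 : ℝ) : ℂ)}
        (fun k : Fin T => Matrix.single k k (1 : ℂ)) (fun k => 2 * Real.pi * p k) := by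
  have htr : ∀ (k : Fin T) (X : Matrix (Fin T) (Fin T) ℂ),
      (Matrix.single k k (1 : ℂ) * X).trace = X k k := fun k X => by
    rw [trace_single_mul]; simp
  refine ⟨fun f => ?_, ?_, fun v h => ?_⟩
  · rw [Set.mem_ofPred_eq]
    simp only [one_div_two_pi_mul_eq_iff, htr, weighted, Matrix.smul_apply, smul_eq_mul]
  · rintro _ ⟨α, rfl⟩
    have hsum : (Matrix.diagonal fun k => ((α k ^ 2 : ℝ) : ℂ)) =
        ∑ k, Matrix.single k k ((α k ^ 2 : ℝ) : ℂ) := by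
      ext i j
      rw [Matrix.sum_apply, Finset.sum_eq_single i (fun k _ hk => by
        rw [Matrix.single_apply, if_neg fun h => hk h.1]) (by simp)]
      simp [Matrix.single_apply, Matrix.diagonal_apply]
    rw [diagonal_transpose, hsum]
    refine sum_mem fun k _ => ?_
    have : Matrix.single k k ((α k ^ 2 : ℝ) : ℂ) =
        ((α k ^ 2 : ℝ) : ℂ) • Matrix.single k k (1 : ℂ) := by simp
    rw [this]
    exact Submodule.smul_mem _ _ (Submodule.subset_span ⟨k, rfl⟩)
  · set R := (vecMulVec v (star v))ᵀ with hR
    have hRh : R.IsHermitian := isHermitian_vecMulVec_transpose v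
    set Z : Matrix (Fin T) (Fin T) ℂ := diagonal fun k => R k k with hZ
    have hXh : (R - Z).IsHermitian := by
      refine hRh.sub ?_
      rw [hZ, IsHermitian, diagonal_conjTranspose]
      congr 1
      ext k
      exact hRh.apply k k
    have hdiag : ∀ k, (R - Z) k k = 0 := fun k => by simp [hZ]
    have hX := eq_zero_of_trace_mul (R := R) hXh
      (by rw [← herm_eq_trace]; exact h _ hXh fun k => by rw [htr, hdiag])
      (by
        rw [sub_sub_cancel, hZ, Matrix.trace]
        refine Finset.sum_eq_zero fun k _ => ?_
        rw [diag_apply, diagonal_mul, ← hZ, hdiag, mul_zero])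
    refine ⟨fun k => ‖v k‖, ?_⟩
    have h3 := congrArg transpose (sub_eq_zero.1 hX)
    rw [hR, transpose_transpose, hZ, diagonal_transpose] at h3
    rw [h3]
    congr 1
    ext k
    rw [hR, transpose_apply, vecMulVec_apply, Pi.star_apply, Complex.star_def, Complex.mul_conj,
      Complex.normSq_eq_norm_sq]

theorem momentForm_total (γ : GMType) (P : Matrix (Fin T) (Fin T) ℂ) :
    MomentForm γ {f | IsSpectralDensity f ∧
          ∀ i j, (1 / (2 * Real.pi) : ℂ) * ∫ l, (weight γ l : ℂ) * f l i j ∂circ = P i j}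
        {L | ∃ α : Fin T → ℂ, L = vecMulVec α (star α)}
        (fun ij : Fin T × Fin T => Matrix.single ij.2 ij.1 (1 : ℂ))
        (fun ij => 2 * Real.pi * P ij.1 ij.2) := by
  have htr : ∀ (i j : Fin T) (X : Matrix (Fin T) (Fin T) ℂ),
      (Matrix.single j i (1 : ℂ) * X).trace = X i j := fun i j X => by
    rw [trace_single_mul]; simp
  refine ⟨fun f => ?_, fun L _ => ?_, fun v _ => ⟨v, rfl⟩⟩
  · rw [Set.mem_ofPred_eq]
    simp only [one_div_two_pi_mul_eq_iff, htr, weighted, Matrix.smul_apply, smul_eq_mul,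
      Prod.forall]
  · rw [matrix_eq_sum_single Lᵀ]
    refine sum_mem fun i _ => sum_mem fun j _ => ?_
    have : Matrix.single i j (Lᵀ i j) = Lᵀ i j • Matrix.single i j (1 : ℂ) := by simp
    rw [this]
    exact Submodule.smul_mem _ _ (Submodule.subset_span ⟨(j, i), rfl⟩)

theorem MomentClass.exists_momentForm (hT : 0 < T) {γ : GMType}
    {D : Set (ℝ → Matrix (Fin T) (Fin T) ℂ)} {S : Set (Matrix (Fin T) (Fin T) ℂ)}
    (h : MomentClass γ D S) :
    ∃ (ι : Type) (A : ι → Matrix (Fin T) (Fin T) ℂ) (p : ι → ℂ), MomentForm γ D S A p := by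
  cases h with
  | total P hP => exact ⟨_, _, _, momentForm_total γ P⟩
  | trace p =>
    have := momentForm_inner hT γ (PosDef.one (n := Fin T) (R := ℂ)) p
    simp only [one_mul, transpose_one] at this
    exact ⟨_, _, _, this⟩
  | diag p => exact ⟨_, _, _, momentForm_diag γ p⟩
  | inner B₁ hB₁ p => exact ⟨_, _, _, momentForm_inner hT γ hB₁ p⟩

end Moments

/-! ### Least favourable densities and Lagrange multipliers -/

section Lagrange

variable {T : ℕ} {γ : GMType} {D : Set (ℝ → Matrix (Fin T) (Fin T) ℂ)}
  {S : Set (Matrix (Fin T) (Fin T) ℂ)} {b : ℕ → Fin T → ℂ}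
  {f f₀ : ℝ → Matrix (Fin T) (Fin T) ℂ} {C : ℝ → Fin T → ℂ}

theorem pi_norm_sq_le_sum (x : Fin T → ℂ) : ‖x‖ ^ 2 ≤ ∑ p, ‖x p‖ ^ 2 := by
  refine (Real.le_sqrt (norm_nonneg _) (Finset.sum_nonneg fun _ _ => sq_nonneg _)).1 ?_
  refine (pi_norm_le_iff_of_nonneg (Real.sqrt_nonneg _)).2 fun p => Real.le_sqrt_of_sq_le ?_
  exact Finset.single_le_sum (f := fun p => ‖x p‖ ^ 2) (fun _ _ => sq_nonneg _) (Finset.mem_univ p)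

theorem leastFavourable_iff (hD : ∀ f ∈ D, IsSpectralDensity f)
    (hb : Summable fun k => ‖b k‖) (hf₀ : f₀ ∈ D) :
    LeastFavourable γ b D f₀ ↔ ∀ f ∈ D,
      optVal (weighted γ f) (bSeries b) ≤ optVal (weighted γ f₀) (bSeries b) := by
  rw [LeastFavourable, and_iff_right hf₀]
  refine forall₂_congr fun f hf => ?_
  have h0 := optVal_nonneg ((hD f₀ hf₀).weighted (γ := γ)) (bSeries b)
  rw [optErr_eq (hD f hf) hb, optErr_eq (hD f₀ hf₀) hb, ENNReal.ofReal_le_ofReal_iff (by positivity)]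
  exact mul_le_mul_iff_right₀ (by positivity)

theorem vecMulVec_mulVec (M : Matrix (Fin T) (Fin T) ℂ) (x : Fin T → ℂ) :
    vecMulVec (M *ᵥ x) (star (M *ᵥ x)) = M * vecMulVec x (star x) * Mᴴ := by
  rw [mul_vecMulVec, vecMulVec_mul, star_mulVec]

/-- In terms of the residual `r = (Gᵀ)⁻¹ C` the equation with multipliers reads `r r* = Λ`. -/
theorem lagrange_iff_residual {G : ℝ → Matrix (Fin T) (Fin T) ℂ} (hG : IsMinDensity G)
    (C : ℝ → Fin T → ℂ) (L : Matrix (Fin T) (Fin T) ℂ) :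
    (∀ᵐ l ∂circ, vecMulVec (C l) (star (C l)) = (G l)ᵀ * L * (G l)ᵀ) ↔
      ∀ᵐ l ∂circ, vecMulVec (residual G C l) (star (residual G C l)) = L := by
  have key : ∀ᵐ l ∂circ, (vecMulVec (C l) (star (C l)) = (G l)ᵀ * L * (G l)ᵀ ↔
      vecMulVec (residual G C l) (star (residual G C l)) = L) := by
    filter_upwards [transpose_mulVec_residual hG C, hG.posSemidef, hG.isUnit_det] with l h1 hp hu
    have hu' : IsUnit ((G l)ᵀ) := by
      rw [isUnit_iff_isUnit_det, det_transpose]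
      exact hu
    rw [← h1, vecMulVec_mulVec, hp.transpose.isHermitian.eq]
    exact hu'.mul_left_inj.trans hu'.mul_right_inj
  constructor <;> intro h <;> filter_upwards [key, h] with l h1 h2
  · exact h1.1 h2
  · exact h1.2 h2

theorem residual_bounded {r : ℝ → Fin T → ℂ} {L : Matrix (Fin T) (Fin T) ℂ}
    (h : ∀ᵐ l ∂circ, vecMulVec (r l) (star (r l)) = L) :
    ∀ᵐ l ∂circ, ‖r l‖ ≤ √L.trace.re := by
  filter_upwards [h] with l hl
  refine Real.le_sqrt_of_sq_le ((pi_norm_sq_le_sum _).trans (le_of_eq ?_))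
  rw [← hl, trace_vecMulVec, dotProduct, Complex.re_sum]
  refine Finset.sum_congr rfl fun p _ => ?_
  rw [Pi.star_apply, Complex.star_def, Complex.mul_conj, Complex.ofReal_re,
    Complex.normSq_eq_norm_sq]

/-- If `r r*` is constant then the residual `r` is bounded, and `B - r` lies in the past of every
density, not only of the one it was computed from. -/
theorem IsSolution.pastLim_of_const {G G' : ℝ → Matrix (Fin T) (Fin T) ℂ} (hG : IsMinDensity G)
    (hb : Summable fun k => ‖b k‖) (hC : IsSolution G b C) {L : Matrix (Fin T) (Fin T) ℂ}
    (hL : ∀ᵐ l ∂circ, vecMulVec (residual G C l) (star (residual G C l)) = L)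
    (hG' : IsSpectralDensity G') : PastLim G' (bSeries b - residual G C) := by
  have hr := memL2_residual hG hC.energy
  refine pastLim_of_bounded hG' ((continuous_bSeries hb).aestronglyMeasurable.sub hr.aesm)
    (M := (∑' k, ‖b k‖) + √L.trace.re) ?_ fun p k hk => ?_
  · filter_upwards [residual_bounded hL] with l hl
    exact (norm_sub_le _ _).trans (add_le_add (norm_bSeries_le hb l) hl)
  · exact (hC.pastLim hG hb).fcoeff_eq_zero hG p hk

theorem integrable_trace_mul {G : ℝ → Matrix (Fin T) (Fin T) ℂ} (hG : IsSpectralDensity G)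
    (M : Matrix (Fin T) (Fin T) ℂ) : Integrable (fun l => (M * G l).trace) circ := by
  simp only [Matrix.trace, diag_apply, mul_apply]
  exact integrable_finsetSum _ fun i _ => integrable_finsetSum _ fun j _ =>
    (hG.integrable j i).const_mul _

theorem MomentForm.integral_trace_eq {ι : Type} {A : ι → Matrix (Fin T) (Fin T) ℂ} {p : ι → ℂ}
    (hF : MomentForm γ D S A p) (hf : f ∈ D) (hf₀ : f₀ ∈ D) {M : Matrix (Fin T) (Fin T) ℂ}
    (hM : M ∈ Submodule.span ℂ (Set.range A)) :
    ∫ l, (M * weighted γ f l).trace ∂circ = ∫ l, (M * weighted γ f₀ l).trace ∂circ := by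
  obtain ⟨h1, h2⟩ := (hF.mem_iff f).1 hf
  obtain ⟨h3, h4⟩ := (hF.mem_iff f₀).1 hf₀
  induction hM using Submodule.span_induction with
  | mem x hx =>
    obtain ⟨i, rfl⟩ := hx
    rw [h2, h4]
  | zero => simp
  | add x y _ _ hx hy =>
    simp only [add_mul, trace_add]
    rw [integral_add (integrable_trace_mul h1.weighted x) (integrable_trace_mul h1.weighted y),
      integral_add (integrable_trace_mul h3.weighted x) (integrable_trace_mul h3.weighted y), hx, hy]
  | smul c x _ hx =>
    simp only [smul_mul_assoc, trace_smul]
    rw [integral_smul, integral_smul, hx]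

theorem nrm_eq_integral_trace {G : ℝ → Matrix (Fin T) (Fin T) ℂ} (hG : IsSpectralDensity G)
    {r : ℝ → Fin T → ℂ} {L : Matrix (Fin T) (Fin T) ℂ}
    (hL : ∀ᵐ l ∂circ, vecMulVec (r l) (star (r l)) = L) :
    nrm G r = (∫ l, (Lᵀ * G l).trace ∂circ).re := by
  refine Eq.trans ?_ (integral_re (integrable_trace_mul hG Lᵀ))
  refine integral_congr_ae ?_
  filter_upwards [hL] with l hl
  rw [quad, herm_eq_trace, hl, trace_mul_comm]
  rfl

/-- When `r r* = Λ` is a multiplier matrix, the error of the estimate with residual `r` is the same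
for all densities of the class. -/
theorem MomentForm.nrm_residual_eq {ι : Type} {A : ι → Matrix (Fin T) (Fin T) ℂ} {p : ι → ℂ}
    (hF : MomentForm γ D S A p) (hf : f ∈ D) (hf₀ : f₀ ∈ D) {r : ℝ → Fin T → ℂ}
    {L : Matrix (Fin T) (Fin T) ℂ} (hLS : L ∈ S)
    (hL : ∀ᵐ l ∂circ, vecMulVec (r l) (star (r l)) = L) :
    nrm (weighted γ f) r = nrm (weighted γ f₀) r := by
  rw [nrm_eq_integral_trace ((hF.mem_iff f).1 hf).1.weighted hL,
    nrm_eq_integral_trace ((hF.mem_iff f₀).1 hf₀).1.weighted hL,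
    hF.integral_trace_eq hf hf₀ (hF.span L hLS)]

/-- The sufficiency of the equation with multipliers: the estimate that is optimal for `f₀` is
admissible, with the same error, for all other densities of the class. -/
theorem MomentForm.optVal_le {ι : Type} {A : ι → Matrix (Fin T) (Fin T) ℂ} {p : ι → ℂ}
    (hF : MomentForm γ D S A p) (hf : f ∈ D) (hf₀ : f₀ ∈ D) (hm : Minimal γ f₀)
    (hb : Summable fun k => ‖b k‖) (hC : IsSolution (weighted γ f₀) b C)
    {L : Matrix (Fin T) (Fin T) ℂ} (hLS : L ∈ S)
    (hL : ∀ᵐ l ∂circ, vecMulVec (residual (weighted γ f₀) C l)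
      (star (residual (weighted γ f₀) C l)) = L) :
    optVal (weighted γ f) (bSeries b) ≤ optVal (weighted γ f₀) (bSeries b) := by
  have hG₀ := hm.isMinDensity ((hF.mem_iff f₀).1 hf₀).1
  have hG := ((hF.mem_iff f).1 hf).1.weighted (γ := γ)
  have h1 := optVal_le_of_pastLim hG (memL2_bSeries hG hb) (hC.pastLim_of_const hG₀ hb hL hG)
  rw [sub_sub_cancel, hF.nrm_residual_eq hf hf₀ hLS hL] at h1
  rwa [hC.optVal_eq hG₀ hb]

/-- A lower bound for a density in terms of the trace of its inverse. -/
def lowerBound (f : ℝ → Matrix (Fin T) (Fin T) ℂ) (l : ℝ) : ℝ := ((f l)⁻¹.trace.re)⁻¹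

theorem lowerBound_pos (hT : 0 < T) (hf : IsSpectralDensity f) (hm : Minimal γ f) :
    ∀ᵐ l ∂circ, 0 < lowerBound f l := by
  have : Nonempty (Fin T) := ⟨⟨0, hT⟩⟩
  filter_upwards [hf.posSemidef, hm.1] with l hp hu
  have h1 : (f l).PosDef := hp.posDef_iff_isUnit.2 ((isUnit_iff_isUnit_det _).2 hu)
  exact inv_pos.2 (Complex.pos_iff.1 h1.inv.trace_pos).1

theorem lowerBound_mul_le (hT : 0 < T) (hf : IsSpectralDensity f) (hm : Minimal γ f) :
    ∀ᵐ l ∂circ, ∀ x : Fin T → ℂ, lowerBound f l * ∑ p, ‖x p‖ ^ 2 ≤ quad (f l) x := by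
  filter_upwards [hf.posSemidef, hm.1, lowerBound_pos hT hf hm] with l hp hu hpos x
  have h1 := sum_norm_sq_le hp hu x
  have h2 : 0 < (f l)⁻¹.trace.re := inv_pos.1 hpos
  rw [lowerBound, inv_mul_le_iff₀ h2, mul_comm]
  exact h1

theorem integrable_lowerBound (hT : 0 < T) (hf : IsSpectralDensity f) (hm : Minimal γ f) :
    Integrable (lowerBound f) circ := by
  refine (hf.integrable ⟨0, hT⟩ ⟨0, hT⟩).re.mono' ?_ ?_
  · have h : AEStronglyMeasurable (fun l => (f l)⁻¹.trace) circ :=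
      Finset.aestronglyMeasurable_fun_sum _ fun i _ => aesm_inv hf.aesm i i
    exact (Complex.continuous_re.comp_aestronglyMeasurable h).aemeasurable.inv.aestronglyMeasurable
  · filter_upwards [lowerBound_pos hT hf hm, lowerBound_mul_le hT hf hm] with l h1 h2
    rw [Real.norm_of_nonneg h1.le]
    have h3 := h2 (Pi.single ⟨0, hT⟩ 1)
    rw [quad_single] at h3
    refine le_trans (le_of_eq ?_) h3
    rw [Finset.sum_eq_single (⟨0, hT⟩ : Fin T)]
    · simp
    · intro q _ hq
      simp [hq]
    · simp

theorem integrable_weight_mul_real {u : ℝ → ℝ} (hu : Integrable u circ) :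
    Integrable (fun l => weight γ l * u l) circ := by
  have := (integrable_weight_mul γ hu.ofReal).re
  refine this.congr (ae_of_all _ fun l => ?_)
  simp

theorem abs_quad_le_sum (X : Matrix (Fin T) (Fin T) ℂ) (x : Fin T → ℂ) :
    |quad X x| ≤ (∑ i, ∑ j, ‖X i j‖) * ∑ p, ‖x p‖ ^ 2 := by
  refine (Complex.abs_re_le_norm _).trans ((norm_herm_le_sum x x).trans ?_)
  rw [← sq]
  gcongr
  exact pi_norm_sq_le_sum x

/-- First variation at a least favourable density `f₀` in the direction `ρ ψ X`, where `ρ` is the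
lower bound of `f₀`. The bound `ρ` keeps `f₀ + t ρ ψ X` positive semidefinite for small `t`, and
`hmom` keeps it in the class. -/
theorem MomentForm.integral_quad_nonpos {ι : Type} {A : ι → Matrix (Fin T) (Fin T) ℂ} {p : ι → ℂ}
    (hT : 0 < T) (hF : MomentForm γ D S A p) (hf₀ : f₀ ∈ D) (hm : Minimal γ f₀)
    (hb : Summable fun k => ‖b k‖) (hC : IsSolution (weighted γ f₀) b C)
    (hmax : ∀ f ∈ D, optVal (weighted γ f) (bSeries b) ≤ optVal (weighted γ f₀) (bSeries b))
    {X : Matrix (Fin T) (Fin T) ℂ} (hX : X.IsHermitian) {ψ : ℝ → ℝ} (hψ : Measurable ψ)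
    (hψ1 : ∀ l, |ψ l| ≤ 1)
    (hmom : ∀ i, (A i * X).trace *
      ((∫ l, weight γ l * lowerBound f₀ l * ψ l ∂circ : ℝ) : ℂ) = 0) :
    ∫ l, weight γ l * lowerBound f₀ l * ψ l * quad X (residual (weighted γ f₀) C l) ∂circ ≤ 0 := by
  obtain ⟨hfd, hfm⟩ := (hF.mem_iff f₀).1 hf₀
  have hG := hm.isMinDensity hfd
  have hτ := integrable_lowerBound hT hfd hm
  set u : ℝ → ℝ := fun l => lowerBound f₀ l * ψ l with hu
  have hui : Integrable u circ := hτ.mul_bdd (c := 1) hψ.aestronglyMeasurable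
    (ae_of_all _ fun l => by rw [Real.norm_eq_abs]; exact hψ1 l)
  have hwu : Integrable (fun l => weight γ l * u l) circ := integrable_weight_mul_real hui
  set κ : ℝ := (∑ i, ∑ j, ‖X i j‖) + 1 with hκ
  have hκ0 : 0 < κ := by positivity
  have hbound : ∀ᵐ l ∂circ, ∀ x, |u l * quad X x| ≤ κ * quad (f₀ l) x := by
    filter_upwards [lowerBound_pos hT hfd hm, lowerBound_mul_le hT hfd hm] with l h1 h2 x
    have h3 := abs_quad_le_sum X x
    have h4 : 0 ≤ ∑ p, ‖x p‖ ^ 2 := Finset.sum_nonneg fun _ _ => sq_nonneg _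
    rw [abs_mul, hu, abs_mul, abs_of_pos h1]
    calc lowerBound f₀ l * |ψ l| * |quad X x|
        ≤ lowerBound f₀ l * 1 * ((∑ i, ∑ j, ‖X i j‖) * ∑ p, ‖x p‖ ^ 2) := by
          gcongr
          exact hψ1 l
      _ ≤ κ * (lowerBound f₀ l * ∑ p, ‖x p‖ ^ 2) := by
          rw [hκ]
          nlinarith [mul_nonneg h1.le h4]
      _ ≤ κ * quad (f₀ l) x := mul_le_mul_of_nonneg_left (h2 x) hκ0.le
  have hherm : ∀ c : ℝ, ((c : ℂ) • X).IsHermitian := fun c => by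
    rw [IsHermitian, conjTranspose_smul, hX.eq]
    simp
  have h := hC.integral_quad_nonpos hG hb (H := fun l => ((weight γ l * u l : ℝ) : ℂ) • X)
    (fun i j => by
      simp only [Matrix.smul_apply, smul_eq_mul]
      exact hwu.ofReal.mul_const _)
    (ae_of_all _ fun l => hherm _) hκ0
    (by
      filter_upwards [hbound] with l hl x
      rw [quad_smul_matrix, weighted, quad_smul_matrix, mul_assoc, abs_mul,
        abs_of_nonneg (weight_nonneg γ l), mul_left_comm]
      exact mul_le_mul_of_nonneg_left (hl x) (weight_nonneg γ l))
    (fun t ht htκ => by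
      set f : ℝ → Matrix (Fin T) (Fin T) ℂ := fun l => f₀ l + ((t * u l : ℝ) : ℂ) • X with hf
      have hw : weighted γ f = fun l => weighted γ f₀ l +
          (t : ℂ) • (((weight γ l * u l : ℝ) : ℂ) • X) := by
        ext1 l
        rw [hf, weighted, weighted, smul_add, smul_smul, smul_smul]
        congr 2
        push_cast
        ring
      rw [← hw]
      refine hmax f ((hF.mem_iff f).2 ⟨⟨fun i j => ?_, ?_⟩, fun i => ?_⟩)
      · refine (hfd.integrable i j).add ?_
        simp only [Matrix.smul_apply, smul_eq_mul]
        exact (hui.const_mul t).ofReal.mul_const _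
      · filter_upwards [hfd.posSemidef, hbound] with l hp hl
        refine posSemidef_of_quad_nonneg (hp.isHermitian.add (hherm _)) fun x => ?_
        rw [quad_add_matrix, quad_smul_matrix]
        have h1 := (abs_le.1 (hl x)).1
        have h2 := quad_nonneg hp x
        nlinarith
      · rw [hw, ← hfm i]
        simp only [mul_add, trace_add, mul_smul_comm, trace_smul, smul_eq_mul]
        have hi1 : Integrable (fun l => (A i * weighted γ f₀ l).trace) circ :=
          integrable_trace_mul hfd.weighted _
        have hi2 : Integrable (fun l => (t : ℂ) *
            (((weight γ l * u l : ℝ) : ℂ) * (A i * X).trace)) circ :=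
          (hwu.ofReal.mul_const _).const_mul _
        rw [integral_add hi1 hi2, integral_const_mul, integral_mul_const,
          integral_complex_ofReal]
        have h1 := hmom i
        simp only [mul_assoc] at h1
        rw [mul_comm _ (A i * X).trace, h1, mul_zero, add_zero])
  simp only [quad_smul_matrix] at h
  refine le_of_eq_of_le ?_ h
  congr 1
  ext l
  simp only [hu]
  ring

theorem integrable_lowerBound_mul_quad (hT : 0 < T) (hf : IsSpectralDensity f) (hm : Minimal γ f)
    {r : ℝ → Fin T → ℂ} (hr : MemL2 (weighted γ f) r) (X : Matrix (Fin T) (Fin T) ℂ) :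
    Integrable (fun l => weight γ l * lowerBound f l * quad X (r l)) circ := by
  have hω := integrable_weight_mul_real (γ := γ) (integrable_lowerBound hT hf hm)
  have hq : AEStronglyMeasurable (fun l => quad X (r l)) circ :=
    Complex.continuous_re.comp_aestronglyMeasurable
      (aesm_herm (G := fun _ => X) (fun i j => aestronglyMeasurable_const) hr.aesm hr.aesm)
  refine (hr.integrable.const_mul (∑ i, ∑ j, ‖X i j‖)).mono' (hω.aestronglyMeasurable.mul hq) ?_
  filter_upwards [lowerBound_pos hT hf hm, lowerBound_mul_le hT hf hm] with l h1 h2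
  have hw := weight_nonneg γ l
  rw [norm_mul, Real.norm_of_nonneg (mul_nonneg hw h1.le), Real.norm_eq_abs, weighted,
    quad_smul_matrix]
  calc weight γ l * lowerBound f l * |quad X (r l)|
      ≤ weight γ l * lowerBound f l * ((∑ i, ∑ j, ‖X i j‖) * ∑ p, ‖r l p‖ ^ 2) :=
        mul_le_mul_of_nonneg_left (abs_quad_le_sum X _) (mul_nonneg hw h1.le)
    _ = (∑ i, ∑ j, ‖X i j‖) * (weight γ l * (lowerBound f l * ∑ p, ‖r l p‖ ^ 2)) := by ring
    _ ≤ _ := mul_le_mul_of_nonneg_left (mul_le_mul_of_nonneg_left (h2 _) hw) (by positivity)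

theorem herm_single_self (i j : Fin T) (c : ℂ) (x : Fin T → ℂ) :
    herm (Matrix.single i j c) x x = c * (x i * star (x j)) := by
  rw [herm, single_mulVec, ← Pi.single, dotProduct_single]
  simp only [Pi.star_apply]
  ring

/-- If all Hermitian forms of `r` are a.e. constant then so is `r r*`, whose entries are
combinations of the forms of `E_ij + E_ji` and `i (E_ij - E_ji)`. -/
theorem ae_const_vecMulVec {r : ℝ → Fin T → ℂ}
    (h : ∀ X : Matrix (Fin T) (Fin T) ℂ, X.IsHermitian →
      ∃ c : ℝ, ∀ᵐ l ∂circ, quad X (r l) = c) :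
    ∃ K : Matrix (Fin T) (Fin T) ℂ, ∀ᵐ l ∂circ, vecMulVec (r l) (star (r l)) = K := by
  have hentry : ∀ i j, ∃ c, ∀ᵐ l ∂circ, vecMulVec (r l) (star (r l)) i j = c := by
    intro i j
    obtain ⟨c₁, hc₁⟩ := h (Matrix.single i j 1 + Matrix.single j i 1) (by
      rw [IsHermitian, conjTranspose_add, conjTranspose_single, conjTranspose_single, star_one,
        add_comm])
    obtain ⟨c₂, hc₂⟩ := h (Matrix.single i j Complex.I + Matrix.single j i (-Complex.I)) (by
      rw [IsHermitian, conjTranspose_add, conjTranspose_single, conjTranspose_single, star_neg,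
        Complex.star_def, Complex.conj_I, neg_neg, add_comm])
    refine ⟨(c₁ / 2 : ℝ) + (-c₂ / 2 : ℝ) * Complex.I, ?_⟩
    filter_upwards [hc₁, hc₂] with l h1 h2
    rw [quad, herm_add_matrix, herm_single_self, herm_single_self] at h1 h2
    rw [vecMulVec_apply, Pi.star_apply]
    simp only [Complex.star_def, Complex.add_re, Complex.mul_re, Complex.mul_im, Complex.conj_re,
      Complex.conj_im, Complex.I_re, Complex.I_im, Complex.one_re, Complex.one_im, Complex.neg_re,
      Complex.neg_im] at h1 h2
    apply Complex.ext
    · simp only [Complex.star_def, Complex.add_re, Complex.mul_re, Complex.conj_re,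
        Complex.conj_im, Complex.I_re, Complex.I_im, Complex.ofReal_re, Complex.ofReal_im]
      linarith
    · simp only [Complex.star_def, Complex.add_im, Complex.mul_im, Complex.conj_re,
        Complex.conj_im, Complex.I_re, Complex.I_im, Complex.ofReal_re, Complex.ofReal_im]
      linarith
  choose K hK using hentry
  refine ⟨Matrix.of K, ?_⟩
  have : ∀ᵐ l ∂circ, ∀ i j, vecMulVec (r l) (star (r l)) i j = K i j :=
    ae_all_iff.2 fun i => ae_all_iff.2 fun j => hK i j
  filter_upwards [this] with l hl
  ext i j
  exact hl i j

theorem neBot_ae_circ : (ae circ).NeBot := by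
  rw [ae_neBot]
  intro h0
  have h := circ_real_univ
  rw [h0, measureReal_zero, Pi.zero_apply] at h
  linarith [Real.pi_pos]

/-- Under a least favourable density the residual satisfies `r r* = Λ` for a constant matrix `Λ`,
which is a multiplier matrix of the class. -/
theorem MomentForm.exists_multiplier {ι : Type} {A : ι → Matrix (Fin T) (Fin T) ℂ} {p : ι → ℂ}
    (hT : 0 < T) (hF : MomentForm γ D S A p) (hf₀ : f₀ ∈ D) (hm : Minimal γ f₀)
    (hb : Summable fun k => ‖b k‖) (hC : IsSolution (weighted γ f₀) b C)
    (hmax : ∀ f ∈ D, optVal (weighted γ f) (bSeries b) ≤ optVal (weighted γ f₀) (bSeries b)) :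
    ∃ L ∈ S, ∀ᵐ l ∂circ, vecMulVec (residual (weighted γ f₀) C l)
      (star (residual (weighted γ f₀) C l)) = L := by
  have hfd := ((hF.mem_iff f₀).1 hf₀).1
  have hG := hm.isMinDensity hfd
  have hτ := integrable_lowerBound hT hfd hm
  set r := residual (weighted γ f₀) C with hr
  have hrm : MemL2 (weighted γ f₀) r := memL2_residual hG hC.energy
  set ω : ℝ → ℝ := fun l => weight γ l * lowerBound f₀ l with hω
  have hωi : Integrable ω circ := integrable_weight_mul_real hτ
  have hωpos : ∀ᵐ l ∂circ, 0 < ω l := by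
    filter_upwards [ae_weight_pos γ, lowerBound_pos hT hfd hm] with l h1 h2 using mul_pos h1 h2
  have hki : ∀ X : Matrix (Fin T) (Fin T) ℂ, Integrable (fun l => ω l * quad X (r l)) circ :=
    integrable_lowerBound_mul_quad hT hfd hm hrm
  -- Applying the first variation to `ψ` and `-ψ` turns the inequality into an equality.
  have hzero : ∀ X : Matrix (Fin T) (Fin T) ℂ, X.IsHermitian → ∀ ψ : ℝ → ℝ, Measurable ψ →
      (∀ l, |ψ l| ≤ 1) → (∀ i, (A i * X).trace * ((∫ l, ω l * ψ l ∂circ : ℝ) : ℂ) = 0) →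
      ∫ l, ω l * ψ l * quad X (r l) ∂circ = 0 := by
    intro X hX ψ hψ hψ1 hmom
    have h1 := hF.integral_quad_nonpos hT hf₀ hm hb hC hmax hX hψ hψ1 hmom
    have h2 := hF.integral_quad_nonpos hT hf₀ hm hb hC hmax hX hψ.neg
      (fun l => by rw [Pi.neg_apply, abs_neg]; exact hψ1 l) (fun i => by
        simp only [Pi.neg_apply, mul_neg, integral_neg]
        push_cast
        rw [mul_neg, neg_eq_zero]
        exact hmom i)
    simp only [Pi.neg_apply, mul_neg, neg_mul, integral_neg] at h2
    exact le_antisymm h1 (by linarith)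
  have hconst : ∀ X : Matrix (Fin T) (Fin T) ℂ, X.IsHermitian →
      ∃ c, ∀ᵐ l ∂circ, quad X (r l) = c := fun X hX =>
    ae_const_of_forall_integral_eq_zero hωi hωpos (hki X) fun ψ hψ hψ1 h0 =>
      hzero X hX ψ hψ hψ1 fun i => by rw [h0, Complex.ofReal_zero, mul_zero]
  obtain ⟨K, hae⟩ := ae_const_vecMulVec hconst
  have hne := neBot_ae_circ
  -- For invisible `X` no condition on `ψ` is needed, and `ψ = 1` shows that the form of `X` vanishes.
  obtain ⟨l₀, hl₀⟩ := hae.exists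
  refine ⟨K, ?_, hae⟩
  rw [← hl₀]
  refine hF.mem_of_annihilates _ fun X hX hXA => ?_
  obtain ⟨c, hc⟩ := hconst X hX
  have h1 := hzero X hX (fun _ => 1) measurable_const (fun _ => by simp)
    (fun i => by rw [hXA i, zero_mul])
  have hc0 : c = 0 := by
    have h2 : ∫ l, ω l * 1 * quad X (r l) ∂circ = (∫ l, ω l ∂circ) * c := by
      rw [← integral_mul_const]
      refine integral_congr_ae ?_
      filter_upwards [hc] with l hl
      rw [hl, mul_one]
    rw [h2] at h1
    refine (mul_eq_zero.1 h1).resolve_left fun h3 => ?_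
    have h4 := (integral_eq_zero_iff_of_nonneg_ae (hωpos.mono fun l hl => hl.le) hωi).1 h3
    obtain ⟨l, h5, h6⟩ := (h4.and hωpos).exists
    rw [h5] at h6
    exact lt_irrefl _ h6
  obtain ⟨l₁, h2, h3⟩ := (hc.and hae).exists
  rw [herm_eq_trace, hl₀, ← h3, ← herm_eq_trace, quad_conj_swap hX, h2, hc0, Complex.ofReal_zero]

/-! ### The constrained optimization problem -/

theorem Minimal.of_isMinDensity (hG : IsMinDensity (weighted γ f)) : Minimal γ f := by
  refine ⟨?_, hG.integrable_inv.congr ?_⟩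
  · filter_upwards [hG.isUnit_det] with l hu
    rw [weighted, det_smul] at hu
    exact isUnit_of_mul_isUnit_right hu
  · filter_upwards [ae_weight_pos γ] with l hw
    rw [weighted_inv hw]

/-- Diagonal form of the antitonicity of the inverse. -/
theorem inv_add_diag_le {A A' : Matrix (Fin T) (Fin T) ℂ} (hA : A.PosSemidef) (hA' : A'.PosSemidef)
    (hu : IsUnit A'.det) (p : Fin T) :
    IsUnit (A + A').det ∧ ((A + A')⁻¹ p p).re ≤ (A'⁻¹ p p).re := by
  have hd : A'.PosDef := hA'.posDef_iff_isUnit.2 ((isUnit_iff_isUnit_det _).2 hu)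
  have hs : IsUnit (A + A').det := (isUnit_iff_isUnit_det _).1 (PosDef.posSemidef_add hA hd).isUnit
  refine ⟨hs, ?_⟩
  have hp := hA.add hA'
  set y : Fin T → ℂ := ((A + A')⁻¹)ᵀ *ᵥ Pi.single p 1 with hy
  have hyp : y p = (A + A')⁻¹ p p := by simp [hy]
  have h1 : ((A + A')⁻¹ p p).re = quad (A + A') y := by
    rw [← quad_single, quad, herm_inv hp hs, quad]
  rw [quad_add_matrix] at h1
  have h2 := norm_apply_sq_le hA' hu y p
  have h3 := quad_nonneg hA y
  have h4 := quad_nonneg hA' y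
  have h5 := Complex.re_le_norm (y p)
  rw [hyp] at h2 h5
  have h6 := (Complex.nonneg_iff.1 (hA'.inv.diag_nonneg (i := p))).1
  rcases eq_or_lt_of_le (h3.trans (le_of_le_of_eq (le_add_of_nonneg_right h4) h1.symm)) with h0 | h0
  · rw [← h0]; exact h6
  · nlinarith

theorem isMinDensity_midpoint {G G₀ : ℝ → Matrix (Fin T) (Fin T) ℂ} (hG : IsSpectralDensity G)
    (hG₀ : IsMinDensity G₀) :
    IsMinDensity fun l => (1 / 2 : ℂ) • (G l + G₀ l) := by
  have h0 : (0 : ℂ) ≤ 1 / 2 := by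
    rw [show (1 / 2 : ℂ) = ((1 / 2 : ℝ) : ℂ) by push_cast; rfl]
    exact_mod_cast (by norm_num : (0 : ℝ) ≤ 1 / 2)
  have hd : IsSpectralDensity fun l => (1 / 2 : ℂ) • (G l + G₀ l) := by
    refine ⟨fun i j => ((hG.integrable i j).add (hG₀.integrable i j)).const_mul _, ?_⟩
    filter_upwards [hG.posSemidef, hG₀.posSemidef] with l h1 h2 using (h1.add h2).smul h0
  refine ⟨hd, ?_, ?_⟩
  · filter_upwards [hG.posSemidef, hG₀.posSemidef, hG₀.isUnit_det] with l h1 h2 h3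
    rw [det_smul]
    refine IsUnit.mul (isUnit_iff_ne_zero.2 (by norm_num)) ?_
    rcases Nat.eq_zero_or_pos T with h | h
    · subst h; simp
    · exact (inv_add_diag_le h1 h2 h3 ⟨0, h⟩).1
  · refine (hG₀.integrable_inv.re.const_mul 2).mono'
      (Finset.aestronglyMeasurable_fun_sum _ fun i _ => aesm_inv hd.aesm i i) ?_
    filter_upwards [hG.posSemidef, hG₀.posSemidef, hG₀.isUnit_det] with l h1 h2 h3
    have hp := (h1.add h2).inv
    have e : ((1 / 2 : ℂ) • (G l + G₀ l))⁻¹ = (2 : ℂ) • (G l + G₀ l)⁻¹ := by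
      by_cases hu : IsUnit (G l + G₀ l).det
      · refine inv_eq_right_inv ?_
        rw [smul_mul_smul_comm, mul_nonsing_inv _ hu]
        norm_num
      · have h5 : ¬ IsUnit ((1 / 2 : ℂ) • (G l + G₀ l)).det := by
          rw [det_smul, isUnit_iff_ne_zero]
          rw [isUnit_iff_ne_zero, not_not] at hu
          simp [hu]
        rw [nonsing_inv_apply_not_isUnit _ h5, nonsing_inv_apply_not_isUnit _ hu, smul_zero]
    have h4 : ((G l + G₀ l)⁻¹).trace = (((G l + G₀ l)⁻¹).trace.re : ℂ) :=
      Complex.ext (by simp) (by simpa using (Complex.nonneg_iff.1 hp.trace_nonneg).2.symm)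
    rw [e, trace_smul, norm_smul, h4, Complex.norm_real, Real.norm_of_nonneg (trace_re_nonneg hp)]
    simp only [Complex.norm_ofNat]
    gcongr
    simp only [Matrix.trace, Complex.re_sum, diag_apply]
    change _ ≤ (∑ i, (G₀ l)⁻¹ i i).re
    rw [Complex.re_sum]
    exact Finset.sum_le_sum fun i _ => (inv_add_diag_le h1 h2 h3 i).2

/-- The optimal error is a concave function of the density, being an infimum of linear ones. -/
theorem optVal_midpoint {G G₀ : ℝ → Matrix (Fin T) (Fin T) ℂ} (hG : IsSpectralDensity G)
    (hG₀ : IsSpectralDensity G₀) {B : ℝ → Fin T → ℂ} (hB : MemL2 G B) (hB₀ : MemL2 G₀ B) :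
    (1 / 2) * (optVal G B + optVal G₀ B) ≤
      optVal (fun l => (1 / 2 : ℂ) • (G l + G₀ l)) B := by
  refine le_ciInf fun Q => ?_
  have h1 := optVal_le hG B Q.2
  have h2 := optVal_le hG₀ B Q.2
  have h3 : nrm (fun l => (1 / 2 : ℂ) • (G l + G₀ l)) (B - Q.1) =
      (1 / 2) * (nrm G (B - Q.1) + nrm G₀ (B - Q.1)) := by
    rw [nrm, nrm, nrm, ← integral_add (hB.sub hG (memL2_of_mem hG Q.2)).integrable
      (hB₀.sub hG₀ (memL2_of_mem hG₀ Q.2)).integrable, ← integral_const_mul]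
    congr 1
    ext l
    rw [show (1 / 2 : ℂ) = ((1 / 2 : ℝ) : ℂ) by push_cast; rfl, quad_smul_matrix, quad_add_matrix]
  rw [h3]
  linarith

/-- Maximality among the minimal densities of the class implies maximality in the whole class:
the midpoint of `f₀` and an arbitrary `f` is minimal, and the error is concave. -/
theorem MomentForm.isMax_iff {ι : Type} {A : ι → Matrix (Fin T) (Fin T) ℂ} {p : ι → ℂ}
    (hF : MomentForm γ D S A p) (hf₀ : f₀ ∈ D) (hm : Minimal γ f₀)
    (hb : Summable fun k => ‖b k‖) (hC : IsSolution (weighted γ f₀) b C) :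
    (∀ f ∈ D, optVal (weighted γ f) (bSeries b) ≤ optVal (weighted γ f₀) (bSeries b)) ↔
      ∀ f ∈ D, Minimal γ f → ∀ C', IsFInverse γ f b C' → fInvForm b C' ≤ fInvForm b C := by
  have hfd := ((hF.mem_iff f₀).1 hf₀).1
  have hG₀ := hm.isMinDensity hfd
  have h2π : 0 < 1 / (2 * Real.pi) := by positivity
  constructor
  · intro h f hf hfm C' hC'
    have hfd' := ((hF.mem_iff f).1 hf).1
    rw [(hC'.isSolution hfd' hfm).fInvForm_eq (hfm.isMinDensity hfd') hb, hC.fInvForm_eq hG₀ hb]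
    exact mul_le_mul_of_nonneg_left (h f hf) h2π.le
  · intro h f hf
    obtain ⟨hfd', hfm'⟩ := (hF.mem_iff f).1 hf
    have hG := hfd'.weighted (γ := γ)
    set g : ℝ → Matrix (Fin T) (Fin T) ℂ := fun l => (1 / 2 : ℂ) • (f l + f₀ l) with hg
    have hw : weighted γ g = fun l => (1 / 2 : ℂ) • (weighted γ f l + weighted γ f₀ l) := by
      ext1 l
      simp only [weighted, hg, smul_add, smul_comm (weight γ l : ℂ)]
    have hgd : IsSpectralDensity g := by
      refine ⟨fun i j => ((hfd'.integrable i j).add (hfd.integrable i j)).const_mul _, ?_⟩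
      filter_upwards [hfd'.posSemidef, hfd.posSemidef] with l h1 h2
      refine (h1.add h2).smul ?_
      rw [show (1 / 2 : ℂ) = ((1 / 2 : ℝ) : ℂ) by push_cast; rfl]
      exact_mod_cast (by norm_num : (0 : ℝ) ≤ 1 / 2)
    have hgD : g ∈ D := by
      refine (hF.mem_iff g).2 ⟨hgd, fun i => ?_⟩
      rw [hw]
      simp only [mul_smul_comm, mul_add, trace_smul, trace_add, smul_eq_mul]
      have hi1 : Integrable (fun l => (1 / 2 : ℂ) * (A i * weighted γ f l).trace) circ :=
        (integrable_trace_mul hG _).const_mul _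
      have hi2 : Integrable (fun l => (1 / 2 : ℂ) * (A i * weighted γ f₀ l).trace) circ :=
        (integrable_trace_mul hG₀.toIsSpectralDensity _).const_mul _
      rw [integral_add hi1 hi2, integral_const_mul, integral_const_mul, hfm' i,
        ((hF.mem_iff f₀).1 hf₀).2 i]
      ring
    have hgG : IsMinDensity (weighted γ g) := by
      rw [hw]
      exact isMinDensity_midpoint hG hG₀
    have hgm := Minimal.of_isMinDensity hgG
    obtain ⟨C', hC', -⟩ := exists_isSolution hgG hb
    have h1 := h g hgD hgm C' (hC'.isFInverse hgd hgm)
    rw [hC'.fInvForm_eq hgG hb, hC.fInvForm_eq hG₀ hb] at h1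
    have h2 := le_of_mul_le_mul_left h1 h2π
    have h3 := optVal_midpoint hG hG₀.toIsSpectralDensity (memL2_bSeries hG hb)
      (memL2_bSeries hG₀.toIsSpectralDensity hb)
    rw [← hw] at h3
    linarith

end Lagrange

/-! ### The minimax-robust spectral characteristic -/

section Minimax

variable {T : ℕ} {γ : GMType} {D : Set (ℝ → Matrix (Fin T) (Fin T) ℂ)}
  {S : Set (Matrix (Fin T) (Fin T) ℂ)} {b : ℕ → Fin T → ℂ}
  {f f₀ : ℝ → Matrix (Fin T) (Fin T) ℂ} {C : ℝ → Fin T → ℂ}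

theorem MemPast.congr (hf : IsSpectralDensity f) {h g : ℝ → Fin T → ℂ} (hh : MemPast γ f h)
    (e : h =ᵐ[circ] g) : MemPast γ f g := by
  refine (memPast_iff hf g).2 (((memPast_iff hf h).1 hh).congr ?_)
  filter_upwards [e] with l hl
  rw [hl]

/-- The spectral characteristic is the transfer function times the projection `B - r` onto the
past. -/
theorem charact_ae_eq : charact γ b f C =ᵐ[circ]
    fun l => (chi γ l / beta γ l) • (bSeries b - residual (weighted γ f) C) l := by
  filter_upwards [ae_chi_ne_zero γ, ae_beta_ne_zero γ, ae_weight_pos γ] with l h1 h2 h3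
  have hw : (weight γ l : ℂ) = chi γ l / beta γ l * star (chi γ l / beta γ l) := by
    rw [weight_eq, Complex.star_def, Complex.mul_conj, Complex.normSq_eq_norm_sq]
  have h4 : star (beta γ l) / star (chi γ l) = chi γ l / beta γ l * (weight γ l : ℂ)⁻¹ := by
    rw [hw, star_div₀]
    have h5 : star (chi γ l) ≠ 0 := star_ne_zero.2 h1
    have h6 : star (beta γ l) ≠ 0 := star_ne_zero.2 h2
    field_simp
  rw [charact, Pi.sub_apply, smul_sub, residual, weighted_inv h3, transpose_smul, smul_mulVec,
    smul_smul, ← h4, mulVec_transpose]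

theorem err_eq (hf : IsSpectralDensity f) (hb : Summable fun k => ‖b k‖) {v : ℝ → Fin T → ℂ}
    (hv : MemL2 (weighted γ f) v) :
    err γ b (fun l => (chi γ l / beta γ l) • v l) f =
      ENNReal.ofReal (1 / (2 * Real.pi) * nrm (weighted γ f) (bSeries b - v)) := by
  rw [err_smul_transfer, sqNorm_eq_ofReal hf.weighted
    ((memL2_bSeries hf.weighted hb).sub hf.weighted hv)]

theorem isOptimal_charact (hf : IsSpectralDensity f) (hm : Minimal γ f)
    (hb : Summable fun k => ‖b k‖) (hC : IsSolution (weighted γ f) b C) :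
    IsOptimal γ b f (charact γ b f C) := by
  have hG := hm.isMinDensity hf
  have hp := hC.pastLim hG hb
  refine ⟨((memPast_smul_iff hf _).2 hp).congr hf charact_ae_eq.symm, ?_⟩
  rw [err_congr charact_ae_eq, err_eq hf hb hp.memL2, sub_sub_cancel, optErr_eq hf hb,
    hC.optVal_eq hG hb]

/-- Under a least favourable density the optimal estimate lies in the past of every density of the
class and has the same error for all of them; a competitor with no larger error under `f₀` agrees
with it by Pythagoras. -/
theorem MomentForm.isMinimax_iff {ι : Type} {A : ι → Matrix (Fin T) (Fin T) ℂ} {p : ι → ℂ}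
    (hF : MomentForm γ D S A p) (hf₀ : f₀ ∈ D) (hm : Minimal γ f₀)
    (hb : Summable fun k => ‖b k‖) (hC : IsSolution (weighted γ f₀) b C)
    {L : Matrix (Fin T) (Fin T) ℂ} (hLS : L ∈ S)
    (hL : ∀ᵐ l ∂circ, vecMulVec (residual (weighted γ f₀) C l)
      (star (residual (weighted γ f₀) C l)) = L) (h : ℝ → Fin T → ℂ) :
    IsMinimax γ b D h ↔ h =ᵐ[circ] charact γ b f₀ C := by
  have hfd : ∀ f ∈ D, IsSpectralDensity f := fun f hf => ((hF.mem_iff f).1 hf).1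
  have hG₀ := hm.isMinDensity (hfd f₀ hf₀)
  have hG₀' := hG₀.toIsSpectralDensity
  set r := residual (weighted γ f₀) C with hr
  have hp : ∀ f ∈ D, PastLim (weighted γ f) (bSeries b - r) := fun f hf =>
    hC.pastLim_of_const hG₀ hb hL (hfd f hf).weighted
  have hpast : ∀ f ∈ D, MemPast γ f (charact γ b f₀ C) := fun f hf =>
    ((memPast_smul_iff (hfd f hf) _).2 (hp f hf)).congr (hfd f hf) charact_ae_eq.symm
  have herr : ∀ f ∈ D, err γ b (charact γ b f₀ C) f = optErr γ b f₀ := fun f hf => by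
    rw [err_congr charact_ae_eq, err_eq (hfd f hf) hb (hp f hf).memL2, sub_sub_cancel,
      hF.nrm_residual_eq hf hf₀ hLS hL, optErr_eq (hfd f₀ hf₀) hb, hC.optVal_eq hG₀ hb]
  have hsup : ⨆ f ∈ D, err γ b (charact γ b f₀ C) f = optErr γ b f₀ :=
    le_antisymm (iSup₂_le fun f hf => (herr f hf).le)
      ((herr f₀ hf₀).symm.le.trans (le_iSup₂ (f := fun f (_ : f ∈ D) =>
        err γ b (charact γ b f₀ C) f) f₀ hf₀))
  constructor
  · rintro ⟨hh, hmin⟩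
    have h1 : err γ b h f₀ ≤ optErr γ b f₀ := by
      rw [← hsup]
      exact (le_iSup₂ (f := fun f (_ : f ∈ D) => err γ b h f) f₀ hf₀).trans (hmin _ hpast)
    have hv := (memPast_iff (hfd f₀ hf₀) h).1 (hh f₀ hf₀)
    set v : ℝ → Fin T → ℂ := fun l => (chi γ l / beta γ l)⁻¹ • h l with hvdef
    rw [err_congr (ae_eq_smul_transfer (γ := γ) h), err_eq (hfd f₀ hf₀) hb hv.memL2,
      optErr_eq (hfd f₀ hf₀) hb, hC.optVal_eq hG₀ hb,
      ENNReal.ofReal_le_ofReal_iff (mul_nonneg (by positivity) (nrm_nonneg hG₀' _))] at h1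
    have h2 := le_of_mul_le_mul_left h1 (by positivity)
    have hd := hv.sub hG₀' (hp f₀ hf₀)
    have h3 := nrm_sub_of_orthogonal hG₀' (memL2_residual hG₀ hC.energy) (hC.orthogonal hG₀) hd
    rw [show residual (weighted γ f₀) C - (v - (bSeries b - r)) = bSeries b - v by
      rw [hr]; abel] at h3
    have h4 : nrm (weighted γ f₀) (v - (bSeries b - r)) = 0 :=
      le_antisymm (by linarith) (nrm_nonneg hG₀' _)
    have h5 := (integral_eq_zero_iff_of_nonneg_ae (by
      filter_upwards [hG₀'.posSemidef] with l hl using quad_nonneg hl _) hd.memL2.integrable).1 h4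
    refine (ae_eq_smul_transfer (γ := γ) h).trans (EventuallyEq.trans ?_ charact_ae_eq.symm)
    filter_upwards [h5, hG₀'.posSemidef, hG₀.isUnit_det] with l hl hpos hu
    have h6 := sub_eq_zero.1 (eq_zero_of_quad_eq_zero hpos hu hl)
    rw [← h6]
  · intro e
    refine ⟨fun f hf => (hpast f hf).congr (hfd f hf) e.symm, fun h' hh' => ?_⟩
    have h1 : ⨆ f ∈ D, err γ b h f = optErr γ b f₀ := by
      rw [← hsup]
      simp only [err_congr e]
    rw [h1]
    exact (iInf₂_le h' (hh' f₀ hf₀)).trans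
      (le_iSup₂ (f := fun f (_ : f ∈ D) => err γ b h' f) f₀ hf₀)

end Minimax

/-! ### Canonical factorization -/

section Factor

variable {T q : ℕ}

theorem isSpectralDensity_one :
    IsSpectralDensity fun _ : ℝ => (1 : Matrix (Fin q) (Fin q) ℂ) :=
  ⟨fun _ _ => integrable_const _, ae_of_all _ fun _ => PosSemidef.one⟩

theorem herm_one (x y : Fin q → ℂ) : herm 1 x y = ∑ i, x i * star (y i) := by
  simp [herm, dotProduct]

theorem quad_one_eq_sum (x : Fin q → ℂ) : quad 1 x = ∑ i, ‖x i‖ ^ 2 := by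
  rw [quad, herm_one, Complex.re_sum]
  refine Finset.sum_congr rfl fun i _ => ?_
  rw [Complex.star_def, Complex.mul_conj, Complex.ofReal_re, Complex.normSq_eq_norm_sq]

theorem herm_mul_conjTranspose (Ψ : Matrix (Fin T) (Fin q) ℂ) (x y : Fin T → ℂ) :
    herm (Ψ * Ψᴴ) x y = herm 1 (Ψᵀ *ᵥ x) (Ψᵀ *ᵥ y) := by
  rw [herm, herm, one_mulVec, ← mulVec_mulVec, dotProduct_mulVec, mulVec_transpose,
    mulVec_transpose, star_vecMul]

/-- The Cauchy–Schwarz inequality for the standard inner product. -/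
theorem norm_integral_herm_one_sq_le {u w : ℝ → Fin q → ℂ} (hu : MemL2 (fun _ => 1) u)
    (hw : MemL2 (fun _ => 1) w) :
    ‖∫ l, herm 1 (u l) (w l) ∂circ‖ ^ 2 ≤ nrm (fun _ => 1) u * nrm (fun _ => 1) w :=
  norm_integral_herm_sq_le isSpectralDensity_one hu hw

theorem two_pi_mul_fcoeff_eq (u : ℝ → Fin q → ℂ) (i : Fin q) (k : ℤ) :
    2 * Real.pi * fcoeff (fun l => u l i) k =
      ∫ l, herm 1 (u l) (expo k l • Pi.single i 1) ∂circ := by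
  have := integral_herm_expo_eq (G := fun _ : ℝ => (1 : Matrix (Fin q) (Fin q) ℂ)) u i k
  simp only [transpose_one, one_mulVec] at this
  exact this.symm

theorem memL2_one_const_expo (i : Fin q) (k : ℤ) :
    MemL2 (fun _ => 1) fun l => expo k l • (Pi.single i 1 : Fin q → ℂ) := by
  refine memL2_of_bounded isSpectralDensity_one (M := ‖(Pi.single i 1 : Fin q → ℂ)‖)
    (Continuous.aestronglyMeasurable (by fun_prop)) (ae_of_all _ fun l => ?_)
  rw [norm_smul, norm_expo, one_mul]

variable {G : ℝ → Matrix (Fin T) (Fin T) ℂ} {Φ : ℝ → Matrix (Fin T) (Fin q) ℂ}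

/-- Multiplication by `Φᵀ` is an isometry from `L₂(ΦΦ*)` into `L₂`. -/
theorem memL2_transpose_mulVec (hΦm : ∀ i j, Integrable (fun l => Φ l i j) circ)
    (hΦ : ∀ᵐ l ∂circ, G l = Φ l * (Φ l)ᴴ) {h : ℝ → Fin T → ℂ} (hh : MemL2 G h) :
    MemL2 (fun _ => 1) fun l => (Φ l)ᵀ *ᵥ h l := by
  refine ⟨aesm_pi fun i => ?_, hh.integrable.congr ?_⟩
  · simp only [mulVec, dotProduct, transpose_apply]
    exact Finset.aestronglyMeasurable_fun_sum _ fun j _ =>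
      (hΦm j i).aestronglyMeasurable.mul (aesm_apply hh.aesm j)
  · filter_upwards [hΦ] with l hl
    rw [quad, hl, herm_mul_conjTranspose]
    rfl

theorem nrm_transpose_mulVec (hΦ : ∀ᵐ l ∂circ, G l = Φ l * (Φ l)ᴴ) (h : ℝ → Fin T → ℂ) :
    nrm (fun _ => 1) (fun l => (Φ l)ᵀ *ᵥ h l) = nrm G h := by
  refine integral_congr_ae ?_
  filter_upwards [hΦ] with l hl
  rw [quad, quad, hl, herm_mul_conjTranspose]

theorem eq_zero_of_forall_norm_sq_le {z : ℂ} {K : ℝ} (hK : 0 ≤ K)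
    (h : ∀ ε : ℝ, 0 < ε → ‖z‖ ^ 2 ≤ K * ε) : z = 0 := by
  have h0 : ‖z‖ ^ 2 ≤ 0 := by
    refine le_of_forall_pos_le_add fun ε hε => ?_
    refine (h (ε / (K + 1)) (by positivity)).trans ?_
    rw [zero_add, ← mul_div_assoc, div_le_iff₀ (by positivity)]
    nlinarith
  have : ‖z‖ = 0 := by nlinarith [norm_nonneg z]
  simpa using this

/-- `Φᵀ g` has no Fourier coefficients of index `k ≥ 0` for `g` in the past, if those of `Φ` vanish
for `k > 0`. -/
theorem PastLim.fcoeff_transpose_mulVec (hG : IsSpectralDensity G)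
    (hΦm : ∀ i j, Integrable (fun l => Φ l i j) circ)
    (hΦ : ∀ᵐ l ∂circ, G l = Φ l * (Φ l)ᴴ)
    (h0 : ∀ i j (k : ℤ), 0 < k → fcoeff (fun l => Φ l i j) k = 0) {g : ℝ → Fin T → ℂ}
    (hg : PastLim G g) (i : Fin q) {k : ℤ} (hk : 0 ≤ k) :
    fcoeff (fun l => ((Φ l)ᵀ *ᵥ g l) i) k = 0 := by
  have hQ0 : ∀ Q ∈ pastSpan T, fcoeff (fun l => ((Φ l)ᵀ *ᵥ Q l) i) k = 0 := by
    rintro _ ⟨N, x, rfl⟩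
    have e : ∀ l, ((Φ l)ᵀ *ᵥ pastFun N x l) i = ∑ n ∈ Finset.range N, ∑ j,
        x n j * (expo (-((n : ℤ) + 1)) l * Φ l j i) := fun l => by
      rw [pastFun_eq, mulVec_sum, Finset.sum_apply]
      refine Finset.sum_congr rfl fun n _ => ?_
      rw [mulVec_smul, Pi.smul_apply, smul_eq_mul, mulVec, dotProduct, Finset.mul_sum]
      refine Finset.sum_congr rfl fun j _ => ?_
      rw [transpose_apply]
      ring
    have hi : ∀ (n : ℕ) (j : Fin T),
        Integrable (fun l => expo (-((n : ℤ) + 1)) l * Φ l j i) circ := fun n j => by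
      simpa only [mul_comm] using integrable_mul_expo (hΦm j i) (-((n : ℤ) + 1))
    simp only [e]
    rw [fcoeff_sum _ fun n _ => integrable_finsetSum _ fun j _ => (hi n j).const_mul _]
    refine Finset.sum_eq_zero fun n _ => ?_
    rw [fcoeff_sum _ fun j _ => (hi n j).const_mul _]
    refine Finset.sum_eq_zero fun j _ => ?_
    rw [fcoeff_const_mul, fcoeff_expo_mul, h0 _ _ _ (by lia), mul_zero]
  have hone := isSpectralDensity_one (q := q)
  have hi : ∀ h : ℝ → Fin T → ℂ, MemL2 G h →
      Integrable (fun l => ((Φ l)ᵀ *ᵥ h l) i) circ := fun h hh => by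
    have := hone.integrable_transpose_mulVec (memL2_transpose_mulVec hΦm hΦ hh) i
    simpa using this
  have h2π := two_pi_ne_zero
  refine (mul_eq_zero.1 (eq_zero_of_forall_norm_sq_le
    (z := 2 * Real.pi * fcoeff (fun l => ((Φ l)ᵀ *ᵥ g l) i) k)
    (K := nrm (fun _ => 1) fun l => expo k l • (Pi.single i 1 : Fin q → ℂ))
    (nrm_nonneg hone _) fun ε hε => ?_)).resolve_left h2π
  obtain ⟨Q, hQ, hlt⟩ := hg.approx ε hε
  have hd := hg.memL2.sub hG (memL2_of_mem hG hQ)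
  have h1 : fcoeff (fun l => ((Φ l)ᵀ *ᵥ g l) i) k =
      fcoeff (fun l => ((Φ l)ᵀ *ᵥ (g - Q) l) i) k := by
    have := fcoeff_sub (hi g hg.memL2) (hi Q (memL2_of_mem hG hQ)) k
    rw [hQ0 Q hQ, sub_zero] at this
    rw [← this]
    congr 1
    ext l
    simp [mulVec_sub]
  rw [h1, two_pi_mul_fcoeff_eq (fun l => (Φ l)ᵀ *ᵥ (g - Q) l)]
  refine (norm_integral_herm_one_sq_le (memL2_transpose_mulVec hΦm hΦ hd)
    (memL2_one_const_expo i k)).trans ?_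
  rw [nrm_transpose_mulVec hΦ, mul_comm]
  exact mul_le_mul_of_nonneg_left hlt.le (nrm_nonneg hone _)

/-- If `r` is orthogonal to the past then `Φᵀ r` has no Fourier coefficients of index `k < 0`: the
canonical property approximates `e^{ikλ} δ_j` by `Φᵀ Q` with `Q` in the past. -/
theorem IsCanonicalFactor.fcoeff_residual {γ : GMType} {f : ℝ → Matrix (Fin T) (Fin T) ℂ}
    {φ : ℕ → Matrix (Fin T) (Fin q) ℂ} (hΦ : IsCanonicalFactor γ f φ Φ)
    (hG : IsSpectralDensity (weighted γ f)) {r : ℝ → Fin T → ℂ} (hr : MemL2 (weighted γ f) r)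
    (horth : ∀ Q ∈ pastSpan T, ∫ l, herm (weighted γ f l) (r l) (Q l) ∂circ = 0) (j : Fin q)
    {k : ℤ} (hk : k < 0) : fcoeff (fun l => ((Φ l)ᵀ *ᵥ r l) j) k = 0 := by
  have hone := isSpectralDensity_one (q := q)
  have hΦm : ∀ i j, Integrable (fun l => Φ l i j) circ := fun i j => (hΦ.series i j).1
  have hu := memL2_transpose_mulVec hΦm hΦ.factor hr
  refine (mul_eq_zero.1 (eq_zero_of_forall_norm_sq_le
    (z := 2 * Real.pi * fcoeff (fun l => ((Φ l)ᵀ *ᵥ r l) j) k)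
    (K := nrm (fun _ => 1) fun l => (Φ l)ᵀ *ᵥ r l)
    (nrm_nonneg hone _) fun ε hε => ?_)).resolve_left two_pi_ne_zero
  -- `w = Φᵀ (e^{ikλ} P) - e^{ikλ} δ_j` is small, and `Φᵀ r` is orthogonal to its first term.
  obtain ⟨N, x, hlt⟩ := hΦ.innovation j (ENNReal.ofReal ε) (ENNReal.ofReal_pos.2 hε)
  set P : ℝ → Fin T → ℂ := fun l => ∑ n ∈ Finset.range N, Complex.exp (-Complex.I * n * l) • x n
    with hP
  have hQ : (fun l => expo k l • P l) ∈ pastSpan T := by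
    have : (fun l => expo k l • P l) = ∑ n ∈ Finset.range N, fun l => expo (k - n) l • x n := by
      ext1 l
      rw [hP, Finset.sum_apply, Finset.smul_sum]
      refine Finset.sum_congr rfl fun n _ => ?_
      rw [smul_smul, expo, expo, ← Complex.exp_add]
      congr 2
      push_cast
      ring
    rw [this]
    exact sum_mem fun n _ => expo_smul_mem (by lia) (x n)
  have hPm : MemL2 (weighted γ f) fun l => expo k l • P l := memL2_of_mem hG hQ
  have hPu := memL2_transpose_mulVec hΦm hΦ.factor hPm
  have hs := memL2_one_const_expo j k
  have hd := hPu.sub hone hs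
  have hnrm : nrm (fun _ => 1) ((fun l => (Φ l)ᵀ *ᵥ (expo k l • P l)) -
      fun l => expo k l • (Pi.single j 1 : Fin q → ℂ)) ≤ ε := by
    rw [← ENNReal.ofReal_le_ofReal_iff hε.le, ← lintegral_quad hone hd]
    refine le_of_eq_of_le ?_ hlt.le
    have hmeas : ∀ i, AEMeasurable (fun l => ‖(P l ᵥ* Φ l) i -
        (1 : Matrix (Fin q) (Fin q) ℂ) j i‖ₑ ^ 2) circ := fun i => by
      refine (AEStronglyMeasurable.enorm ?_).pow_const 2
      refine AEStronglyMeasurable.sub ?_ aestronglyMeasurable_const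
      simp only [vecMul, dotProduct]
      refine Finset.aestronglyMeasurable_fun_sum _ fun m _ =>
        AEStronglyMeasurable.mul ?_ (hΦm m i).aestronglyMeasurable
      exact Continuous.aestronglyMeasurable (by fun_prop)
    rw [← lintegral_finsetSum' _ fun i _ => hmeas i]
    refine lintegral_congr fun l => ?_
    rw [quad_one_eq_sum, ENNReal.ofReal_sum_of_nonneg fun _ _ => sq_nonneg _]
    refine Finset.sum_congr rfl fun i _ => ?_
    rw [ENNReal.ofReal_pow (norm_nonneg _), ofReal_norm]
    congr 1
    rw [Pi.sub_apply, mulVec_smul, ← smul_sub, Pi.smul_apply, smul_eq_mul, enorm_mul]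
    have h1 : ‖expo k l‖ₑ = 1 := by rw [← ofReal_norm, norm_expo, ENNReal.ofReal_one]
    rw [h1, one_mul, Pi.sub_apply, mulVec_transpose]
    congr 2
    rw [one_apply, Pi.single_apply]
    simp only [eq_comm]
  have h0 : ∫ l, herm 1 ((Φ l)ᵀ *ᵥ r l) ((Φ l)ᵀ *ᵥ (expo k l • P l)) ∂circ = 0 := by
    rw [← horth _ hQ]
    refine integral_congr_ae ?_
    filter_upwards [hΦ.factor] with l hl
    rw [hl, herm_mul_conjTranspose]
  have h1 := norm_integral_herm_one_sq_le hu hd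
  simp only [Pi.sub_apply, herm_sub_right] at h1
  rw [integral_sub (integrable_herm hone hu hPu) (integrable_herm hone hu hs), h0, zero_sub,
    norm_neg] at h1
  rw [two_pi_mul_fcoeff_eq (fun l => (Φ l)ᵀ *ᵥ r l)]
  exact h1.trans (mul_le_mul_of_nonneg_left hnrm (nrm_nonneg hone _))

/-- The Fourier coefficients of `Φᵀ B` of index `k ≥ 0` are `∑_m φ(m)ᵀ b(m + k)`. -/
theorem fcoeff_transpose_mulVec_bSeries {φ : ℕ → Matrix (Fin T) (Fin q) ℂ} {b : ℕ → Fin T → ℂ}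
    (hb : Summable fun k => ‖b k‖)
    (hΦ : ∀ i j, IsTrigSum (fun k => if k ≤ 0 then φ (-k).toNat i j else 0) fun l => Φ l i j)
    (i : Fin q) (k : ℕ) :
    fcoeff (fun l => ((Φ l)ᵀ *ᵥ bSeries b l) i) k = rCoeff b φ k i := by
  have hterm : ∀ (i : Fin q) (j : Fin T), HasSum (fun m : ℕ => φ m j i * b (m + k) j)
      (fcoeff (fun l => bSeries b l j * Φ l j i) k) := by
    intro i j
    have h := hasSum_fcoeff_mul (summable_apply hb j) (hΦ j i).1 k
    simp only [← bSeries_apply hb, (hΦ j i).2] at h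
    rw [← hasSum_nat_add_iff' k, Finset.sum_eq_zero, sub_zero] at h
    · refine h.congr_fun fun m => ?_
      have h1 : (-((k : ℤ) - ((m + k : ℕ) : ℤ))).toNat = m := by lia
      rw [if_pos (by lia), h1, mul_comm]
    · intro m hm
      rw [if_neg (by have := Finset.mem_range.1 hm; lia), mul_zero]
  have hi : ∀ j, Integrable (fun l => bSeries b l j * Φ l j i) circ := fun j =>
    (hΦ j i).1.bdd_mul (c := ∑' k, ‖b k‖)
      ((continuous_apply j).comp (continuous_bSeries hb)).aestronglyMeasurable
      (ae_of_all _ fun l => (norm_le_pi_norm _ j).trans (norm_bSeries_le hb l))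
  have hvec : HasSum (fun m : ℕ => (φ m)ᵀ *ᵥ b (m + k))
      fun i => ∑ j, fcoeff (fun l => bSeries b l j * Φ l j i) k := by
    rw [Pi.hasSum]
    intro i
    exact hasSum_sum fun j _ => hterm i j
  rw [rCoeff, hvec.tsum_eq]
  change _ = ∑ j, fcoeff (fun l => bSeries b l j * Φ l j i) k
  rw [← fcoeff_sum _ fun j _ => hi j]
  congr 1
  ext l
  simp only [mulVec, dotProduct, transpose_apply, mul_comm]

/-- The sum of `∑_k (∑_m φ(m)ᵀ b(m + k)) e^{ikλ}` is `Φᵀ r`: with `r = B - g` the coefficients of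
index `k ≥ 0` are those of `Φᵀ B`, as `g` is in the past, and the others vanish. -/
theorem IsCanonicalFactor.ae_eq {γ : GMType} {f : ℝ → Matrix (Fin T) (Fin T) ℂ}
    {φ : ℕ → Matrix (Fin T) (Fin q) ℂ} (hΦ : IsCanonicalFactor γ f φ Φ)
    (hG : IsMinDensity (weighted γ f)) {b : ℕ → Fin T → ℂ} (hb : Summable fun k => ‖b k‖)
    {C : ℝ → Fin T → ℂ} (hC : IsSolution (weighted γ f) b C) {R : ℝ → Fin q → ℂ}
    (hR : IsAnalyticSum (rCoeff b φ) R) :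
    R =ᵐ[circ] fun l => (Φ l)ᵀ *ᵥ residual (weighted γ f) C l := by
  have hone := isSpectralDensity_one (q := q)
  have hG' := hG.toIsSpectralDensity
  have hΦm : ∀ i j, Integrable (fun l => Φ l i j) circ := fun i j => (hΦ.series i j).1
  have hr := memL2_residual hG hC.energy
  have hg := hC.pastLim hG hb
  have hB := memL2_bSeries hG' hb
  have hi : ∀ h : ℝ → Fin T → ℂ, MemL2 (weighted γ f) h → ∀ i,
      Integrable (fun l => ((Φ l)ᵀ *ᵥ h l) i) circ := fun h hh i => by
    have := hone.integrable_transpose_mulVec (memL2_transpose_mulVec hΦm hΦ.factor hh) i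
    simpa using this
  have h : ∀ i, (fun l => R l i) =ᵐ[circ]
      fun l => ((Φ l)ᵀ *ᵥ residual (weighted γ f) C l) i := by
    intro i
    refine ae_eq_of_fcoeff_eq (hR i).1 (hi _ hr i) fun k => ?_
    refine ((hR i).2 k).trans ?_
    by_cases hk : 0 ≤ k
    · have h1 := hg.fcoeff_transpose_mulVec hG' hΦm hΦ.factor (fun i j k hk => by
        exact ((hΦ.series i j).2 k).trans (if_neg (not_le.2 hk))) i hk
      have h2 := fcoeff_sub (hi _ hB i) (hi _ hr i) k
      have h3 := fcoeff_transpose_mulVec_bSeries hb hΦ.series i k.toNat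
      rw [Int.toNat_of_nonneg hk] at h3
      simp only [Pi.sub_apply, mulVec_sub] at h1
      rw [h1, h3] at h2
      exact (if_pos hk).trans (sub_eq_zero.1 h2.symm)
    · refine (if_neg hk).trans ?_
      rw [hΦ.fcoeff_residual hG' hr (hC.orthogonal hG) i (not_le.1 hk)]
  have h' : ∀ᵐ l ∂circ, ∀ i, R l i = ((Φ l)ᵀ *ᵥ residual (weighted γ f) C l) i :=
    ae_all_iff.2 h
  filter_upwards [h'] with l hl
  exact funext hl

theorem vecMulVec_transpose_mulVec (Ψ : Matrix (Fin T) (Fin q) ℂ) (x : Fin T → ℂ) :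
    vecMulVec (Ψᵀ *ᵥ x) (star (Ψᵀ *ᵥ x)) = Ψᵀ * vecMulVec x (star x) * Ψ.map star := by
  rw [mul_vecMulVec, vecMulVec_mul, star_mulVec]
  rfl

theorem transpose_mul_mul_map_inj {Ψ : Matrix (Fin T) (Fin q) ℂ} (hu : IsUnit (Ψ * Ψᴴ).det)
    {A B : Matrix (Fin T) (Fin T) ℂ} :
    Ψᵀ * A * Ψ.map star = Ψᵀ * B * Ψ.map star ↔ A = B := by
  refine ⟨fun h => ?_, fun h => by rw [h]⟩
  have hu' : IsUnit (Ψ.map star * Ψᵀ) := by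
    have h1 : Ψ.map star * Ψᵀ = (Ψ * Ψᴴ)ᵀ := by
      rw [transpose_mul]
      rfl
    rw [h1, isUnit_iff_isUnit_det, det_transpose]
    exact hu
  have h2 := congrArg (fun M => Ψ.map star * M * Ψᵀ) h
  simp only [Matrix.mul_assoc] at h2
  rw [← Matrix.mul_assoc, ← Matrix.mul_assoc (Ψ.map star) Ψᵀ (B * _)] at h2
  have h3 := hu'.mul_right_inj.1 h2
  exact hu'.mul_left_inj.1 h3

/-- In terms of the canonical factor the equation with multipliers again reads `r r* = Λ`. -/
theorem IsCanonicalFactor.lagrange_iff_residual {γ : GMType} {f : ℝ → Matrix (Fin T) (Fin T) ℂ}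
    {φ : ℕ → Matrix (Fin T) (Fin q) ℂ} (hΦ : IsCanonicalFactor γ f φ Φ)
    (hG : IsMinDensity (weighted γ f)) {b : ℕ → Fin T → ℂ} (hb : Summable fun k => ‖b k‖)
    {C : ℝ → Fin T → ℂ} (hC : IsSolution (weighted γ f) b C) {R : ℝ → Fin q → ℂ}
    (hR : IsAnalyticSum (rCoeff b φ) R) (L : Matrix (Fin T) (Fin T) ℂ) :
    (∀ᵐ l ∂circ, vecMulVec (R l) (star (R l)) = (Φ l)ᵀ * L * (Φ l).map star) ↔
      ∀ᵐ l ∂circ, vecMulVec (residual (weighted γ f) C l)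
        (star (residual (weighted γ f) C l)) = L := by
  have key : ∀ᵐ l ∂circ, (vecMulVec (R l) (star (R l)) = (Φ l)ᵀ * L * (Φ l).map star ↔
      vecMulVec (residual (weighted γ f) C l) (star (residual (weighted γ f) C l)) = L) := by
    filter_upwards [hΦ.ae_eq hG hb hC hR, hΦ.factor, hG.isUnit_det] with l h1 h2 hu
    rw [h1, vecMulVec_transpose_mulVec]
    exact transpose_mul_mul_map_inj (h2 ▸ hu)
  constructor <;> intro h <;> filter_upwards [key, h] with l h1 h2
  · exact h1.1 h2
  · exact h1.2 h2

end Factor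

/-! ### Mean square errors of linear estimates -/

section Stochastic

variable {Ω : Type*} [MeasurableSpace Ω] {T : ℕ} {γ : GMType} {P : Measure Ω}
  {ξ : ℤ → Ω → Fin T → ℂ} {f : ℝ → Matrix (Fin T) (Fin T) ℂ}

theorem HasSpectralDensity.memLp_incr (h : HasSpectralDensity γ P ξ f) (m : ℤ) (p : Fin T) :
    MemLp (fun ω => incr γ ξ m ω p) 2 P := h.memLp γ.mu γ.mu_pos m p

theorem herm_sum_sum (M : Matrix (Fin T) (Fin T) ℂ) {ι : Type*} (s : Finset ι) (c : ι → ℂ)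
    (x : ι → Fin T → ℂ) : herm M (∑ i ∈ s, c i • x i) (∑ j ∈ s, c j • x j) =
      ∑ i ∈ s, ∑ j ∈ s, c i * star (c j) * herm M (x i) (x j) := by
  simp only [herm, star_sum, mulVec_sum, sum_dotProduct, dotProduct_sum, star_smul, mulVec_smul,
    smul_dotProduct, dotProduct_smul, smul_eq_mul, Finset.mul_sum]
  rw [Finset.sum_comm]
  refine Finset.sum_congr rfl fun i _ => Finset.sum_congr rfl fun j _ => ?_
  ring

theorem herm_single_single (M : Matrix (Fin T) (Fin T) ℂ) (p q : Fin T) :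
    herm M (Pi.single p 1) (Pi.single q 1) = M p q := by
  rw [herm_single_right]
  simp

theorem HasSpectralDensity.integral_incr_mul (h : HasSpectralDensity γ P ξ f) (m k : ℤ)
    (p q : Fin T) :
    ∫ ω, incr γ ξ m ω p * star (incr γ ξ k ω q) ∂P = (1 / (2 * Real.pi) : ℂ) *
      ∫ l, herm (weighted γ f l) (expo m l • Pi.single p 1) (expo k l • Pi.single q 1) ∂circ := by
  refine (h.structural γ.mu γ.mu_pos γ.mu γ.mu_pos m k p q).trans ?_
  congr 2
  ext l
  change Complex.exp (Complex.I * l * (m - k)) *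
    (chi γ l * star (chi γ l) / ((‖beta γ l‖ ^ 2 : ℝ) : ℂ)) * f l p q = _
  rw [herm_smul_left, herm_smul_right, herm_single_single, star_expo, ← mul_assoc, ← expo_add,
    weighted, Matrix.smul_apply, smul_eq_mul, weight, Complex.star_def, Complex.mul_conj,
    Complex.normSq_eq_norm_sq, expo, ← mul_assoc]
  congr 2
  · congr 1
    push_cast
    ring
  · push_cast
    rfl

/-- The isometry between linear combinations of increments and trigonometric polynomials. -/
theorem HasSpectralDensity.lintegral_sum_sq (hf : IsSpectralDensity f)
    (h : HasSpectralDensity γ P ξ f) {ι : Type*} (s : Finset ι) (t : ι → ℤ)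
    (y : ι → Fin T → ℂ) :
    ∫⁻ ω, ‖∑ i ∈ s, y i ⬝ᵥ incr γ ξ (t i) ω‖ₑ ^ 2 ∂P =
      sqNorm (weighted γ f) fun l => ∑ i ∈ s, expo (t i) l • y i := by
  have hG := hf.weighted (γ := γ)
  set X : ι × Fin T → Ω → ℂ := fun j ω => incr γ ξ (t j.1) ω j.2 with hX
  set e : ι × Fin T → ℝ → Fin T → ℂ := fun j l => expo (t j.1) l • Pi.single j.2 1 with he
  set c : ι × Fin T → ℂ := fun j => y j.1 j.2 with hc
  have hY : ∀ ω, ∑ i ∈ s, y i ⬝ᵥ incr γ ξ (t i) ω = ∑ j ∈ s ×ˢ Finset.univ, c j * X j ω :=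
    fun ω => by rw [Finset.sum_product]; rfl
  have hu : ∀ l, ∑ i ∈ s, expo (t i) l • y i = ∑ j ∈ s ×ˢ Finset.univ, c j • e j l := fun l => by
    rw [Finset.sum_product]
    refine Finset.sum_congr rfl fun i _ => ?_
    simp only [hc, he]
    rw [← Finset.sum_congr rfl fun p _ => smul_comm (expo (t i) l) (y i p)
      (Pi.single p (1 : ℂ) : Fin T → ℂ), ← Finset.smul_sum]
    congr 1
    ext q
    simp [Finset.sum_apply, Pi.single_apply]
  simp only [hY, hu]
  set J := s ×ˢ (Finset.univ : Finset (Fin T))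
  have hXm : ∀ j, MemLp (X j) 2 P := fun j => h.memLp_incr _ _
  have hem : ∀ j, MemL2 (weighted γ f) (e j) := fun j =>
    memL2_of_bounded hG (M := ‖(Pi.single j.2 1 : Fin T → ℂ)‖)
      (Continuous.aestronglyMeasurable (by fun_prop)) (ae_of_all _ fun l => by
        rw [he, norm_smul, norm_expo, one_mul])
  have hXi : ∀ i j, Integrable (fun ω => X i ω * star (X j ω)) P := fun i j =>
    (hXm i).integrable_mul (hXm j).star
  have hYm : MemLp (fun ω => ∑ j ∈ J, c j * X j ω) 2 P :=
    memLp_finsetSum _ fun j _ => (hXm j).const_mul (c j)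
  have hum : MemL2 (weighted γ f) fun l => ∑ j ∈ J, c j • e j l := by
    refine ⟨?_, ?_⟩
    · exact Finset.aestronglyMeasurable_fun_sum _ fun j _ => (hem j).aesm.const_smul (c j)
    · have h1 : ∀ l, quad (weighted γ f l) (∑ j ∈ J, c j • e j l) =
          (∑ i ∈ J, ∑ j ∈ J, c i * star (c j) * herm (weighted γ f l) (e i l) (e j l)).re :=
        fun l => by rw [quad, herm_sum_sum]
      simp only [h1]
      exact (integrable_finsetSum _ fun i _ => integrable_finsetSum _ fun j _ =>
        (integrable_herm hG (hem i) (hem j)).const_mul _).re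
  have key : ∫ ω, (∑ j ∈ J, c j * X j ω) * star (∑ j ∈ J, c j * X j ω) ∂P =
      (1 / (2 * Real.pi) : ℂ) * ∫ l, herm (weighted γ f l) (∑ j ∈ J, c j • e j l)
        (∑ j ∈ J, c j • e j l) ∂circ := by
    simp only [herm_sum_sum]
    rw [integral_finsetSum _ fun i _ => integrable_finsetSum _ fun j _ =>
      (integrable_herm hG (hem i) (hem j)).const_mul _, Finset.mul_sum]
    have h1 : ∀ ω, (∑ j ∈ J, c j * X j ω) * star (∑ j ∈ J, c j * X j ω) =
        ∑ i ∈ J, ∑ j ∈ J, c i * star (c j) * (X i ω * star (X j ω)) := fun ω => by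
      rw [star_sum, Finset.sum_mul_sum]
      refine Finset.sum_congr rfl fun i _ => Finset.sum_congr rfl fun j _ => ?_
      rw [star_mul']
      ring
    simp only [h1]
    rw [integral_finsetSum _ fun i _ => integrable_finsetSum _ fun j _ => (hXi i j).const_mul _]
    refine Finset.sum_congr rfl fun i _ => ?_
    rw [integral_finsetSum _ fun j _ => (hXi i j).const_mul _,
      integral_finsetSum _ fun j _ => (integrable_herm hG (hem i) (hem j)).const_mul _,
      Finset.mul_sum]
    refine Finset.sum_congr rfl fun j _ => ?_
    rw [integral_const_mul, integral_const_mul, h.integral_incr_mul]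
    ring
  have hsq : ∫ ω, ‖∑ j ∈ J, c j * X j ω‖ ^ 2 ∂P =
      1 / (2 * Real.pi) * nrm (weighted γ f) fun l => ∑ j ∈ J, c j • e j l := by
    have h1 : ((∫ ω, ‖∑ j ∈ J, c j * X j ω‖ ^ 2 ∂P : ℝ) : ℂ) =
        ((1 / (2 * Real.pi) * nrm (weighted γ f) fun l => ∑ j ∈ J, c j • e j l : ℝ) : ℂ) := by
      rw [← integral_complex_ofReal, Complex.ofReal_mul, nrm, ← integral_complex_ofReal]
      refine Eq.trans (integral_congr_ae (ae_of_all _ fun ω => ?_)) (key.trans ?_)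
      · rw [Complex.star_def, Complex.mul_conj, Complex.normSq_eq_norm_sq]
      · push_cast
        congr 1
        refine integral_congr_ae ?_
        filter_upwards [hG.posSemidef] with l hp using herm_self hp _
    exact_mod_cast h1
  rw [sqNorm_eq_ofReal hG hum, ← hsq, ofReal_integral_eq_lintegral_ofReal
    ((memLp_two_iff_integrable_sq_norm hYm.1).1 hYm) (ae_of_all _ fun ω => sq_nonneg _)]
  refine lintegral_congr fun ω => ?_
  rw [ENNReal.ofReal_pow (norm_nonneg _), ofReal_norm]

theorem tendsto_sqNorm_of_bounded {G : ℝ → Matrix (Fin T) (Fin T) ℂ} (hG : IsSpectralDensity G)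
    {v : ℕ → ℝ → Fin T → ℂ} {w : ℝ → Fin T → ℂ} (hv : ∀ n, Continuous (v n))
    (hw : Continuous w) {M : ℝ} (hM : ∀ n l, ‖v n l‖ ≤ M)
    (hlim : ∀ l, Tendsto (fun n => v n l) atTop (𝓝 (w l))) :
    Tendsto (fun n => sqNorm G (v n)) atTop (𝓝 (sqNorm G w)) := by
  have hwM : ∀ l, ‖w l‖ ≤ M := fun l =>
    le_of_tendsto (hlim l).norm (Eventually.of_forall fun n => hM n l)
  rw [sqNorm_eq_ofReal hG (memL2_of_bounded hG hw.aestronglyMeasurable (ae_of_all _ hwM))]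
  simp only [fun n => sqNorm_eq_ofReal hG
    (memL2_of_bounded hG (hv n).aestronglyMeasurable (ae_of_all _ (hM n)))]
  refine ENNReal.tendsto_ofReal (Tendsto.const_mul _ ?_)
  refine tendsto_integral_of_dominated_convergence
    (fun l => (∑ i, ∑ j, ‖G l i j‖) * M ^ 2) (fun n => aesm_quad hG (hv n).aestronglyMeasurable)
    ((integrable_finsetSum _ fun i _ => integrable_finsetSum _ fun j _ =>
      (hG.integrable i j).norm).mul_const _) (fun n => ?_) (ae_of_all _ fun l => ?_)
  · filter_upwards [hG.posSemidef] with l hp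
    rw [Real.norm_of_nonneg (quad_nonneg hp _)]
    refine (quad_le_sum _).trans ?_
    gcongr
    exact hM n l
  · exact ((continuous_quad (G l)).tendsto _).comp (hlim l)

theorem eLpNorm_two_sq {Z : Ω → ℂ} : eLpNorm Z 2 P ^ 2 = ∫⁻ ω, ‖Z ω‖ₑ ^ 2 ∂P := by
  have := eLpNorm_nnreal_pow_eq_lintegral (μ := P) (f := Z) (p := 2) two_ne_zero
  simpa using this

theorem aestronglyMeasurable_sum_dotProduct {η : ℤ → Ω → Fin T → ℂ}
    (hη : ∀ m p, AEStronglyMeasurable (fun ω => η m ω p) P) {ι : Type*} (s : Finset ι) (t : ι → ℤ)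
    (y : ι → Fin T → ℂ) : AEStronglyMeasurable (fun ω => ∑ i ∈ s, y i ⬝ᵥ η (t i) ω) P :=
  Finset.aestronglyMeasurable_fun_sum _ fun i _ => Finset.aestronglyMeasurable_fun_sum _ fun p _ =>
    (hη (t i) p).const_mul _

/-- The mean square error of a linear estimate is the error of its spectral characteristic. The
initial part `V ξ` cancels, and the partial sums of the functional are covered by the isometry. -/
theorem HasSpectralDensity.lintegral_estimate (hf : IsSpectralDensity f)
    (h : HasSpectralDensity γ P ξ f) {b : ℕ → Fin T → ℂ} (hb : Summable fun k => ‖b k‖)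
    {A : Ω → ℂ} (hA : IsFunctional γ P b ξ A) (N : ℕ) (x : ℕ → Fin T → ℂ) :
    ∫⁻ ω, ‖A ω - estimate γ b ξ N x ω‖ₑ ^ 2 ∂P =
      sqNorm (weighted γ f) (bSeries b - pastFun N x) := by
  have hG := hf.weighted (γ := γ)
  set Z : Ω → ℂ := fun ω => A ω - estimate γ b ξ N x ω with hZ
  set Y : ℕ → Ω → ℂ := fun n ω => (∑ k ∈ Finset.range n, b k ⬝ᵥ incr γ ξ k ω) -
    ∑ k ∈ Finset.range N, x k ⬝ᵥ incr γ ξ (-((k : ℤ) + 1)) ω with hY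
  set v : ℕ → ℝ → Fin T → ℂ := fun n l => (∑ k ∈ Finset.range n, expo k l • b k) - pastFun N x l
    with hv
  have hYv : ∀ n, eLpNorm (Y n) 2 P ^ 2 = sqNorm (weighted γ f) (v n) := by
    intro n
    have h1 := h.lintegral_sum_sq hf ((Finset.range n).disjSum (Finset.range N))
      (Sum.elim (fun k => (k : ℤ)) fun k => -((k : ℤ) + 1)) (Sum.elim b fun k => -x k)
    simp only [Finset.sum_disjSum, Sum.elim_inl, Sum.elim_inr, neg_dotProduct, smul_neg,
      Finset.sum_neg_distrib, ← sub_eq_add_neg] at h1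
    rw [eLpNorm_two_sq, h1]
    congr 1
    ext1 l
    simp only [hv, pastFun_eq]
  have hlim : Tendsto (fun n => sqNorm (weighted γ f) (v n)) atTop
      (𝓝 (sqNorm (weighted γ f) (bSeries b - pastFun N x))) := by
    obtain ⟨M, hM⟩ := bounded_of_mem (pastFun_mem N x)
    have hc := continuous_of_mem (pastFun_mem N x)
    refine tendsto_sqNorm_of_bounded hG (M := (∑' k, ‖b k‖) + M)
      (fun n => Continuous.sub (by fun_prop) hc) ((continuous_bSeries hb).sub hc)
      (fun n l => (norm_sub_le _ _).trans (add_le_add ?_ (hM l))) fun l => ?_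
    · refine (norm_sum_le _ _).trans ?_
      simp only [norm_smul, norm_expo, one_mul]
      exact hb.sum_le_tsum _ fun _ _ => norm_nonneg _
    · refine Tendsto.sub_const ?_ _
      rw [bSeries_eq]
      exact (summable_expo_smul hb l).hasSum.tendsto_sum_nat
  have hincr : ∀ m p, AEStronglyMeasurable (fun ω => incr γ ξ m ω p) P := fun m p =>
    (h.memLp_incr m p).aestronglyMeasurable
  have hYm : ∀ n, AEStronglyMeasurable (Y n) P := fun n =>
    (aestronglyMeasurable_sum_dotProduct hincr _ _ _).sub
      (aestronglyMeasurable_sum_dotProduct hincr _ _ _)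
  have hZm : AEStronglyMeasurable Z P := by
    refine hA.1.sub ((aestronglyMeasurable_sum_dotProduct hincr _ _ _).sub ?_)
    exact aestronglyMeasurable_sum_dotProduct h.measurable _ (fun i : ℕ => -((i : ℤ) + 1)) _
  have hd : Tendsto (fun n => eLpNorm (Y n - Z) 2 P) atTop (𝓝 0) := by
    refine hA.2.congr fun n => ?_
    congr 1
    ext ω
    simp only [Pi.sub_apply, hY, hZ, estimate]
    ring
  -- The norms of `Y n` tend both to the norm of `Z` and to `a`.
  set a : ℝ≥0∞ := sqNorm (weighted γ f) (bSeries b - pastFun N x) ^ (1 / 2 : ℝ) with ha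
  have hYlim : Tendsto (fun n => eLpNorm (Y n) 2 P) atTop (𝓝 a) := by
    have h1 := (ENNReal.continuous_rpow_const (y := 1 / 2)).tendsto _ |>.comp hlim
    refine h1.congr fun n => ?_
    rw [Function.comp_apply, ← hYv, ← ENNReal.rpow_natCast, ← ENNReal.rpow_mul]
    norm_num
  have hZa : eLpNorm Z 2 P = a := by
    refine le_antisymm ?_ ?_
    · refine ge_of_tendsto' (by simpa using hYlim.add hd) fun n => ?_
      have h1 := eLpNorm_sub_le (p := 2) (hYm n) ((hYm n).sub hZm) (by norm_num)
      rwa [sub_sub_cancel] at h1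
    · refine le_of_tendsto_of_tendsto' hYlim
        (by simpa using (tendsto_const_nhds (x := eLpNorm Z 2 P)).add hd) fun n => ?_
      have h1 := eLpNorm_add_le (p := 2) hZm ((hYm n).sub hZm) (by norm_num)
      rwa [add_sub_cancel] at h1
  rw [← eLpNorm_two_sq, hZa, ha, ← ENNReal.rpow_natCast, ← ENNReal.rpow_mul]
  norm_num

/-- The least mean square error is the value of the error functional. -/
theorem HasSpectralDensity.iInf_lintegral_estimate (hf : IsSpectralDensity f)
    (h : HasSpectralDensity γ P ξ f) {b : ℕ → Fin T → ℂ} (hb : Summable fun k => ‖b k‖)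
    {A : Ω → ℂ} (hA : IsFunctional γ P b ξ A) :
    ⨅ (N : ℕ) (x : ℕ → Fin T → ℂ), ∫⁻ ω, ‖A ω - estimate γ b ξ N x ω‖ₑ ^ 2 ∂P =
      optErr γ b f := by
  have hG := hf.weighted (γ := γ)
  simp only [h.lintegral_estimate hf hb hA]
  rw [optErr_eq hf hb, ofReal_optVal hG (memL2_bSeries hG hb)]
  refine le_antisymm (le_iInf fun Q => ?_) (le_iInf fun N => le_iInf fun x => ?_)
  · obtain ⟨N, x, hQ⟩ := Q.2
    rw [hQ]
    exact iInf₂_le (f := fun N x => sqNorm (weighted γ f) (bSeries b - pastFun N x)) N x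
  · exact iInf_le (fun Q : pastSpan T => sqNorm (weighted γ f) (bSeries b - Q.1))
      ⟨_, pastFun_mem N x⟩

end Stochastic

end GMForecast

end

theorem mainTheorem9 (γ : GMForecast.GMType) (T : ℕ) (hT : 0 < T)
    (a : ℕ → Fin T → ℂ) (ha : GMForecast.AdmissibleCoeffs γ a)
    (b : ℕ → Fin T → ℂ) (hb : b = GMForecast.dTransform γ a) :
    -- the error functional on densities is the mean square error of estimation of the functional
    (∀ (Ω : Type*) [MeasurableSpace Ω] (P : Measure Ω) [IsProbabilityMeasure P]
      (ξ : ℤ → Ω → Fin T → ℂ) (f : ℝ → Matrix (Fin T) (Fin T) ℂ) (A : Ω → ℂ),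
      GMForecast.IsSpectralDensity f → GMForecast.HasSpectralDensity γ P ξ f →
      GMForecast.IsFunctional γ P b ξ A →
      (⨅ (N : ℕ) (x : ℕ → Fin T → ℂ),
        ∫⁻ ω, ‖A ω - GMForecast.estimate γ b ξ N x ω‖ₑ ^ 2 ∂P) = GMForecast.optErr γ b f) ∧
    -- under the minimality condition `F⁻¹ D a` exists and is unique
    (∀ f : ℝ → Matrix (Fin T) (Fin T) ℂ, GMForecast.IsSpectralDensity f →
      GMForecast.Minimal γ f →
      ∃ C, GMForecast.IsFInverse γ f b C ∧
        ∀ C', GMForecast.IsFInverse γ f b C' → C' =ᵐ[GMForecast.circ] C) ∧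
    -- the four classes
    (∀ (D : Set (ℝ → Matrix (Fin T) (Fin T) ℂ)) (S : Set (Matrix (Fin T) (Fin T) ℂ)),
      GMForecast.MomentClass γ D S →
      ∀ f₀ ∈ D, GMForecast.Minimal γ f₀ → ∀ C : ℝ → Fin T → ℂ, GMForecast.IsFInverse γ f₀ b C →
        -- the equations with Lagrange multipliers
        (GMForecast.LeastFavourable γ b D f₀ ↔
          ∃ L ∈ S, ∀ᵐ l ∂GMForecast.circ,
            vecMulVec (C l) (star (C l)) =
              (GMForecast.weighted γ f₀ l)ᵀ * L * (GMForecast.weighted γ f₀ l)ᵀ) ∧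
        -- the constrained optimization problem
        (GMForecast.LeastFavourable γ b D f₀ ↔
          ∀ f ∈ D, GMForecast.Minimal γ f → ∀ C', GMForecast.IsFInverse γ f b C' →
            GMForecast.fInvForm b C' ≤ GMForecast.fInvForm b C) ∧
        -- the equations in terms of the canonical factorization
        (∀ (q : ℕ) (φ : ℕ → Matrix (Fin T) (Fin q) ℂ) (Φ : ℝ → Matrix (Fin T) (Fin q) ℂ)
          (R : ℝ → Fin q → ℂ), GMForecast.IsCanonicalFactor γ f₀ φ Φ →
          GMForecast.IsAnalyticSum (GMForecast.rCoeff b φ) R →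
          (GMForecast.LeastFavourable γ b D f₀ ↔
            ∃ L ∈ S, ∀ᵐ l ∂GMForecast.circ,
              vecMulVec (R l) (star (R l)) = (Φ l)ᵀ * L * (Φ l).map star)) ∧
        -- the minimax-robust spectral characteristic
        (GMForecast.LeastFavourable γ b D f₀ →
          GMForecast.IsOptimal γ b f₀ (GMForecast.charact γ b f₀ C) ∧
          ∀ h : ℝ → Fin T → ℂ, GMForecast.IsMinimax γ b D h ↔
            h =ᵐ[GMForecast.circ] GMForecast.charact γ b f₀ C)) := by
  have hb' : Summable fun k => ‖b k‖ := hb ▸ ha.summable_d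
  refine ⟨?_, ?_, ?_⟩
  · intro Ω _ P _ ξ f A hf hξ hA
    exact hξ.iInf_lintegral_estimate hf hb' hA
  · intro f hf hm
    have hG := hm.isMinDensity hf
    obtain ⟨C, hC, -⟩ := GMForecast.exists_isSolution hG hb'
    exact ⟨C, hC.isFInverse hf hm, fun C' hC' => (hC'.isSolution hf hm).unique hG hC⟩
  · intro D S hDS f₀ hf₀ hm C hC
    obtain ⟨ι, A, p, hF⟩ := hDS.exists_momentForm hT
    have hD : ∀ f ∈ D, GMForecast.IsSpectralDensity f := fun f hf => ((hF.mem_iff f).1 hf).1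
    have hG := hm.isMinDensity (hD f₀ hf₀)
    have hS := hC.isSolution (hD f₀ hf₀) hm
    have hLF := GMForecast.leastFavourable_iff (γ := γ) hD hb' hf₀
    have hres : GMForecast.LeastFavourable γ b D f₀ ↔ ∃ L ∈ S, ∀ᵐ l ∂GMForecast.circ,
        vecMulVec (GMForecast.residual (GMForecast.weighted γ f₀) C l)
          (star (GMForecast.residual (GMForecast.weighted γ f₀) C l)) = L := by
      rw [hLF]
      exact ⟨hF.exists_multiplier hT hf₀ hm hb' hS,
        fun ⟨L, hLS, hL⟩ f hf => hF.optVal_le hf hf₀ hm hb' hS hLS hL⟩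
    refine ⟨?_, ?_, ?_, ?_⟩
    · simp only [hres, GMForecast.lagrange_iff_residual hG]
    · rw [hLF, hF.isMax_iff hf₀ hm hb' hS]
    · intro q φ Φ R hΦ hR
      simp only [hres, hΦ.lagrange_iff_residual hG hb' hS hR]
    · intro h
      obtain ⟨L, hLS, hL⟩ := hres.1 h
      exact ⟨GMForecast.isOptimal_charact (hD f₀ hf₀) hm hb' hS,
        hF.isMinimax_iff hf₀ hm hb' hS hLS hL⟩
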